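/- Let $G_J=\exp(\mathfrak a)\ltimes\mathbb R^4$, where $\mathfrak a\subset\mathfrak{sl}_4(\mathbb R)$ is the space of diagonal matrices of trace zero and $(A,b)(A',b')=(AA',\,b+Ab')$; it is a simply connected unimodular solvable Lie group. Let $e_7=\mathrm{Diag}(1,1,-1,-1)$, $e_1=\mathrm{Diag}(1,-1,1,-1)$, $e_2=\mathrm{Diag}(1,-1,-1,1)$, a basis of $\mathfrak a$, let $e_3,\dots,e_6$ be the standard basis of $\mathbb R^4$, and let $\varphi$ be the left-invariant 3-form $$\varphi=\varphi_0:=e^{127}+e^{347}+e^{567}+e^{135}-e^{146}-e^{236}-e^{245}$$ on $G_J$. A $G_2$-structure on a 7-manifold is a smooth 3-form which at every point has the form $\varphi_0$ in some basis of the tangent space; such bases are oriented and orthonormal for the induced orientation and metric. It is called closed if $d\varphi=0$, and a closed $G_2$-structure is called ERP (extremally Ricci pinched) if its torsion form $\tau:=-*d*\varphi$ satisfies $$d\tau=\tfrac16|\tau|^2\varphi+\tfrac16*(\tau\wedge\tau).$$ Let $u_1,u_2,u_3,u_4$ be the numbers $2\cos(2\pi k/15)$, $k=1,2,4,7$, let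 $\phi=(u_i^{\,j-1})_{i,j}$ be their Vandermonde matrix, and let $$A_1=\begin{bmatrix}0&0&-1&-1\\0&0&-4&-5\\1&0&4&0\\0&1&1&5\end{bmatrix},\quad A_2=\begin{bmatrix}3&-1&-1&-1\\-4&-1&-5&-5\\0&0&3&-1\\1&1&1&4\end{bmatrix},\quad A_3=\begin{bmatrix}4&1&2&3\\3&8&9&14\\-1&-1&0&-3\\-1&-2&-3&-3\end{bmatrix}.$$ 1. $A_1,A_2,A_3\in\mathrm{SL}_4(\mathbb Z)$ commute pairwise, each has spectrum $\{u_1^2,\dots,u_4^2\}$, which consists of four distinct positive numbers, $\phi$ is invertible, and $\phi A_1\phi^{-1}=\mathrm{Diag}(u_1^2,u_2^2,u_3^2,u_4^2)$, $\phi A_2\phi^{-1}=\mathrm{Diag}(u_2^2,u_3^2,u_4^2,u_1^2)$, $\phi A_3\phi^{-1}=\mathrm{Diag}(u_3^2,u_4^2,u_1^2,u_2^2)$. The matrices $\phi A_j\phi^{-1}$ lie in $\exp(\mathfrak a)$ and generate a lattice (a discrete cocompact subgroup) $\Lambda$ of $\exp(\mathfrak a)$. 2. The set $\Gamma=\Lambda\ltimes\phi(\mathbb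 Z^4)$ is a subgroup of $G_J$ and a lattice in $G_J$. 3. The left-invariant form $\varphi$ is an ERP $G_2$-structure on $G_J$. The quotient $M$ of $G_J$ by left translations by $\Gamma$ is a compact connected 7-manifold (Hausdorff, smooth, with the projection $G_J\to M$ a local diffeomorphism), and $\varphi$ descends to an ERP $G_2$-structure $\varphi_M$ on $M$, whose torsion form $\tau$ vanishes nowhere. 4. Bryant's example is the following $G_2$-structure $\varphi_B$ on the homogeneous space $(\mathrm{SL}_2(\mathbb C)\ltimes\mathbb C^2)/\mathrm{SU}(2)$. Realize this space as the set of pairs $(h,v)$ of a positive definite Hermitian $2\times2$ matrix $h$ with $\det h=1$ and a vector $v\in\mathbb C^2$, with the action $(g,w)\cdot(h,v)=(ghg^*,gv+w)$; this action is transitive, and the stabilizer of the base point $(1,0)$ is $\mathrm{SU}(2)$. Let $\varphi_B$ be the invariant 3-form that at $(1,0)$ equals $\varphi_0$ with respect to the basis $e_1,\dots,e_7$ of the tangent space $i\,\mathfrak{su}(2)\oplus\mathbb C^2$ given by $e_7=\sigma_3$, $e_2=\sigma_1$, $e_1=-\sigma_2$ (Pauli matrices; $X\in i\,\mathfrak{su}(2)$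 is the velocity of $\exp(tX)\cdot(1,0)$ at $t=0$), $e_3=(1,0)$, $e_4=(i,0)$, $e_5=(0,1)$, $e_6=(0,-i)$. Then $\varphi_B$ is well defined and an ERP $G_2$-structure. 5. $\varphi_M$ is nowhere locally equivalent to Bryant's example, even up to scaling: for all $c>0$, $p\in M$ and all points $q$ there is no diffeomorphism $f$ from an open neighbourhood of $p$ onto an open neighbourhood of $q$ with $f(p)=q$ and $f^*(c\,\varphi_B)=\varphi_M$. In particular the conjecture of Cleyton and Ivanov, that every compact connected 7-manifold with an ERP $G_2$-structure that is not torsion-free is locally equivalent, up to scaling, to Bryant's example, is false. -/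

import Mathlib

open scoped Manifold ContDiff Matrix ComplexOrder

noncomputable section

/-! ## Differential forms on 7-dimensional manifolds -/

/-- The model space `ℝ⁷`; the vector `e_i` of the standard basis has index `i - 1`. -/
abbrev E7 : Type := EuclideanSpace ℝ (Fin 7)

/-- The model with corners of 7-manifolds without boundary. -/
abbrev I7 : ModelWithCorners ℝ E7 E7 := 𝓘(ℝ, E7)

/-- (Not necessarily smooth) differential `k`-forms on a 7-manifold. -/
abbrev DiffForm (k : ℕ) (M : Type*) [TopologicalSpace M] [ChartedSpace E7 M] : Type _ :=
  ∀ p : M, (TangentSpace I7 p) [⋀^Fin k]→L[ℝ] ℝ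

namespace DiffForm

variable {M N : Type*} [TopologicalSpace M] [ChartedSpace E7 M]
  [TopologicalSpace N] [ChartedSpace E7 N] {k : ℕ}

/-- The pullback `f^* η`. -/
def pullback (f : M → N) (η : DiffForm k N) : DiffForm k M :=
  fun p => (η (f p)).compContinuousLinearMap (mfderiv I7 I7 f p)

/-- The expression of `η` in the preferred chart at `p`, a form on (an open subset of) `ℝ⁷`. -/
def inChart (η : DiffForm k M) (p : M) : E7 → E7 [⋀^Fin k]→L[ℝ] ℝ :=
  pullback (chartAt E7 p).symm η

/-- A form is smooth when its expressions in the charts are. -/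
def IsSmooth (η : DiffForm k M) : Prop :=
  ∀ p : M, ContDiffOn ℝ ∞ (inChart η p) (chartAt E7 p).target

/-- The exterior derivative, computed at `p` in the preferred chart at `p`. -/
def d (η : DiffForm k M) : DiffForm (k + 1) M :=
  fun p => pullback (chartAt E7 p) (fun y : E7 => extDeriv (inChart η p) y) p

end DiffForm

/-! ## Multilinear algebra: wedge product, the model 3-form, Hodge star -/

section Pointwise

variable {V : Type*} [AddCommGroup V] [Module ℝ V] [TopologicalSpace V]

/-- The product `(v, w) ↦ α(v) β(w)` of two alternating forms, as a multilinear map. -/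
def altProd {k l : ℕ} (α : V [⋀^Fin k]→L[ℝ] ℝ) (β : V [⋀^Fin l]→L[ℝ] ℝ) :
    ContinuousMultilinearMap ℝ (fun _ : Fin (k + l) => V) ℝ where
  toFun v := α (fun i => v (Fin.castAdd l i)) * β (fun j => v (Fin.natAdd k j))
  map_update_add' := by
    intro _ v i x y
    obtain rfl := Subsingleton.elim ‹DecidableEq (Fin (k + l))› (instDecidableEqFin _)
    induction i using Fin.addCases with
    | left i =>
      have h1 : ∀ z : V, (fun a => Function.update v (Fin.castAdd l i) z (Fin.castAdd l a))
          = Function.update (fun a => v (Fin.castAdd l a)) i z := fun z =>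
        Function.update_comp_eq_of_injective v (Fin.castAdd_injective k l) i z
      have h2 : ∀ z : V, (fun a => Function.update v (Fin.castAdd l i) z (Fin.natAdd k a))
          = fun a => v (Fin.natAdd k a) := by
        intro z; funext a
        rw [Function.update_of_ne]
        intro h
        have := congrArg Fin.val h
        simp at this
        omega
      simp only [h1, h2, α.map_update_add]
      ring
    | right i =>
      have h1 : ∀ z : V, (fun a => Function.update v (Fin.natAdd k i) z (Fin.natAdd k a))
          = Function.update (fun a => v (Fin.natAdd k a)) i z := fun z =>
        Function.update_comp_eq_of_injective v (Fin.natAdd_injective l k) i z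
      have h2 : ∀ z : V, (fun a => Function.update v (Fin.natAdd k i) z (Fin.castAdd l a))
          = fun a => v (Fin.castAdd l a) := by
        intro z; funext a
        rw [Function.update_of_ne]
        intro h
        have := congrArg Fin.val h
        simp at this
        omega
      simp only [h1, h2, β.map_update_add]
      ring
  map_update_smul' := by
    intro _ v i c x
    obtain rfl := Subsingleton.elim ‹DecidableEq (Fin (k + l))› (instDecidableEqFin _)
    induction i using Fin.addCases with
    | left i =>
      have h1 : ∀ z : V, (fun a => Function.update v (Fin.castAdd l i) z (Fin.castAdd l a))
          = Function.update (fun a => v (Fin.castAdd l a)) i z := fun z =>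
        Function.update_comp_eq_of_injective v (Fin.castAdd_injective k l) i z
      have h2 : ∀ z : V, (fun a => Function.update v (Fin.castAdd l i) z (Fin.natAdd k a))
          = fun a => v (Fin.natAdd k a) := by
        intro z; funext a
        rw [Function.update_of_ne]
        intro h
        have := congrArg Fin.val h
        simp at this
        omega
      simp only [h1, h2, α.map_update_smul, smul_eq_mul]
      ring
    | right i =>
      have h1 : ∀ z : V, (fun a => Function.update v (Fin.natAdd k i) z (Fin.natAdd k a))
          = Function.update (fun a => v (Fin.natAdd k a)) i z := fun z =>
        Function.update_comp_eq_of_injective v (Fin.natAdd_injective l k) i z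
      have h2 : ∀ z : V, (fun a => Function.update v (Fin.natAdd k i) z (Fin.castAdd l a))
          = fun a => v (Fin.castAdd l a) := by
        intro z; funext a
        rw [Function.update_of_ne]
        intro h
        have := congrArg Fin.val h
        simp at this
        omega
      simp only [h1, h2, β.map_update_smul, smul_eq_mul]
      ring
  cont := by
    refine (α.cont.comp ?_).mul (β.cont.comp ?_) <;> fun_prop

/-- The wedge product
`(α ∧ β)(v) = 1/(k! l!) ∑_σ sgn(σ) α(v_σ(1), …, v_σ(k)) β(v_σ(k+1), …, v_σ(k+l))`. -/
def altWedge {k l : ℕ} (α : V [⋀^Fin k]→L[ℝ] ℝ) (β : V [⋀^Fin l]→L[ℝ] ℝ) :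
    V [⋀^Fin (k + l)]→L[ℝ] ℝ :=
  ((k.factorial * l.factorial : ℝ)⁻¹) •
    ContinuousMultilinearMap.alternatization (altProd α β)

/-- The form `e^{i_1} ∧ ⋯ ∧ e^{i_k}` on `ℝ⁷`. -/
def coordForm {k : ℕ} (i : Fin k → Fin 7) : E7 [⋀^Fin k]→L[ℝ] ℝ where
  __ := (Matrix.detRowAlternating (R := ℝ) (n := Fin k)).compLinearMap
    (LinearMap.pi fun b => (EuclideanSpace.proj (𝕜 := ℝ) (i b)).toLinearMap)
  cont := by
    change Continuous fun v : Fin k → E7 => (Matrix.of fun a b => v a (i b)).det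
    refine Continuous.matrix_det ?_
    fun_prop

/-- `φ₀ = e^{127} + e^{347} + e^{567} + e^{135} - e^{146} - e^{236} - e^{245}`. -/
def phi0 : E7 [⋀^Fin 3]→L[ℝ] ℝ :=
  coordForm ![0, 1, 6] + coordForm ![2, 3, 6] + coordForm ![4, 5, 6] + coordForm ![0, 2, 4]
    - coordForm ![0, 3, 5] - coordForm ![1, 2, 5] - coordForm ![1, 3, 4]

/-- The sign of the arrangement `i_1, …, i_k, j_1, …, j_l` of `1, …, 7` (zero when it is not a
permutation), as the determinant of the corresponding 0-1 matrix. -/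
def arrSign {k l : ℕ} (h : k + l = 7) (i : Fin k → Fin 7) (j : Fin l → Fin 7) : ℤ :=
  (Matrix.of fun a b : Fin 7 => if Fin.append i j (Fin.cast h.symm a) = b then (1 : ℤ) else 0).det

/-- The Hodge star of `ℝ⁷` with its standard metric and orientation:
`e^I ↦ ± e^J`, `J` the complement of `I` and `±` the sign of the arrangement `(I, J)`;
the sums are over increasing multi-indices. -/
def star0 {k l : ℕ} (h : k + l = 7) (α : E7 [⋀^Fin k]→L[ℝ] ℝ) : E7 [⋀^Fin l]→L[ℝ] ℝ :=
  ∑ I : Fin k ↪o Fin 7, ∑ J : Fin l ↪o Fin 7,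
    ((arrSign h I J : ℝ) * α (fun a => EuclideanSpace.single (I a) 1)) • coordForm J

/-- A 3-form is positive when it is `φ₀` in some basis of the space. -/
def IsPositiveForm (α : V [⋀^Fin 3]→L[ℝ] ℝ) : Prop :=
  ∃ e : V ≃L[ℝ] E7, phi0.compContinuousLinearMap (e : V →L[ℝ] E7) = α

/-- Coordinates in which a positive 3-form is `φ₀`. The metric and the orientation induced by the
3-form are the standard ones of `ℝ⁷` in these coordinates; they do not depend on the choice,
because two choices differ by an element of `G₂ ⊂ SO(7)`. -/
def adaptedCoords (α : V [⋀^Fin 3]→L[ℝ] ℝ) (h : IsPositiveForm α) : V ≃L[ℝ] E7 := h.choose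

open Classical in
/-- The Hodge star of the metric and orientation induced by the positive 3-form `α`. -/
def hodgeStar (α : V [⋀^Fin 3]→L[ℝ] ℝ) {k l : ℕ} (hkl : k + l = 7) (β : V [⋀^Fin k]→L[ℝ] ℝ) :
    V [⋀^Fin l]→L[ℝ] ℝ :=
  if h : IsPositiveForm α then
    (star0 hkl (β.compContinuousLinearMap ((adaptedCoords α h).symm : E7 →L[ℝ] V))).compContinuousLinearMap
      (adaptedCoords α h : V →L[ℝ] E7)
  else 0

open Classical in
/-- The square norm `|β|² = ∑_{i_1 < ⋯ < i_k} β(e_{i_1}, …, e_{i_k})²` of a form with respect to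
the metric induced by the positive 3-form `α`. -/
def formNormSq (α : V [⋀^Fin 3]→L[ℝ] ℝ) {k : ℕ} (β : V [⋀^Fin k]→L[ℝ] ℝ) : ℝ :=
  if h : IsPositiveForm α then
    ∑ I : Fin k ↪o Fin 7,
      (β (fun a => (adaptedCoords α h).symm (EuclideanSpace.single (I a) 1))) ^ 2
  else 0

end Pointwise

/-! ## `G₂`-structures -/

section G2

variable {M N : Type*} [TopologicalSpace M] [ChartedSpace E7 M]
  [TopologicalSpace N] [ChartedSpace E7 N]

/-- A `G₂`-structure: a smooth 3-form that is positive at every point. -/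
structure IsG2Structure (φ : DiffForm 3 M) : Prop where
  smooth : DiffForm.IsSmooth φ
  positive : ∀ p, IsPositiveForm (φ p)

/-- `*η`, for the metric and orientation of `φ`. -/
def g2Star (φ : DiffForm 3 M) {k l : ℕ} (hkl : k + l = 7) (η : DiffForm k M) : DiffForm l M :=
  fun p => hodgeStar (φ p) hkl (η p)

/-- The torsion 2-form `τ = - * d * φ`. -/
def g2Torsion (φ : DiffForm 3 M) : DiffForm 2 M :=
  -g2Star φ (k := 5) (l := 2) rfl (DiffForm.d (g2Star φ (k := 3) (l := 4) rfl φ))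

/-- Closed `G₂`-structures. -/
structure IsClosedG2 (φ : DiffForm 3 M) : Prop extends IsG2Structure φ where
  closed : DiffForm.d φ = 0

/-- Extremally Ricci pinched (ERP) `G₂`-structures: closed ones with
`dτ = (1/6) |τ|² φ + (1/6) * (τ ∧ τ)`. -/
structure IsERP (φ : DiffForm 3 M) : Prop extends IsClosedG2 φ where
  erp : ∀ p, DiffForm.d (g2Torsion φ) p =
    ((1 / 6 : ℝ) * formNormSq (φ p) (g2Torsion φ p)) • φ p +
      (1 / 6 : ℝ) • hodgeStar (φ p) (k := 4) (l := 3) rfl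
        (altWedge (g2Torsion φ p) (g2Torsion φ p))

/-- Torsion-free: `dφ = 0` and `d * φ = 0`. -/
def IsTorsionFree (φ : DiffForm 3 M) : Prop :=
  DiffForm.d φ = 0 ∧ DiffForm.d (g2Star φ (k := 3) (l := 4) rfl φ) = 0

/-- `(M, φ)` near `p` is equivalent to `(N, φ')` near `q`: a diffeomorphism `f` between open
neighbourhoods with `f(p) = q` and `f^* φ' = φ`. -/
def LocallyEquivalentAt (φ : DiffForm 3 M) (φ' : DiffForm 3 N) (p : M) (q : N) : Prop :=
  ∃ f : PartialDiffeomorph I7 I7 M N ∞, p ∈ f.source ∧ f p = q ∧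
    ∀ x ∈ f.source, φ x = DiffForm.pullback f φ' x

end G2

/-! ## Groups -/

/-- A lattice: a discrete and cocompact subgroup. -/
structure IsLattice {G : Type*} [Group G] [TopologicalSpace G] (Γ : Subgroup G) : Prop where
  discrete : DiscreteTopology Γ
  cocompact : CompactSpace (G ⧸ Γ)

/-- Unimodular: every left Haar measure is right invariant. -/
def IsUnimodularGroup (G : Type*) [Group G] [TopologicalSpace G] : Prop :=
  letI : MeasurableSpace G := borel G
  ∀ μ : MeasureTheory.Measure G, μ.IsHaarMeasure → μ.IsMulRightInvariant

/-- The semidirect product `H ⋉ Kⁿ` of a group `H` of matrices with `Kⁿ`. -/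
@[ext]
structure LinSemidirect {n : ℕ} {K : Type*} [CommRing K]
    (H : Subgroup (Matrix.SpecialLinearGroup (Fin n) K)) where
  lin : H
  vec : Fin n → K

namespace LinSemidirect

variable {n : ℕ} {K : Type*} [CommRing K] {H : Subgroup (Matrix.SpecialLinearGroup (Fin n) K)}

/-- The matrix of the linear part. -/
def mat (g : LinSemidirect H) : Matrix (Fin n) (Fin n) K :=
  ((g.lin : Matrix.SpecialLinearGroup (Fin n) K) : Matrix (Fin n) (Fin n) K)

instance : Mul (LinSemidirect H) := ⟨fun g h => ⟨g.lin * h.lin, g.vec + g.mat *ᵥ h.vec⟩⟩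
instance : One (LinSemidirect H) := ⟨⟨1, 0⟩⟩
instance : Inv (LinSemidirect H) :=
  ⟨fun g => ⟨g.lin⁻¹, -((g.lin⁻¹ : H) : Matrix.SpecialLinearGroup (Fin n) K).1 *ᵥ g.vec⟩⟩

/-- `(A, b) (A', b') = (A A', b + A b')`. -/
instance : Group (LinSemidirect H) :=
  Group.ofLeftAxioms
    (by
      intro a b c
      refine LinSemidirect.ext (mul_assoc _ _ _) ?_
      change a.vec + a.mat *ᵥ b.vec + _ *ᵥ c.vec = a.vec + a.mat *ᵥ (b.vec + b.mat *ᵥ c.vec)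
      rw [Matrix.mulVec_add, Matrix.mulVec_mulVec, add_assoc]
      rfl)
    (by
      intro a
      refine LinSemidirect.ext (one_mul _) ?_
      change 0 + (1 : Matrix (Fin n) (Fin n) K) *ᵥ a.vec = a.vec
      simp)
    (by
      intro a
      refine LinSemidirect.ext (inv_mul_cancel _) ?_
      change -((a.lin⁻¹ : H) : Matrix.SpecialLinearGroup (Fin n) K).1 *ᵥ a.vec +
        ((a.lin⁻¹ : H) : Matrix.SpecialLinearGroup (Fin n) K).1 *ᵥ a.vec = 0
      rw [Matrix.neg_mulVec, neg_add_cancel])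

/-- The product topology of `H × Kⁿ`. -/
instance [TopologicalSpace K] : TopologicalSpace (LinSemidirect H) :=
  TopologicalSpace.induced (fun g => (g.lin, g.vec)) inferInstance

end LinSemidirect

/-! ## The group `G_J = exp(𝔞) ⋉ ℝ⁴` -/

/-- `𝔞 ⊂ 𝔰𝔩₄(ℝ)`: the diagonal matrices of trace zero. -/
def diagAlg : Submodule ℝ (Matrix (Fin 4) (Fin 4) ℝ) where
  carrier := {D | D.IsDiag ∧ D.trace = 0}
  add_mem' := fun h h' => ⟨h.1.add h'.1, by rw [Matrix.trace_add, h.2, h'.2, add_zero]⟩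
  zero_mem' := ⟨Matrix.isDiag_zero, by simp⟩
  smul_mem' := fun c _ h => ⟨h.1.smul c, by rw [Matrix.trace_smul, h.2, smul_zero]⟩

theorem diagAlg_commute {D D' : Matrix (Fin 4) (Fin 4) ℝ} (h : D ∈ diagAlg) (h' : D' ∈ diagAlg) :
    Commute D D' := by
  rw [← h.1.diagonal_diag, ← h'.1.diagonal_diag]
  exact Matrix.commute_diagonal _ _

/-- `exp(𝔞) ⊂ SL₄(ℝ)`. -/
def expA : Subgroup (Matrix.SpecialLinearGroup (Fin 4) ℝ) where
  carrier := {g | ∃ D ∈ diagAlg, (g : Matrix (Fin 4) (Fin 4) ℝ) = NormedSpace.exp D}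
  mul_mem' := by
    rintro g g' ⟨D, hD, h⟩ ⟨D', hD', h'⟩
    refine ⟨D + D', diagAlg.add_mem hD hD', ?_⟩
    rw [Matrix.exp_add_of_commute _ _ (diagAlg_commute hD hD'), Matrix.SpecialLinearGroup.coe_mul,
      h, h']
  one_mem' := ⟨0, diagAlg.zero_mem, by simp⟩
  inv_mem' := by
    rintro g ⟨D, hD, h⟩
    refine ⟨-D, diagAlg.neg_mem hD, ?_⟩
    rw [Matrix.exp_neg, ← h]
    symm
    apply Matrix.inv_eq_left_inv
    rw [← Matrix.SpecialLinearGroup.coe_mul, inv_mul_cancel, Matrix.SpecialLinearGroup.coe_one]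

/-- The simply connected solvable Lie group `G_J = exp(𝔞) ⋉ ℝ⁴`. -/
abbrev GJ : Type := LinSemidirect expA

/-- The element `x₇ e₇ + x₁ e₁ + x₂ e₂` of `𝔞`, where `e₇ = Diag(1,1,-1,-1)`,
`e₁ = Diag(1,-1,1,-1)`, `e₂ = Diag(1,-1,-1,1)`. -/
def aElem (x : E7) : Matrix (Fin 4) (Fin 4) ℝ :=
  x 6 • Matrix.diagonal ![1, 1, -1, -1] + x 0 • Matrix.diagonal ![1, -1, 1, -1]
    + x 1 • Matrix.diagonal ![1, -1, -1, 1]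

theorem aElem_eq (x : E7) : aElem x = Matrix.diagonal
    ![x 6 + x 0 + x 1, x 6 - x 0 - x 1, -x 6 + x 0 - x 1, -x 6 - x 0 + x 1] := by
  ext i j
  fin_cases i <;> fin_cases j <;> simp [aElem] <;> ring

theorem aElem_mem (x : E7) : aElem x ∈ diagAlg := by
  refine ⟨?_, ?_⟩
  · rw [aElem_eq]; exact Matrix.isDiag_diagonal _
  · rw [aElem_eq, Matrix.trace_diagonal]; simp [Fin.sum_univ_four]; ring

theorem exp_aElem (x : E7) : NormedSpace.exp (aElem x) = Matrix.diagonal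
    ![Real.exp (x 6 + x 0 + x 1), Real.exp (x 6 - x 0 - x 1), Real.exp (-x 6 + x 0 - x 1),
      Real.exp (-x 6 - x 0 + x 1)] := by
  rw [aElem_eq, Matrix.exp_diagonal]
  congr 1
  ext i
  rw [Pi.coe_exp, ← Real.exp_eq_exp_ℝ]
  fin_cases i <;> rfl

/-- `exp(x₇ e₇ + x₁ e₁ + x₂ e₂)` as an element of `exp(𝔞)`. -/
def expElem (x : E7) : expA :=
  ⟨⟨NormedSpace.exp (aElem x), by
    rw [exp_aElem, Matrix.det_diagonal]
    simp only [Fin.prod_univ_four, Matrix.cons_val]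
    rw [← Real.exp_add, ← Real.exp_add, ← Real.exp_add, ← Real.exp_zero]
    congr 1; ring⟩, aElem x, aElem_mem x, rfl⟩

/-- The point `(exp(x₇ e₇ + x₁ e₁ + x₂ e₂), (x₃, x₄, x₅, x₆))` of `G_J`. -/
def GJ.ofCoords (x : E7) : GJ := ⟨expElem x, ![x 2, x 3, x 4, x 5]⟩

/-- The inverse of `GJ.ofCoords`. -/
def GJ.toCoords (g : GJ) : E7 :=
  !₂[(Real.log (g.mat 0 0) + Real.log (g.mat 2 2)) / 2,
    (Real.log (g.mat 0 0) + Real.log (g.mat 3 3)) / 2,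
    g.vec 0, g.vec 1, g.vec 2, g.vec 3,
    (Real.log (g.mat 0 0) + Real.log (g.mat 1 1)) / 2]

theorem expElem_mat (x : E7) (v : Fin 4 → ℝ) : (⟨expElem x, v⟩ : GJ).mat = Matrix.diagonal
    ![Real.exp (x 6 + x 0 + x 1), Real.exp (x 6 - x 0 - x 1), Real.exp (-x 6 + x 0 - x 1),
      Real.exp (-x 6 - x 0 + x 1)] := exp_aElem x

theorem GJ.mat_eq (g : GJ) : ∃ x : E7, g.lin = expElem x := by
  obtain ⟨D, hD, h⟩ := g.lin.2
  refine ⟨!₂[(D 0 0 + D 2 2) / 2, (D 0 0 + D 3 3) / 2, 0, 0, 0, 0, (D 0 0 + D 1 1) / 2], ?_⟩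
  refine Subtype.ext (Subtype.ext ?_)
  refine h.trans ?_
  change _ = NormedSpace.exp (aElem _)
  congr 1
  have ht : D 0 0 + D 1 1 + D 2 2 + D 3 3 = 0 := by
    simpa [Matrix.trace, Fin.sum_univ_four] using hD.2
  rw [aElem_eq, ← hD.1.diagonal_diag]
  congr 1
  ext i
  fin_cases i <;> simp <;> linarith

theorem GJ.toCoords_ofCoords (x : E7) : GJ.toCoords (GJ.ofCoords x) = x := by
  ext i
  simp only [GJ.toCoords, GJ.ofCoords, expElem_mat, Matrix.diagonal_apply_eq, Matrix.cons_val,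
    Real.log_exp]
  fin_cases i <;> simp <;> ring

theorem GJ.ofCoords_toCoords (g : GJ) : GJ.ofCoords (GJ.toCoords g) = g := by
  obtain ⟨x, hx⟩ := g.mat_eq
  have hg : g = GJ.ofCoords (!₂[x 0, x 1, g.vec 0, g.vec 1, g.vec 2, g.vec 3, x 6]) := by
    refine LinSemidirect.ext ?_ ?_
    · rw [hx]
      refine Subtype.ext (Subtype.ext ?_)
      change NormedSpace.exp (aElem _) = NormedSpace.exp (aElem _)
      simp [aElem]
    · ext i; fin_cases i <;> rfl
  rw [hg, GJ.toCoords_ofCoords]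

theorem GJ.continuous_mat : Continuous (fun g : GJ => g.mat) := by
  have h1 : Continuous fun g : GJ => g.lin :=
    continuous_fst.comp (continuous_induced_dom (f := fun g : GJ => (g.lin, g.vec)))
  have h2 : Continuous fun g : GJ => (g.lin : Matrix.SpecialLinearGroup (Fin 4) ℝ) :=
    Continuous.subtype_val h1
  exact Continuous.subtype_val h2

theorem GJ.continuous_vec : Continuous (fun g : GJ => g.vec) :=
  continuous_snd.comp (continuous_induced_dom (f := fun g : GJ => (g.lin, g.vec)))

theorem GJ.mat_ne_zero (g : GJ) (i : Fin 4) : g.mat i i ≠ 0 := by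
  rw [← GJ.ofCoords_toCoords g, GJ.ofCoords, expElem_mat, Matrix.diagonal_apply_eq]
  fin_cases i <;> exact (Real.exp_pos _).ne'

/-- The global coordinates `(x₁, …, x₇)` of `G_J`. -/
def GJ.coords : GJ ≃ₜ E7 where
  toFun := GJ.toCoords
  invFun := GJ.ofCoords
  left_inv := GJ.ofCoords_toCoords
  right_inv := GJ.toCoords_ofCoords
  continuous_toFun := by
    have hm : ∀ i, Continuous fun g : GJ => Real.log (g.mat i i) := fun i =>
      (GJ.continuous_mat.matrix_elem i i).log fun g => g.mat_ne_zero i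
    have hv : ∀ i, Continuous fun g : GJ => g.vec i := fun i =>
      (continuous_apply i).comp GJ.continuous_vec
    refine (PiLp.continuous_toLp 2 _).comp (continuous_pi fun i => ?_)
    fin_cases i
    · exact ((hm 0).add (hm 2)).div_const 2
    · exact ((hm 0).add (hm 3)).div_const 2
    · exact hv 0
    · exact hv 1
    · exact hv 2
    · exact hv 3
    · exact ((hm 0).add (hm 1)).div_const 2
  continuous_invFun := by
    refine continuous_induced_rng.2 (Continuous.prodMk ?_ ?_)
    · refine Continuous.subtype_mk (Continuous.subtype_mk ?_ _) _
      simp_rw [exp_aElem]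
      refine Continuous.matrix_diagonal (continuous_pi fun i => ?_)
      fin_cases i <;> simp <;> fun_prop
    · refine continuous_pi fun i => ?_
      fin_cases i <;> simp [GJ.ofCoords] <;> fun_prop

instance : ChartedSpace E7 GJ := GJ.coords.isOpenEmbedding.singletonChartedSpace

/-- The left-invariant form on `G_J` with value `α` at the identity; `T_e G_J` is identified with
`ℝ⁷` so that `e_7, e_1, e_2` are the above elements of `𝔞` and `e_3, …, e_6` is the standard basis
of `ℝ⁴`. -/
def GJ.leftInvariant {k : ℕ} (α : E7 [⋀^Fin k]→L[ℝ] ℝ) : DiffForm k GJ :=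
  fun g => DiffForm.pullback (fun h => GJ.coords (g⁻¹ * h)) (fun _ : E7 => α) g

/-- The left-invariant 3-form `φ` on `G_J`. -/
def GJ.phi : DiffForm 3 GJ := GJ.leftInvariant phi0

/-! ## The lattice -/

/-- `A₁, A₂, A₃ ∈ SL₄(ℤ)`. -/
def latA : Fin 3 → Matrix.SpecialLinearGroup (Fin 4) ℤ :=
  ![⟨!![0, 0, -1, -1; 0, 0, -4, -5; 1, 0, 4, 0; 0, 1, 1, 5], by decide⟩,
    ⟨!![3, -1, -1, -1; -4, -1, -5, -5; 0, 0, 3, -1; 1, 1, 1, 4], by decide⟩,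
    ⟨!![4, 1, 2, 3; 3, 8, 9, 14; -1, -1, 0, -3; -1, -2, -3, -3], by decide⟩]

/-- `A_j` as a real matrix. -/
def latAReal (j : Fin 3) : Matrix (Fin 4) (Fin 4) ℝ :=
  (latA j : Matrix (Fin 4) (Fin 4) ℤ).map (Int.cast : ℤ → ℝ)

/-- `u_i = 2 cos (2πk/15)`, `k = 1, 2, 4, 7`. -/
def latU : Fin 4 → ℝ :=
  fun i => 2 * Real.cos (2 * Real.pi * ((![1, 2, 4, 7] i : ℝ) / 15))

/-- The Vandermonde matrix of `u_1, …, u_4`. -/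
def latPhi : Matrix (Fin 4) (Fin 4) ℝ := Matrix.vandermonde latU

/-- The group generated by the matrices `ϕ A_j ϕ⁻¹`. -/
def latLambda : Subgroup (Matrix.SpecialLinearGroup (Fin 4) ℝ) :=
  Subgroup.closure {S | ∃ j, (S : Matrix (Fin 4) (Fin 4) ℝ) = latPhi * latAReal j * latPhi⁻¹}

/-- The subset `Λ ⋉ ϕ(ℤ⁴)` of `G_J`. -/
def latGammaSet : Set GJ :=
  {g | (g.lin : Matrix.SpecialLinearGroup (Fin 4) ℝ) ∈ latLambda ∧
    ∃ m : Fin 4 → ℤ, g.vec = latPhi *ᵥ fun i => (m i : ℝ)}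

/-! ## Bryant's homogeneous example -/

/-- The group `SL₂(ℂ) ⋉ ℂ²`. -/
abbrev SL2Aff : Type := LinSemidirect (⊤ : Subgroup (Matrix.SpecialLinearGroup (Fin 2) ℂ))

/-- The homogeneous space `(SL₂(ℂ) ⋉ ℂ²) / SU(2)`, realized as the product of `ℂ²` and the set of
positive definite Hermitian matrices of determinant one (hyperbolic 3-space). -/
@[ext]
structure BryantSpace where
  herm : Matrix (Fin 2) (Fin 2) ℂ
  vec : Fin 2 → ℂ
  posDef : herm.PosDef
  det_eq : herm.det = 1

namespace BryantSpace

instance : TopologicalSpace BryantSpace :=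
  TopologicalSpace.induced (fun p => (p.herm, p.vec)) inferInstance

/-- The transitive action `(g, w) • (h, v) = (g h g^*, g v + w)`. The stabilizer of the base point
`(1, 0)` is `SU(2)`. -/
instance : MulAction SL2Aff BryantSpace where
  smul g p :=
    { herm := g.mat * p.herm * g.matᴴ
      vec := g.mat *ᵥ p.vec + g.vec
      posDef := by
        refine p.posDef.mul_mul_conjTranspose_same ?_
        rw [Matrix.vecMul_injective_iff_isUnit, Matrix.isUnit_iff_isUnit_det]
        simp [LinSemidirect.mat]
      det_eq := by
        simp [Matrix.det_mul, p.det_eq, Matrix.det_conjTranspose, LinSemidirect.mat] }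
  one_smul p := by
    refine BryantSpace.ext ?_ ?_
    · change (1 : Matrix (Fin 2) (Fin 2) ℂ) * p.herm * (1 : Matrix (Fin 2) (Fin 2) ℂ)ᴴ = p.herm
      simp
    · change (1 : Matrix (Fin 2) (Fin 2) ℂ) *ᵥ p.vec + 0 = p.vec
      simp
  mul_smul g g' p := by
    refine BryantSpace.ext ?_ ?_
    · change (g.mat * g'.mat) * p.herm * (g.mat * g'.mat)ᴴ =
        g.mat * (g'.mat * p.herm * g'.matᴴ) * g.matᴴ
      simp only [Matrix.conjTranspose_mul, Matrix.mul_assoc]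
    · change (g.mat * g'.mat) *ᵥ p.vec + (g.vec + g.mat *ᵥ g'.vec) =
        g.mat *ᵥ (g'.mat *ᵥ p.vec + g'.vec) + g.vec
      rw [Matrix.mulVec_add, Matrix.mulVec_mulVec]
      abel

/-- The base point `o = (1, 0)`. -/
def base : BryantSpace := ⟨1, 0, Matrix.PosDef.one, Matrix.det_one⟩

/-- `ζ = 2 (x₂ + i x₁)`. -/
def zeta (x : E7) : ℂ := ⟨2 * x 1, 2 * x 0⟩

/-- The elements `([e^t, ζ e^{-t}; 0, e^{-t}], (x₃ + i x₄, x₅ - i x₆))`, `t = x₇`,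
`ζ = 2 (x₂ + i x₁)`, of `SL₂(ℂ) ⋉ ℂ²`; they form a subgroup that acts simply transitively on the
homogeneous space. -/
def sect (x : E7) : SL2Aff :=
  ⟨⟨⟨!![(Real.exp (x 6) : ℂ), zeta x * (Real.exp (-x 6) : ℂ); 0, (Real.exp (-x 6) : ℂ)], by
      rw [Matrix.det_fin_two_of, mul_zero, sub_zero, ← Complex.ofReal_mul, ← Real.exp_add]
      simp⟩, Subgroup.mem_top _⟩, ![⟨x 2, x 3⟩, ⟨x 4, -x 5⟩]⟩

/-- Global coordinates on the homogeneous space, inverse to `x ↦ sect x • o`. -/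
def toCoords (p : BryantSpace) : E7 :=
  !₂[(p.herm 0 1 / p.herm 1 1).im / 2, (p.herm 0 1 / p.herm 1 1).re / 2,
    (p.vec 0).re, (p.vec 0).im, (p.vec 1).re, -(p.vec 1).im, -Real.log (p.herm 1 1).re / 2]

/-- The point with coordinates `x`. -/
def ofCoords (x : E7) : BryantSpace := sect x • base

theorem ofCoords_herm (x : E7) : (ofCoords x).herm =
    !![(Real.exp (x 6) : ℂ) ^ 2 + Complex.normSq (zeta x) * (Real.exp (-x 6) : ℂ) ^ 2,
      zeta x * (Real.exp (-x 6) : ℂ) ^ 2;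
      (starRingEnd ℂ) (zeta x) * (Real.exp (-x 6) : ℂ) ^ 2, (Real.exp (-x 6) : ℂ) ^ 2] := by
  change (sect x).mat * 1 * (sect x).matᴴ = _
  have h : (sect x).mat =
      !![(Real.exp (x 6) : ℂ), zeta x * (Real.exp (-x 6) : ℂ); 0, (Real.exp (-x 6) : ℂ)] := rfl
  rw [h, Complex.normSq_eq_conj_mul_self]
  ext i j
  fin_cases i <;> fin_cases j <;>
    simp [Matrix.mul_apply, Fin.sum_univ_two, -Complex.ofReal_exp] <;> ring

theorem ofCoords_vec (x : E7) : (ofCoords x).vec = ![⟨x 2, x 3⟩, ⟨x 4, -x 5⟩] := by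
  change (sect x).mat *ᵥ 0 + ![⟨x 2, x 3⟩, ⟨x 4, -x 5⟩] = _
  simp

theorem toCoords_ofCoords (x : E7) : toCoords (ofCoords x) = x := by
  have hne : (Real.exp (-x 6) : ℂ) ^ 2 ≠ 0 := by
    exact_mod_cast pow_ne_zero 2 (Real.exp_pos (-x 6)).ne'
  have h01 : (ofCoords x).herm 0 1 / (ofCoords x).herm 1 1 = zeta x := by
    rw [ofCoords_herm]
    exact mul_div_cancel_right₀ _ hne
  have h11 : ((ofCoords x).herm 1 1).re = Real.exp (-x 6) ^ 2 := by
    rw [ofCoords_herm]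
    change ((Real.exp (-x 6) : ℂ) ^ 2).re = _
    rw [← Complex.ofReal_pow, Complex.ofReal_re]
  ext i
  simp only [toCoords, h01, h11, ofCoords_vec, Real.log_pow, Real.log_exp, zeta]
  fin_cases i <;> simp

theorem herm_pos (p : BryantSpace) : 0 < (p.herm 1 1).re :=
  (Complex.lt_def.1 (p.posDef.diag_pos (i := 1))).1

theorem ofCoords_toCoords (p : BryantSpace) : ofCoords (toCoords p) = p := by
  have hp := herm_pos p
  have him : (p.herm 1 1).im = 0 := (Complex.lt_def.1 (p.posDef.diag_pos (i := 1))).2.symm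
  have h11 : p.herm 1 1 = ((p.herm 1 1).re : ℂ) := by
    apply Complex.ext <;> simp [him]
  have hne : p.herm 1 1 ≠ 0 := by
    intro h; rw [h] at hp; simp at hp
  have hz : zeta (toCoords p) = p.herm 0 1 / p.herm 1 1 := by
    apply Complex.ext <;> simp [zeta, toCoords] <;> ring
  have he : (Real.exp (-(toCoords p) 6) : ℂ) ^ 2 = p.herm 1 1 := by
    rw [← Complex.ofReal_pow, ← Real.exp_nat_mul, h11]
    congr 1
    have : ((2 : ℕ) : ℝ) * -(toCoords p) 6 = Real.log (p.herm 1 1).re := by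
      simp [toCoords]; ring
    rw [this, Real.exp_log hp]
  have he' : (Real.exp ((toCoords p) 6) : ℂ) ^ 2 = (p.herm 1 1)⁻¹ := by
    rw [← he, Real.exp_neg]
    push_cast
    simp
  have h10 : p.herm 1 0 = (starRingEnd ℂ) (p.herm 0 1) := by
    have := p.posDef.isHermitian.apply 1 0
    rw [← this]; rfl
  have hc : (starRingEnd ℂ) (p.herm 1 1) = p.herm 1 1 := by
    rw [h11, Complex.conj_ofReal]
  have hd : p.herm 0 0 * p.herm 1 1 - p.herm 0 1 * p.herm 1 0 = 1 := by
    rw [← Matrix.det_fin_two]; exact p.det_eq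
  refine BryantSpace.ext ?_ ?_
  · rw [ofCoords_herm, Complex.normSq_eq_conj_mul_self, hz, he, he', map_div₀, hc]
    ext i j
    fin_cases i <;> fin_cases j
    · simp only [Fin.zero_eta, Matrix.of_apply, Matrix.cons_val]
      field_simp
      rw [← h10]
      linear_combination -hd
    · simp; field_simp
    · simp [h10]; field_simp
    · simp
  · rw [ofCoords_vec]
    ext i
    fin_cases i <;> simp [toCoords]

theorem continuous_herm : Continuous fun p : BryantSpace => p.herm :=
  continuous_fst.comp (continuous_induced_dom (f := fun p : BryantSpace => (p.herm, p.vec)))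

theorem continuous_vec : Continuous fun p : BryantSpace => p.vec :=
  continuous_snd.comp (continuous_induced_dom (f := fun p : BryantSpace => (p.herm, p.vec)))

/-- The global coordinates `(x₁, …, x₇)` of the homogeneous space. -/
def coords : BryantSpace ≃ₜ E7 where
  toFun := toCoords
  invFun := ofCoords
  left_inv := ofCoords_toCoords
  right_inv := toCoords_ofCoords
  continuous_toFun := by
    have h11 := continuous_herm.matrix_elem 1 1
    have hz : Continuous fun p : BryantSpace => p.herm 0 1 / p.herm 1 1 :=
      (continuous_herm.matrix_elem 0 1).div h11 fun p h => by
        have := herm_pos p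
        rw [h] at this; simp at this
    have hv : ∀ i, Continuous fun p : BryantSpace => p.vec i := fun i =>
      (continuous_apply i).comp continuous_vec
    have hl : Continuous fun p : BryantSpace => Real.log (p.herm 1 1).re :=
      (Complex.continuous_re.comp h11).log fun p => (herm_pos p).ne'
    refine (PiLp.continuous_toLp 2 _).comp (continuous_pi fun i => ?_)
    fin_cases i
    · exact (Complex.continuous_im.comp hz).div_const 2
    · exact (Complex.continuous_re.comp hz).div_const 2
    · exact Complex.continuous_re.comp (hv 0)
    · exact Complex.continuous_im.comp (hv 0)
    · exact Complex.continuous_re.comp (hv 1)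
    · exact (Complex.continuous_im.comp (hv 1)).neg
    · exact hl.neg.div_const 2
  continuous_invFun := by
    have hz : Continuous zeta := by
      have : zeta = fun x : E7 => ((2 * x 1 : ℝ) : ℂ) + ((2 * x 0 : ℝ) : ℂ) * Complex.I := by
        funext x; exact (Complex.mk_eq_add_mul_I _ _)
      rw [this]; fun_prop
    refine continuous_induced_rng.2 (Continuous.prodMk ?_ ?_)
    · simp_rw [ofCoords_herm]
      refine continuous_matrix fun i j => ?_
      have hs : Continuous fun x : E7 => (starRingEnd ℂ) (zeta x) := Complex.continuous_conj.comp hz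
      have hn : Continuous fun x : E7 => ((Complex.normSq (zeta x) : ℝ) : ℂ) :=
        Complex.continuous_ofReal.comp (Complex.continuous_normSq.comp hz)
      fin_cases i <;> fin_cases j <;> simp [-Complex.ofReal_exp] <;> fun_prop
    · simp_rw [ofCoords_vec, Complex.mk_eq_add_mul_I]
      refine continuous_pi fun i => ?_
      fin_cases i <;> simp <;> fun_prop

instance : Nonempty BryantSpace := ⟨base⟩

instance : ChartedSpace E7 BryantSpace := coords.isOpenEmbedding.singletonChartedSpace

/-- The 3-form of Bryant's example: the invariant 3-form with value `φ₀` at the base point `o`. At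
`p = s • o`, `s = sect x`, it is the pullback of `φ₀` by `s⁻¹`. The tangent space at `o` is
`𝔭 ⊕ ℂ²`, `𝔭 = i 𝔰𝔲(2)`, and the coordinates identify `e_7, e_2, e_1 ∈ ℝ⁷` with the Hermitian
matrices `σ_3, σ_1, -σ_2` (Pauli matrices, `X ∈ 𝔭` being tangent to `exp(tX) • o`), and `φ₀` with
the `SU(2)`-invariant form `e^{127} + ∑ Im(v^* X w)`, the sum over the three cyclic
permutations of the arguments `(X, v, w)`. -/
def phi : DiffForm 3 BryantSpace :=
  fun p => DiffForm.pullback (fun q => coords ((sect (coords p))⁻¹ • q)) (fun _ : E7 => phi0) p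

end BryantSpace

/-- The conjecture of Cleyton and Ivanov: every compact manifold with an ERP `G₂`-structure
that is not torsion-free is locally equivalent, up to scaling, to Bryant's example. -/
def CleytonIvanovConjecture : Prop :=
  ∀ (M : Type) [TopologicalSpace M] [T2Space M] [CompactSpace M] [ConnectedSpace M]
    [ChartedSpace E7 M] [IsManifold I7 ∞ M] (φ : DiffForm 3 M),
    IsERP φ → ¬ IsTorsionFree φ →
      ∃ c : ℝ, 0 < c ∧ ∀ p : M, ∃ q : BryantSpace,
        LocallyEquivalentAt φ (c • BryantSpace.phi) p q

end

noncomputable section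

/-! ## Alternating forms on `ℝ⁷` and the Hodge star -/

/-! Everything is reduced to finite linear algebra over ℤ, to one curvature computation and to the
arithmetic of the quartic field generated by 2cos(2π/15).

Well-definedness. The Hodge star and the norm are defined through a chosen coordinate system in
which a positive form is φ₀, so their computation requires G₂ ⊂ SO(7). The 7-form ι_uφ₀ ∧ ι_vφ₀ ∧ φ₀
is a multiple of ⟨u, v⟩ vol. Hence a linear map g preserving φ₀ satisfies det g · gᵀg = 1, whence
(det g)⁹ = 1, det g = 1 and gᵀg = 1 (`stdMatrix_of_map_phi0`). Any adapted coordinates may therefore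
be used (`hodgeStar_of_coords`, `formNormSq_of_coords`).

The ERP equation. On `GJ`, and on Bryant's space viewed as a solvable group acting simply
transitively, φ is φ₀ in a coframe K with dK = C(K, K) and C constant. For forms with constant
components in K, the exterior derivative is the algebraic operator `structDeriv C`
(`IsCoframeOn.extDeriv`, `IsAdaptedOn.d`). All identities become integer identities between
components, decided by evaluation. In both cases, for some n (4 for `GJ`, 12 for Bryant's space),
|τ|² = 6n, τ ∧ τ = -6n e³⁴⁵⁶ and dτ = n(φ₀ - e¹²⁷). As *e³⁴⁵⁶ = e¹²⁷, this is the ERP equation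
(`IsERPStructure.isERP`). Invariance of Bryant's form under the whole group reduces to invariance of
φ₀ under the isotropy representation of SU(2).

The lattice. The matrices A_j represent multiplication by squares of conjugates of u = 2cos(2π/15)
on ℤ[u] in the basis 1, u, u², u³, and ϕ evaluates this basis at the four conjugates, which x ↦ x² -
2 permutes cyclically. Thus Λ is conjugate by ϕ into SL₄(ℤ), which gives discreteness and shows that
Λ preserves ϕ(ℤ⁴). The logarithms of the three generators span 𝔞, which gives cocompactness
(`exists_expElem_eq_sum`). The left quotient by the discrete group Γ is a manifold whose transition
maps are left translations, so left-invariant forms descend to it.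

Inequivalence. The torsion form is determined by φ, so a local equivalence with cφ_B, c = r³,
provides two coframes for the same pair (φ, τ): that of `GJ`, and r times that of Bryant's space.
The change of coframe lies in G₂ and preserves e³⁴⁵⁶ up to scale, because in both coframes τ ∧ τ is
a multiple of e³⁴⁵⁶. Applying * it preserves e¹²⁷ up to scale, and by orthogonality it preserves the
quadratic form (e¹)² + (e²)² + (e⁷)² (`sum_sq_base_of_map_phi0`). On `GJ` these three coframe
elements are differentials of coordinates, so this form is flat. On Bryant's space it is a multiple
of a hyperbolic metric e^{-4t}(dx² + dy²) + dt². No map to ℝ³ pulls the flat metric back to a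
nonzero multiple of it (`not_isometric_hyperbolic`). -/

/-- The standard basis vector `e_{i+1}` of `ℝ⁷`. -/
abbrev stdVec (i : Fin 7) : E7 := EuclideanSpace.single i 1

theorem eq_sum_stdVec (v : E7) : v = ∑ i, v i • stdVec i := by
  ext j
  simp [Finset.sum_apply, Pi.single_apply]

/-! ### Sums over all multi-indices and over increasing ones. -/

section IncreasingSums

variable {k n : ℕ}

theorem strictMono_comp_sort {i : Fin k → Fin n} (hi : Function.Injective i) :
    StrictMono (i ∘ Tuple.sort i) :=
  (Tuple.monotone_sort i).strictMono_of_injective (hi.comp (Tuple.sort i).injective)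

/-- Sorting writes each injective multi-index uniquely as an increasing one followed by a
permutation. Hence each increasing multi-index is counted k! times and the remaining terms vanish.
-/
theorem sum_eq_factorial_mul_sum_orderEmb (F : (Fin k → Fin n) → ℝ)
    (hperm : ∀ i (σ : Equiv.Perm (Fin k)), F (i ∘ σ) = F i)
    (hinj : ∀ i, ¬ Function.Injective i → F i = 0) :
    ∑ i, F i = (k.factorial : ℝ) * ∑ I : Fin k ↪o Fin n, F I := by
  have h1 : ∑ x : (Fin k ↪o Fin n) × Equiv.Perm (Fin k), F (x.1 ∘ x.2) = ∑ i, F i := by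
    refine Fintype.sum_of_injective (fun x => (x.1 : Fin k → Fin n) ∘ x.2) ?_ _ _ ?_ fun _ => rfl
    · rintro ⟨I, σ⟩ ⟨J, τ⟩ h
      have hr : Set.range I = Set.range J := by
        have := congrArg Set.range h
        simpa [Set.range_comp] using this
      have hIJ : I = J := OrderEmbedding.range_inj.1 hr
      subst hIJ
      refine Prod.ext rfl (Equiv.ext fun a => I.injective (congrFun h a))
    · intro i hi
      refine hinj i fun h => hi ⟨⟨OrderEmbedding.ofStrictMono _ (strictMono_comp_sort h),
        (Tuple.sort i)⁻¹⟩, ?_⟩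
      funext a
      simp
  rw [← h1, Fintype.sum_prod_type]
  simp [hperm, Fintype.card_perm, Finset.mul_sum]

end IncreasingSums

/-- Sorting an injective multi-index multiplies both values by the same sign, so agreement on
increasing multi-indices suffices. -/
theorem alternating_ext {k : ℕ} {α β : E7 [⋀^Fin k]→L[ℝ] ℝ}
    (h : ∀ i : Fin k → Fin 7, StrictMono i →
      α (fun a => stdVec (i a)) = β (fun a => stdVec (i a))) : α = β := by
  apply ContinuousAlternatingMap.toAlternatingMap_injective
  refine Module.Basis.ext_alternating (EuclideanSpace.basisFun (Fin 7) ℝ).toBasis fun i hi => ?_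
  have h1 := h _ (strictMono_comp_sort hi)
  have h2 : ∀ γ : E7 [⋀^Fin k]→L[ℝ] ℝ, γ (fun a => stdVec ((i ∘ Tuple.sort i) a)) =
      Equiv.Perm.sign (Tuple.sort i) • γ (fun a => stdVec (i a)) := fun γ =>
    γ.toAlternatingMap.map_perm (fun a => stdVec (i a)) (Tuple.sort i)
  rw [h2, h2] at h1
  have h3 := smul_left_cancel _ h1
  simpa using h3

theorem coordForm_apply {k : ℕ} (i : Fin k → Fin 7) (v : Fin k → E7) :
    coordForm i v = (Matrix.of fun a b => v a (i b)).det := rfl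

theorem coordForm_stdVec {k : ℕ} (i j : Fin k → Fin 7) :
    coordForm i (fun a => stdVec (j a)) =
      (Matrix.of fun a b => if j a = i b then (1 : ℝ) else 0).det := by
  rw [coordForm_apply]
  congr 1
  ext a b
  simp [eq_comm]

/-- Either some index of `j` is missing from `i`, and the determinant has a zero row, or both
increasing sequences have the same range and hence coincide. -/
theorem coordForm_stdVec_of_strictMono {k : ℕ} {i j : Fin k → Fin 7} (hi : StrictMono i)
    (hj : StrictMono j) : coordForm i (fun a => stdVec (j a)) = if j = i then 1 else 0 := by
  rw [coordForm_stdVec]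
  split_ifs with h
  · subst h
    rw [← Matrix.det_one (n := Fin k) (R := ℝ)]
    congr 1
    ext a b
    simp [Matrix.one_apply, hi.injective.eq_iff]
  · by_contra hdet
    apply h
    have hsub : ∀ a, j a ∈ Set.range i := by
      intro a
      by_contra ha
      refine hdet (Matrix.det_eq_zero_of_row_eq_zero a fun b => ?_)
      simp only [Matrix.of_apply]
      rw [if_neg fun hb => ha ⟨b, hb.symm⟩]
    have hs : Set.range j = Set.range i := by
      have h1 : Finset.univ.image j ⊆ Finset.univ.image i := by
        intro x hx
        obtain ⟨a, -, rfl⟩ := Finset.mem_image.1 hx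
        obtain ⟨b, hb⟩ := hsub a
        exact Finset.mem_image.2 ⟨b, Finset.mem_univ _, hb⟩
      have h2 := Finset.eq_of_subset_of_card_le h1 (by
        rw [Finset.card_image_of_injective _ hi.injective,
          Finset.card_image_of_injective _ hj.injective])
      have := congrArg (fun s : Finset (Fin 7) => (s : Set (Fin 7))) h2
      simpa using this
    exact (hj.range_inj hi).1 hs

/-! ### Partial evaluation of an alternating form. -/

section Append

variable {k l : ℕ}

theorem append_update_left {α : Type*} (v : Fin k → α) (w : Fin l → α) (i : Fin k) (x : α) :
    Fin.append (Function.update v i x) w =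
      Function.update (Fin.append v w) (Fin.castAdd l i) x := by
  funext a
  induction a using Fin.addCases with
  | left a =>
    simp [Function.update_apply]
  | right a =>
    rw [Fin.append_right, Function.update_of_ne, Fin.append_right]
    intro h
    have := congrArg Fin.val h
    simp at this
    omega

theorem append_update_right {α : Type*} (v : Fin k → α) (w : Fin l → α) (i : Fin l) (x : α) :
    Fin.append v (Function.update w i x) =
      Function.update (Fin.append v w) (Fin.natAdd k i) x := by
  funext a
  induction a using Fin.addCases with
  | left a =>
    rw [Fin.append_left, Function.update_of_ne, Fin.append_left]
    intro h
    have := congrArg Fin.val h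
    simp at this
    omega
  | right a =>
    simp [Function.update_apply]

/-- Evaluation of the first `k` arguments of an alternating form. -/
def appendRight (f : E7 [⋀^Fin (k + l)]→L[ℝ] ℝ) (v : Fin k → E7) : E7 [⋀^Fin l]→ₗ[ℝ] ℝ where
  toFun w := f (Fin.append v w)
  map_update_add' := by
    intro _ w i x y
    obtain rfl := Subsingleton.elim ‹DecidableEq (Fin l)› (instDecidableEqFin _)
    simp only [append_update_right, f.map_update_add]
  map_update_smul' := by
    intro _ w i c x
    obtain rfl := Subsingleton.elim ‹DecidableEq (Fin l)› (instDecidableEqFin _)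
    simp only [append_update_right, f.map_update_smul]
  map_eq_zero_of_eq' := by
    intro w i j h hij
    refine f.map_eq_zero_of_eq _ (i := Fin.natAdd k i) (j := Fin.natAdd k j) ?_ ?_
    · simpa using h
    · simpa using hij

/-- Evaluation of the last `l` arguments of an alternating form. -/
def appendLeft (f : E7 [⋀^Fin (k + l)]→L[ℝ] ℝ) (w : Fin l → E7) : E7 [⋀^Fin k]→ₗ[ℝ] ℝ where
  toFun v := f (Fin.append v w)
  map_update_add' := by
    intro _ v i x y
    obtain rfl := Subsingleton.elim ‹DecidableEq (Fin k)› (instDecidableEqFin _)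
    simp only [append_update_left, f.map_update_add]
  map_update_smul' := by
    intro _ v i c x
    obtain rfl := Subsingleton.elim ‹DecidableEq (Fin k)› (instDecidableEqFin _)
    simp only [append_update_left, f.map_update_smul]
  map_eq_zero_of_eq' := by
    intro v i j h hij
    refine f.map_eq_zero_of_eq _ (i := Fin.castAdd l i) (j := Fin.castAdd l j) ?_ ?_
    · simpa using h
    · simpa using hij

end Append

/-- The pairing `∑_I A(e_I) B(e_I)` over all multi-indices is invariant under orthogonal maps. -/
theorem sum_apply_mul_apply_of_orthogonal {k : ℕ} (A B : E7 [⋀^Fin k]→ₗ[ℝ] ℝ) (R : E7 →L[ℝ] E7)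
    (hR : ∀ j j', ∑ i, R (stdVec i) j * R (stdVec i) j' = if j = j' then 1 else 0) :
    ∑ i : Fin k → Fin 7, A (fun a => R (stdVec (i a))) * B (fun a => R (stdVec (i a))) =
      ∑ i : Fin k → Fin 7, A (fun a => stdVec (i a)) * B (fun a => stdVec (i a)) := by
  have hexp : ∀ (A : E7 [⋀^Fin k]→ₗ[ℝ] ℝ) (i : Fin k → Fin 7),
      A (fun a => R (stdVec (i a))) =
        ∑ j : Fin k → Fin 7, (∏ a, R (stdVec (i a)) (j a)) * A (fun a => stdVec (j a)) := by
    intro A i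
    have : (fun a => R (stdVec (i a))) = fun a => ∑ j, R (stdVec (i a)) j • stdVec j := by
      funext a; exact eq_sum_stdVec _
    rw [this]
    change A.toMultilinearMap _ = _
    rw [MultilinearMap.map_sum]
    refine Finset.sum_congr rfl fun j _ => ?_
    rw [MultilinearMap.map_smul_univ]
    rfl
  -- The sum over multi-indices of a product over slots is the product over slots of the
  -- orthogonality relations `hR`.
  have hprod : ∀ j j' : Fin k → Fin 7,
      ∑ i : Fin k → Fin 7, (∏ a, R (stdVec (i a)) (j a)) * (∏ a, R (stdVec (i a)) (j' a)) =
        if j = j' then 1 else 0 := by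
    intro j j'
    simp_rw [← Finset.prod_mul_distrib]
    rw [← Fintype.prod_sum (fun a i => R (stdVec i) (j a) * R (stdVec i) (j' a))]
    simp_rw [hR]
    split_ifs with h
    · subst h; simp
    · obtain ⟨a, ha⟩ := Function.ne_iff.1 h
      exact Finset.prod_eq_zero (Finset.mem_univ a) (if_neg ha)
  simp_rw [hexp A, hexp B, Finset.sum_mul_sum]
  rw [Finset.sum_comm]
  refine Finset.sum_congr rfl fun j _ => ?_
  rw [Finset.sum_comm]
  rw [Finset.sum_eq_single j]
  · have := hprod j j
    rw [if_pos rfl] at this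
    calc _ = ∑ i : Fin k → Fin 7, ((∏ a, R (stdVec (i a)) (j a)) *
          (∏ a, R (stdVec (i a)) (j a))) *
          (A (fun a => stdVec (j a)) * B (fun a => stdVec (j a))) :=
          Finset.sum_congr rfl fun i _ => by ring
      _ = _ := by rw [← Finset.sum_mul, this, one_mul]
  · intro j' _ hj'
    have := hprod j j'
    rw [if_neg (Ne.symm hj')] at this
    calc _ = ∑ i : Fin k → Fin 7, ((∏ a, R (stdVec (i a)) (j a)) *
          (∏ a, R (stdVec (i a)) (j' a))) *
          (A (fun a => stdVec (j a)) * B (fun a => stdVec (j' a))) :=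
          Finset.sum_congr rfl fun i _ => by ring
      _ = _ := by rw [← Finset.sum_mul, this, zero_mul]
  · simp

/-- The product of two alternating forms is invariant under permutations of the indices and vanishes
on repeated ones, so both sides are 1/k! of the corresponding sums over all multi-indices. -/
theorem sum_orderEmb_apply_mul_apply_of_orthogonal {k : ℕ} (A B : E7 [⋀^Fin k]→ₗ[ℝ] ℝ)
    (R : E7 →L[ℝ] E7)
    (hR : ∀ j j', ∑ i, R (stdVec i) j * R (stdVec i) j' = if j = j' then 1 else 0) :
    ∑ I : Fin k ↪o Fin 7, A (fun a => R (stdVec (I a))) * B (fun a => R (stdVec (I a))) =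
      ∑ I : Fin k ↪o Fin 7, A (fun a => stdVec (I a)) * B (fun a => stdVec (I a)) := by
  have key : ∀ f : Fin 7 → E7,
      ∑ i : Fin k → Fin 7, A (fun a => f (i a)) * B (fun a => f (i a)) = (k.factorial : ℝ) *
        ∑ I : Fin k ↪o Fin 7, A (fun a => f (I a)) * B (fun a => f (I a)) := by
    intro f
    refine sum_eq_factorial_mul_sum_orderEmb
      (fun i => A (fun a => f (i a)) * B (fun a => f (i a))) ?_ ?_
    · intro i σ
      have hA := A.map_perm (fun a => f (i a)) σ
      have hB := B.map_perm (fun a => f (i a)) σ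
      change A ((fun a => f (i a)) ∘ σ) * B ((fun a => f (i a)) ∘ σ) = _
      rw [hA, hB]
      rcases Int.units_eq_one_or (Equiv.Perm.sign σ) with h | h <;> simp [h]
    · intro i hi
      obtain ⟨a, b, hab, hne⟩ : ∃ a b, i a = i b ∧ a ≠ b := by
        simpa [Function.Injective] using hi
      simp [A.map_eq_zero_of_eq (fun a => f (i a)) (by simp [hab]) hne]
  have h := sum_apply_mul_apply_of_orthogonal A B R hR
  rw [key (fun i => R (stdVec i)), key stdVec] at h
  exact mul_left_cancel₀ (by positivity) h

/-- The volume form of `ℝ⁷`. -/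
def volE7 {n : ℕ} (h : n = 7) : E7 [⋀^Fin n]→L[ℝ] ℝ := coordForm (Fin.cast h)

theorem volE7_append_stdVec {k l : ℕ} (h : k + l = 7) (I : Fin k → Fin 7) (J : Fin l → Fin 7) :
    volE7 h (Fin.append (fun a => stdVec (I a)) (fun a => stdVec (J a))) = arrSign h I J := by
  have h1 : Fin.append (fun a => stdVec (I a)) (fun a => stdVec (J a)) =
      fun a => stdVec (Fin.append I J a) := by
    funext a
    induction a using Fin.addCases <;> simp
  rw [h1, volE7, coordForm_stdVec, arrSign, ← Matrix.det_submatrix_equiv_self (finCongr h)]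
  change _ = Int.castRingHom ℝ _
  rw [RingHom.map_det]
  congr 1
  ext a b
  simp [Matrix.map_apply]

theorem altMap_sum_apply {ι : Type*} {k : ℕ} (s : Finset ι) (f : ι → E7 [⋀^Fin k]→ₗ[ℝ] ℝ)
    (v : Fin k → E7) : (∑ i ∈ s, f i) v = ∑ i ∈ s, f i v := by
  classical
  induction s using Finset.induction_on with
  | empty => simp
  | insert i s hi ih => rw [Finset.sum_insert hi, Finset.sum_insert hi, AlternatingMap.add_apply, ih]

/-- This expresses the star as a pairing of `α` with a partial evaluation of the volume form, in
which only orthonormality of the basis and the volume form enter. The complementary multi-index has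
disappeared, so invariance becomes visible. -/
theorem star0_apply {k l : ℕ} (h : k + l = 7) (α : E7 [⋀^Fin k]→L[ℝ] ℝ) (w : Fin l → E7) :
    star0 h α w = ∑ I : Fin k ↪o Fin 7,
      α (fun a => stdVec (I a)) * volE7 h (Fin.append (fun a => stdVec (I a)) w) := by
  suffices H : (star0 h α).toAlternatingMap = ∑ I : Fin k ↪o Fin 7,
      α (fun a => stdVec (I a)) • appendRight (volE7 h) (fun a => stdVec (I a)) by
    have := congrArg (fun f : E7 [⋀^Fin l]→ₗ[ℝ] ℝ => f w) H
    simp only [altMap_sum_apply] at this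
    exact this
  refine Module.Basis.ext_alternating (EuclideanSpace.basisFun (Fin 7) ℝ).toBasis fun i hi => ?_
  suffices H : ∀ i : Fin l → Fin 7, StrictMono i →
      (star0 h α).toAlternatingMap (fun a => stdVec (i a)) = (∑ I : Fin k ↪o Fin 7,
      α (fun a => stdVec (I a)) • appendRight (volE7 h) (fun a => stdVec (I a)))
        (fun a => stdVec (i a)) by
    have h1 := H _ (strictMono_comp_sort hi)
    have h2 : ∀ γ : E7 [⋀^Fin l]→ₗ[ℝ] ℝ, γ (fun a => stdVec ((i ∘ Tuple.sort i) a)) =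
        Equiv.Perm.sign (Tuple.sort i) • γ (fun a => stdVec (i a)) := fun γ =>
      γ.map_perm (fun a => stdVec (i a)) (Tuple.sort i)
    rw [h2, h2] at h1
    simpa using smul_left_cancel _ h1
  intro j hj
  have h3 : ∀ I : Fin k ↪o Fin 7, (appendRight (volE7 h) (fun a => stdVec (I a)))
      (fun a => stdVec (j a)) = arrSign h I j := fun I => volE7_append_stdVec h I j
  simp only [altMap_sum_apply, AlternatingMap.smul_apply, h3, smul_eq_mul]
  change star0 h α (fun a => stdVec (j a)) = _
  simp only [star0, ContinuousAlternatingMap.sum_apply, ContinuousAlternatingMap.smul_apply,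
    smul_eq_mul]
  refine Finset.sum_congr rfl fun I _ => ?_
  rw [Finset.sum_eq_single (OrderEmbedding.ofStrictMono j hj)]
  · rw [coordForm_stdVec_of_strictMono (OrderEmbedding.strictMono _) hj, if_pos]
    · simp; ring
    · rfl
  · intro J _ hJ
    rw [coordForm_stdVec_of_strictMono J.strictMono hj, if_neg, mul_zero]
    rintro rfl
    exact hJ (by ext; rfl)
  · simp

/-- For fixed `w` the value of the star at `R w` pairs `α` with `v ↦ vol(v, R w)`. This pairing is
unchanged when `R` is applied to the basis vectors, and `vol(R e_I, R w) = vol(e_I, w)`. -/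
theorem star0_compContinuousLinearMap {k l : ℕ} (h : k + l = 7) (α : E7 [⋀^Fin k]→L[ℝ] ℝ)
    (R : E7 →L[ℝ] E7)
    (hR : ∀ j j', ∑ i, R (stdVec i) j * R (stdVec i) j' = if j = j' then 1 else 0)
    (hvol : (volE7 h).compContinuousLinearMap R = volE7 h) :
    star0 h (α.compContinuousLinearMap R) = (star0 h α).compContinuousLinearMap R := by
  ext w
  rw [ContinuousAlternatingMap.compContinuousLinearMap_apply, star0_apply, star0_apply]
  have h1 := sum_orderEmb_apply_mul_apply_of_orthogonal α.toAlternatingMap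
    (appendLeft (volE7 h) (R ∘ w)) R hR
  change ∑ I : Fin k ↪o Fin 7, α (fun a => R (stdVec (I a))) *
    volE7 h (Fin.append (fun a => R (stdVec (I a))) (R ∘ w)) = ∑ I : Fin k ↪o Fin 7,
      α (fun a => stdVec (I a)) * volE7 h (Fin.append (fun a => stdVec (I a)) (R ∘ w)) at h1
  rw [← h1]
  refine Finset.sum_congr rfl fun I _ => ?_
  congr 1
  conv_lhs => rw [← hvol]
  rw [ContinuousAlternatingMap.compContinuousLinearMap_apply]
  congr 1
  funext a
  induction a using Fin.addCases <;> simp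

end

noncomputable section

/-! ## `G₂ ⊂ SO(7)` -/

/-- The coefficient of `e^I` at `(e_{j_1}, …, e_{j_k})`: a determinant of Kronecker deltas, by
expansion along the first row. -/
def kroneckerDet : (k : ℕ) → (Fin k → Fin 7) → (Fin k → Fin 7) → ℤ
  | 0, _, _ => 1
  | k + 1, I, j => ∑ b : Fin (k + 1), if j 0 = I b then
      (-1) ^ (b : ℕ) * kroneckerDet k (fun a => I (b.succAbove a)) (fun a => j a.succ) else 0

/-- The recursive integer determinant can be evaluated by the kernel, unlike the real determinant.
This is the bridge from forms to decidable identities. -/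
theorem coordForm_stdVec_eq_kroneckerDet {k : ℕ} (I j : Fin k → Fin 7) :
    coordForm I (fun a => stdVec (j a)) = kroneckerDet k I j := by
  rw [coordForm_stdVec]
  induction k with
  | zero => simp [kroneckerDet]
  | succ k ih =>
    rw [Matrix.det_succ_row_zero, kroneckerDet]
    push_cast
    refine Finset.sum_congr rfl fun b _ => ?_
    rw [← ih]
    by_cases h : j 0 = I b
    · simp only [Matrix.of_apply, h, if_true]
      rw [mul_one]
      rfl
    · simp [h]

/-- `±(c + 1)` in position `(a, b)` means `φ₀(e_a, e_b, e_c) = ±1`. -/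
def crossTable : Fin 7 → Fin 7 → ℤ :=
  ![![0, 7, 5, -6, -3, 4, -2], ![-7, 0, -6, -5, 4, 3, 1], ![-5, 6, 0, 7, 1, -2, -4],
    ![6, 5, -7, 0, -2, -1, 3], ![3, -4, -1, 2, 0, 7, -6], ![-4, -3, 2, 1, -7, 0, 5],
    ![2, -1, 4, -3, 6, -5, 0]]

/-- The values of `φ₀` on the standard basis. -/
def phiCoeff (i : Fin 3 → Fin 7) : ℤ :=
  match crossTable (i 0) (i 1) with
  | .ofNat m => if m = (i 2 : ℕ) + 1 then 1 else 0
  | .negSucc m => if m = (i 2 : ℕ) then -1 else 0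

set_option maxRecDepth 100000 in
-- The table is a fast way to evaluate φ₀ in the nested sums below; it is compared once and for all
-- with the seven determinants on all triples.
theorem phiCoeff_eq : ∀ a b c : Fin 7, phiCoeff ![a, b, c] =
    kroneckerDet 3 ![0, 1, 6] ![a, b, c] + kroneckerDet 3 ![2, 3, 6] ![a, b, c]
      + kroneckerDet 3 ![4, 5, 6] ![a, b, c] + kroneckerDet 3 ![0, 2, 4] ![a, b, c]
      - kroneckerDet 3 ![0, 3, 5] ![a, b, c] - kroneckerDet 3 ![1, 2, 5] ![a, b, c]
      - kroneckerDet 3 ![1, 3, 4] ![a, b, c] := by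
  decide +kernel

theorem phi0_stdVec (i : Fin 3 → Fin 7) : phi0 (fun a => stdVec (i a)) = phiCoeff i := by
  have hi : i = ![i 0, i 1, i 2] := by funext a; fin_cases a <;> rfl
  rw [hi, phiCoeff_eq]
  simp only [phi0, ContinuousAlternatingMap.add_apply,
    ContinuousAlternatingMap.sub_apply, coordForm_stdVec_eq_kroneckerDet]
  push_cast
  ring

theorem update_vec3_zero {α : Type*} (a b c x : α) :
    Function.update ![a, b, c] 0 x = ![x, b, c] := by
  funext i; fin_cases i <;> rfl

theorem update_vec3_one {α : Type*} (a b c x : α) :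
    Function.update ![a, b, c] 1 x = ![a, x, c] := by
  funext i; fin_cases i <;> rfl

theorem update_vec3_two {α : Type*} (a b c x : α) :
    Function.update ![a, b, c] 2 x = ![a, b, x] := by
  funext i; fin_cases i <;> rfl

/-! ### Alternating 3-forms as trilinear maps. -/

section Trilinear

variable (f : E7 [⋀^Fin 3]→L[ℝ] ℝ)

theorem map_vec3_add_zero (a b v w : E7) : f ![a + b, v, w] = f ![a, v, w] + f ![b, v, w] := by
  have := f.map_update_add ![0, v, w] 0 a b
  simpa only [update_vec3_zero] using this

theorem map_vec3_smul_zero (r : ℝ) (a v w : E7) : f ![r • a, v, w] = r * f ![a, v, w] := by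
  have := f.map_update_smul ![0, v, w] 0 r a
  simpa only [update_vec3_zero, smul_eq_mul] using this

theorem map_vec3_add_one (u a b w : E7) : f ![u, a + b, w] = f ![u, a, w] + f ![u, b, w] := by
  have := f.map_update_add ![u, 0, w] 1 a b
  simpa only [update_vec3_one] using this

theorem map_vec3_smul_one (r : ℝ) (u a w : E7) : f ![u, r • a, w] = r * f ![u, a, w] := by
  have := f.map_update_smul ![u, 0, w] 1 r a
  simpa only [update_vec3_one, smul_eq_mul] using this

theorem map_vec3_add_two (u v a b : E7) : f ![u, v, a + b] = f ![u, v, a] + f ![u, v, b] := by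
  have := f.map_update_add ![u, v, 0] 2 a b
  simpa only [update_vec3_two] using this

theorem map_vec3_smul_two (r : ℝ) (u v a : E7) : f ![u, v, r • a] = r * f ![u, v, a] := by
  have := f.map_update_smul ![u, v, 0] 2 r a
  simpa only [update_vec3_two, smul_eq_mul] using this

/-- The trilinear map of an alternating 3-form. -/
def trilin : E7 →ₗ[ℝ] E7 →ₗ[ℝ] E7 →ₗ[ℝ] ℝ where
  toFun u := LinearMap.mk₂ ℝ (fun w w' => f ![u, w, w']) (map_vec3_add_one f u)
    (fun r => map_vec3_smul_one f r u) (map_vec3_add_two f u)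
    (fun r v a => map_vec3_smul_two f r u v a)
  map_add' a b := by
    refine LinearMap.ext fun w => LinearMap.ext fun w' => ?_
    exact map_vec3_add_zero f a b w w'
  map_smul' r a := by
    refine LinearMap.ext fun w => LinearMap.ext fun w' => ?_
    exact map_vec3_smul_zero f r a w w'

theorem trilin_apply (u w w' : E7) : trilin f u w w' = f ![u, w, w'] := rfl

end Trilinear

theorem phi0_toAlternatingMap_stdVec (i : Fin 3 → Fin 7) :
    phi0.toAlternatingMap (fun a => stdVec (i a)) = phiCoeff i := by
  rw [← phi0_stdVec, ContinuousAlternatingMap.coe_toAlternatingMap]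

/-- The trilinear map `φ₀`. -/
def phiBilin : E7 →ₗ[ℝ] E7 →ₗ[ℝ] E7 →ₗ[ℝ] ℝ := trilin phi0

theorem phiBilin_apply (u w w' : E7) : phiBilin u w w' = phi0 ![u, w, w'] := trilin_apply phi0 u w w'

/-! ### The 7-form ι_uφ₀ ∧ ι_vφ₀ ∧ φ₀ and the metric of φ₀. -/

section Wedge

variable {n m : ℕ}

/-- Twice the wedge product of the alternation of a bilinear form with an alternating form. -/
def bilinWedge (h : n + 2 = m) (s : E7 →ₗ[ℝ] E7 →ₗ[ℝ] ℝ) (β : E7 [⋀^Fin n]→ₗ[ℝ] ℝ) :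
    E7 [⋀^Fin m]→ₗ[ℝ] ℝ :=
  (AlternatingMap.alternatizeUncurryFin (AlternatingMap.alternatizeUncurryFinLM ∘ₗ
    LinearMap.mk₂ ℝ (fun w w' => s w w' • β)
      (fun a b c => by simp [add_smul]) (fun r a c => by simp [mul_smul])
      (fun c a b => by simp [add_smul])
      (fun r c a => by simp [mul_smul]))).domDomCongr (finCongr h)

theorem bilinWedge_apply (h : n + 2 = m) (s : E7 →ₗ[ℝ] E7 →ₗ[ℝ] ℝ) (β : E7 [⋀^Fin n]→ₗ[ℝ] ℝ)
    (v : Fin m → E7) : bilinWedge h s β v = ∑ a : Fin (n + 2), ∑ b : Fin (n + 1),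
      (-1) ^ (a : ℕ) * ((-1) ^ (b : ℕ) *
        (s (v (a.cast h)) (v ((a.succAbove b).cast h)) *
          β (fun c => v ((a.succAbove (b.succAbove c)).cast h)))) := by
  subst h
  simp [bilinWedge, AlternatingMap.alternatizeUncurryFin_apply, Finset.mul_sum,
    Fin.removeNth]
  rfl

/-- The integral version of `bilinWedge`, on the standard basis. -/
def bilinWedgeCoeff (h : n + 2 = m) (s : Fin 7 → Fin 7 → ℤ) (β : (Fin n → Fin 7) → ℤ)
    (i : Fin m → Fin 7) : ℤ :=
  ∑ a : Fin (n + 2), ∑ b : Fin (n + 1),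
    -- The test for zero keeps the evaluation small: `β` is expanded only where the coefficient of
    -- `s` does not vanish.
    if s (i (a.cast h)) (i ((a.succAbove b).cast h)) = 0 then 0 else
    (-1) ^ (a : ℕ) * ((-1) ^ (b : ℕ) *
      (s (i (a.cast h)) (i ((a.succAbove b).cast h)) *
        β (fun c => i ((a.succAbove (b.succAbove c)).cast h))))

theorem bilinWedge_stdVec (h : n + 2 = m) {s : E7 →ₗ[ℝ] E7 →ₗ[ℝ] ℝ} {β : E7 [⋀^Fin n]→ₗ[ℝ] ℝ}
    {s' : Fin 7 → Fin 7 → ℤ} {β' : (Fin n → Fin 7) → ℤ}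
    (hs : ∀ a b, s (stdVec a) (stdVec b) = s' a b)
    (hβ : ∀ i : Fin n → Fin 7, β (fun a => stdVec (i a)) = β' i) (i : Fin m → Fin 7) :
    bilinWedge h s β (fun a => stdVec (i a)) = bilinWedgeCoeff h s' β' i := by
  rw [bilinWedge_apply, bilinWedgeCoeff]
  push_cast
  refine Finset.sum_congr rfl fun a _ => Finset.sum_congr rfl fun b _ => ?_
  rw [hs, hβ (fun c => i ((a.succAbove (b.succAbove c)).cast h))]
  split_ifs with h
  · simp [h]
  · rfl

end Wedge

theorem three_add_two_eq : 3 + 2 = 5 := rfl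

theorem five_add_two_eq : 5 + 2 = 7 := rfl

/-- The 5-form `ι_v φ₀ ∧ φ₀` (up to a constant). -/
def phiFiveForm (v : E7) : E7 [⋀^Fin 5]→ₗ[ℝ] ℝ :=
  bilinWedge three_add_two_eq (phiBilin v) phi0.toAlternatingMap

/-- The 7-form `ι_u φ₀ ∧ ι_v φ₀ ∧ φ₀` (up to a constant). -/
def phiSevenForm (u v : E7) : E7 [⋀^Fin 7]→ₗ[ℝ] ℝ :=
  bilinWedge five_add_two_eq (phiBilin u) (phiFiveForm v)

/-- The integral version of `phiFiveForm`. -/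
def phiFiveCoeff (j : Fin 7) (i : Fin 5 → Fin 7) : ℤ :=
  bilinWedgeCoeff three_add_two_eq (fun a b => phiCoeff ![j, a, b]) phiCoeff i

/-- The integral version of `phiSevenForm`. -/
def phiSevenCoeff (i j : Fin 7) : ℤ :=
  bilinWedgeCoeff five_add_two_eq (fun a b => phiCoeff ![i, a, b]) (phiFiveCoeff j) (fun a => a)

theorem phiBilin_stdVec (i a b : Fin 7) :
    phiBilin (stdVec i) (stdVec a) (stdVec b) = phiCoeff ![i, a, b] := by
  rw [← phi0_stdVec, phiBilin_apply]
  congr 1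
  funext c
  fin_cases c <;> rfl

theorem phiFiveForm_stdVec (j : Fin 7) (i : Fin 5 → Fin 7) :
    phiFiveForm (stdVec j) (fun a => stdVec (i a)) = phiFiveCoeff j i := by
  have h := bilinWedge_stdVec three_add_two_eq (s := phiBilin (stdVec j))
    (β := phi0.toAlternatingMap) (s' := fun a b => phiCoeff ![j, a, b]) (β' := phiCoeff)
  have h' := h (phiBilin_stdVec j) phi0_toAlternatingMap_stdVec i
  rw [phiFiveForm, phiFiveCoeff]
  exact h'

theorem phiSevenForm_stdVec (i j : Fin 7) :
    phiSevenForm (stdVec i) (stdVec j) (fun a => stdVec a) = phiSevenCoeff i j := by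
  have h := bilinWedge_stdVec five_add_two_eq (s := phiBilin (stdVec i))
    (β := phiFiveForm (stdVec j)) (s' := fun a b => phiCoeff ![i, a, b]) (β' := phiFiveCoeff j)
  have h' := h (phiBilin_stdVec i) (phiFiveForm_stdVec j) (fun a => a)
  rw [phiSevenForm, phiSevenCoeff]
  exact h'

set_option maxRecDepth 100000 in
-- The classical identity is ι_uφ₀ ∧ ι_vφ₀ ∧ φ₀ = 6⟨u, v⟩ vol. Each of the two uses of `bilinWedge`
-- runs over ordered pairs and contributes a factor 2, which gives 24.
theorem phiSevenCoeff_eq : ∀ i j, phiSevenCoeff i j = if i = j then 24 else 0 := by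
  decide +kernel

theorem bilinWedge_add_left {n m : ℕ} (h : n + 2 = m) (s t : E7 →ₗ[ℝ] E7 →ₗ[ℝ] ℝ) (β : E7 [⋀^Fin n]→ₗ[ℝ] ℝ)
    (v : Fin m → E7) :
    bilinWedge h (s + t) β v = bilinWedge h s β v + bilinWedge h t β v := by
  simp only [bilinWedge_apply, LinearMap.add_apply, add_mul, mul_add, Finset.sum_add_distrib]

theorem bilinWedge_smul_left {n m : ℕ} (h : n + 2 = m) (r : ℝ) (s : E7 →ₗ[ℝ] E7 →ₗ[ℝ] ℝ)
    (β : E7 [⋀^Fin n]→ₗ[ℝ] ℝ) (v : Fin m → E7) :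
    bilinWedge h (r • s) β v = r * bilinWedge h s β v := by
  simp only [bilinWedge_apply, LinearMap.smul_apply, smul_eq_mul, Finset.mul_sum]
  refine Finset.sum_congr rfl fun a _ => Finset.sum_congr rfl fun b _ => by ring

theorem bilinWedge_add_right {n m : ℕ} (h : n + 2 = m) (s : E7 →ₗ[ℝ] E7 →ₗ[ℝ] ℝ) (β γ : E7 [⋀^Fin n]→ₗ[ℝ] ℝ)
    (v : Fin m → E7) :
    bilinWedge h s (β + γ) v = bilinWedge h s β v + bilinWedge h s γ v := by
  simp only [bilinWedge_apply, AlternatingMap.add_apply, mul_add, Finset.sum_add_distrib]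

theorem bilinWedge_smul_right {n m : ℕ} (h : n + 2 = m) (r : ℝ) (s : E7 →ₗ[ℝ] E7 →ₗ[ℝ] ℝ)
    (β : E7 [⋀^Fin n]→ₗ[ℝ] ℝ) (v : Fin m → E7) :
    bilinWedge h s (r • β) v = r * bilinWedge h s β v := by
  simp only [bilinWedge_apply, AlternatingMap.smul_apply, smul_eq_mul, Finset.mul_sum]
  refine Finset.sum_congr rfl fun a _ => Finset.sum_congr rfl fun b _ => by ring

/-- `phiSevenForm`, evaluated on the standard basis, as a bilinear form. -/
def phiMetric : E7 →ₗ[ℝ] E7 →ₗ[ℝ] ℝ :=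
  LinearMap.mk₂ ℝ (fun u v => phiSevenForm u v (fun a => stdVec a))
    (fun a b c => by simp only [phiSevenForm, map_add, bilinWedge_add_left])
    (fun r a c => by simp only [phiSevenForm, map_smul, bilinWedge_smul_left, smul_eq_mul])
    (fun c a b => by
      have : bilinWedge three_add_two_eq (phiBilin (a + b)) phi0.toAlternatingMap =
          bilinWedge three_add_two_eq (phiBilin a) phi0.toAlternatingMap +
            bilinWedge three_add_two_eq (phiBilin b) phi0.toAlternatingMap := by
        ext v; rw [map_add, bilinWedge_add_left, AlternatingMap.add_apply]
      simp only [phiSevenForm, phiFiveForm, this, bilinWedge_add_right])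
    (fun r c a => by
      have : bilinWedge three_add_two_eq (phiBilin (r • a)) phi0.toAlternatingMap =
          r • bilinWedge three_add_two_eq (phiBilin a) phi0.toAlternatingMap := by
        ext v; rw [map_smul, bilinWedge_smul_left, AlternatingMap.smul_apply, smul_eq_mul]
      simp only [phiSevenForm, phiFiveForm, this, bilinWedge_smul_right, smul_eq_mul])

theorem phiMetric_apply (u v : E7) : phiMetric u v = 24 * ∑ i, u i * v i := by
  conv_lhs => rw [eq_sum_stdVec u, eq_sum_stdVec v]
  have h : ∀ i j, phiMetric (stdVec i) (stdVec j) = if i = j then 24 else 0 := by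
    intro i j
    refine (phiSevenForm_stdVec i j).trans ?_
    rw [phiSevenCoeff_eq]
    split_ifs <;> simp
  simp only [map_sum, map_smul, LinearMap.sum_apply, LinearMap.smul_apply, h, smul_eq_mul]
  rw [Finset.mul_sum]
  refine Finset.sum_congr rfl fun i _ => ?_
  simp
  ring

/-- The matrix of a linear map in the standard basis. -/
def stdMatrix (g : E7 →L[ℝ] E7) : Matrix (Fin 7) (Fin 7) ℝ := Matrix.of fun j i => g (stdVec i) j

theorem alternating_seven_apply (f : E7 [⋀^Fin 7]→ₗ[ℝ] ℝ) (v : Fin 7 → E7) :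
    f v = f (fun a => stdVec a) * (Matrix.of fun j i => v i j).det := by
  let e := (EuclideanSpace.basisFun (Fin 7) ℝ).toBasis
  have h := f.eq_smul_basis_det e
  have h1 : e.det v = (Matrix.of fun j i => v i j).det := by
    rw [Module.Basis.det_apply]
    congr 1
  rw [h, AlternatingMap.smul_apply, AlternatingMap.smul_apply, h1]
  have h2 : (fun a => stdVec a) = e := by
    funext a; simp [e]
  rw [h2, Module.Basis.det_self]
  simp

theorem phiSevenForm_map {g : E7 →L[ℝ] E7} (hg : phi0.compContinuousLinearMap g = phi0)
    (u v : E7) (w : Fin 7 → E7) :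
    phiSevenForm (g u) (g v) (fun a => g (w a)) = phiSevenForm u v w := by
  have h : ∀ x : Fin 3 → E7, phi0 (fun a => g (x a)) = phi0 x := by
    intro x
    conv_rhs => rw [← hg]
    rfl
  have h3 : ∀ a b c, phi0 ![g a, g b, g c] = phi0 ![a, b, c] := by
    intro a b c
    rw [← h ![a, b, c]]
    refine congrArg phi0 ?_
    funext i; fin_cases i <;> rfl
  rw [phiSevenForm, phiSevenForm, phiFiveForm, phiFiveForm, bilinWedge_apply, bilinWedge_apply]
  refine Finset.sum_congr rfl fun a _ => Finset.sum_congr rfl fun b _ => ?_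
  rw [bilinWedge_apply, bilinWedge_apply]
  simp only [phiBilin_apply, h3]
  congr 3
  refine Finset.sum_congr rfl fun c _ => Finset.sum_congr rfl fun d _ => ?_
  congr 3
  exact h _

/-- The 7-form is natural in φ₀. Comparing its values on the basis and on the image of the basis
under `g` gives det g · ⟨g u, g v⟩ = ⟨u, v⟩, from which both the determinant and orthogonality
follow. -/
theorem stdMatrix_of_map_phi0 {g : E7 →L[ℝ] E7} (hg : phi0.compContinuousLinearMap g = phi0) :
    (stdMatrix g)ᵀ * stdMatrix g = 1 ∧ (stdMatrix g).det = 1 := by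
  set M := stdMatrix g with hM
  have h1 : M.det • (Mᵀ * M) = 1 := by
    ext i j
    have h := phiSevenForm_map hg (stdVec i) (stdVec j) (fun a => stdVec a)
    rw [alternating_seven_apply] at h
    change phiMetric (g (stdVec i)) (g (stdVec j)) * M.det =
      phiMetric (stdVec i) (stdVec j) at h
    rw [phiMetric_apply, phiMetric_apply] at h
    have h2 : ∑ k, stdVec i k * stdVec j k = (1 : Matrix (Fin 7) (Fin 7) ℝ) i j := by
      simp [Matrix.one_apply, eq_comm]
    rw [h2] at h
    rw [Matrix.smul_apply, Matrix.mul_apply, smul_eq_mul]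
    simp only [Matrix.transpose_apply, hM, stdMatrix, Matrix.of_apply] at h ⊢
    linarith
  -- Seven factors come from scaling a 7 × 7 matrix by the determinant, two from `Mᵀ * M`. The
  -- exponent is odd, so the real solution is 1.
  have h2 : M.det ^ 9 = 1 := by
    have := congrArg Matrix.det h1
    rw [Matrix.det_smul, Matrix.det_mul, Matrix.det_transpose, Matrix.det_one,
      Fintype.card_fin] at this
    linarith
  have h3 : M.det = 1 := by
    have : Odd 9 := by decide
    exact this.strictMono_pow.injective (by simpa using h2)
  rw [h3, one_smul] at h1
  exact ⟨h1, h3⟩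

theorem row_orthonormal_of_map_phi0 {g : E7 →L[ℝ] E7}
    (hg : phi0.compContinuousLinearMap g = phi0) (j j' : Fin 7) :
    ∑ i, g (stdVec i) j * g (stdVec i) j' = if j = j' then 1 else 0 := by
  have h := mul_eq_one_comm.1 (stdMatrix_of_map_phi0 hg).1
  have := congrFun (congrFun h j) j'
  rwa [Matrix.mul_apply, Matrix.one_apply] at this

theorem seven_form_compContinuousLinearMap {g : E7 →L[ℝ] E7}
    (hg : phi0.compContinuousLinearMap g = phi0) (f : E7 [⋀^Fin 7]→L[ℝ] ℝ) :
    f.compContinuousLinearMap g = f := by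
  ext v
  have h1 := alternating_seven_apply (f.compContinuousLinearMap g).toAlternatingMap v
  have h2 := alternating_seven_apply f.toAlternatingMap v
  have h3 := alternating_seven_apply f.toAlternatingMap (fun a => g (stdVec a))
  have h4 : (Matrix.of fun j i => g (stdVec i) j).det = 1 := (stdMatrix_of_map_phi0 hg).2
  rw [h4, mul_one] at h3
  refine h1.trans (Eq.trans ?_ h2.symm)
  exact congrArg (· * _) h3

theorem volE7_compContinuousLinearMap {g : E7 →L[ℝ] E7}
    (hg : phi0.compContinuousLinearMap g = phi0) {n : ℕ} (h : n = 7) :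
    (volE7 h).compContinuousLinearMap g = volE7 h := by
  subst h
  exact seven_form_compContinuousLinearMap hg _

/-- The Hodge star is invariant under `G₂`. -/
theorem star0_comp_of_map_phi0 {g : E7 →L[ℝ] E7} (hg : phi0.compContinuousLinearMap g = phi0)
    {k l : ℕ} (h : k + l = 7) (α : E7 [⋀^Fin k]→L[ℝ] ℝ) :
    star0 h (α.compContinuousLinearMap g) = (star0 h α).compContinuousLinearMap g :=
  star0_compContinuousLinearMap h α g (row_orthonormal_of_map_phi0 hg)
    (volE7_compContinuousLinearMap hg h)

/-! ## The Hodge star of a positive form -/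

section Hodge

variable {V W : Type*} [AddCommGroup V] [Module ℝ V] [TopologicalSpace V]
  [AddCommGroup W] [Module ℝ W] [TopologicalSpace W]

/-- The coordinates `e` and those chosen in the definition differ by a map `R` that preserves φ₀,
and `star0` commutes with such maps. So the choice is immaterial. -/
theorem hodgeStar_of_coords {α : V [⋀^Fin 3]→L[ℝ] ℝ} (e : V ≃L[ℝ] E7)
    (he : phi0.compContinuousLinearMap (e : V →L[ℝ] E7) = α) {k l : ℕ} (hkl : k + l = 7)
    (β : V [⋀^Fin k]→L[ℝ] ℝ) :
    hodgeStar α hkl β = (star0 hkl (β.compContinuousLinearMap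
      (e.symm : E7 →L[ℝ] V))).compContinuousLinearMap (e : V →L[ℝ] E7) := by
  have hα : IsPositiveForm α := ⟨e, he⟩
  rw [hodgeStar, dif_pos hα]
  set e' := adaptedCoords α hα
  have he' : phi0.compContinuousLinearMap (e' : V →L[ℝ] E7) = α := hα.choose_spec
  let R : E7 →L[ℝ] E7 := (e' : V →L[ℝ] E7).comp (e.symm : E7 →L[ℝ] V)
  have hR : phi0.compContinuousLinearMap R = phi0 := by
    ext v
    have h1 := congrArg (fun f => f (fun a => e.symm (v a))) (he'.trans he.symm)
    refine h1.trans ?_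
    change phi0 (fun a => e (e.symm (v a))) = _
    simp
  have h2 := star0_comp_of_map_phi0 hR hkl
    (β.compContinuousLinearMap (e'.symm : E7 →L[ℝ] V))
  have h3 : (β.compContinuousLinearMap (e'.symm : E7 →L[ℝ] V)).compContinuousLinearMap R =
      β.compContinuousLinearMap (e.symm : E7 →L[ℝ] V) := by
    ext v
    change β (fun a => e'.symm (e' (e.symm (v a)))) = β (fun a => e.symm (v a))
    simp
  rw [h3] at h2
  rw [h2]
  ext v
  change star0 hkl _ (fun a => e' (v a)) = star0 hkl _ (fun a => e' (e.symm (e (v a))))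
  simp

theorem formNormSq_of_coords {α : V [⋀^Fin 3]→L[ℝ] ℝ} (e : V ≃L[ℝ] E7)
    (he : phi0.compContinuousLinearMap (e : V →L[ℝ] E7) = α) {k : ℕ}
    (β : V [⋀^Fin k]→L[ℝ] ℝ) :
    formNormSq α β = ∑ I : Fin k ↪o Fin 7, (β (fun a => e.symm (stdVec (I a)))) ^ 2 := by
  have hα : IsPositiveForm α := ⟨e, he⟩
  rw [formNormSq, dif_pos hα]
  set e' := adaptedCoords α hα
  have he' : phi0.compContinuousLinearMap (e' : V →L[ℝ] E7) = α := hα.choose_spec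
  let R : E7 →L[ℝ] E7 := (e : V →L[ℝ] E7).comp (e'.symm : E7 →L[ℝ] V)
  have hR : phi0.compContinuousLinearMap R = phi0 := by
    ext v
    have h1 := congrArg (fun f => f (fun a => e'.symm (v a))) (he.trans he'.symm)
    refine h1.trans ?_
    change phi0 (fun a => e' (e'.symm (v a))) = _
    simp
  let γ := (β.compContinuousLinearMap (e.symm : E7 →L[ℝ] V)).toAlternatingMap
  have h2 := sum_orderEmb_apply_mul_apply_of_orthogonal γ γ R (row_orthonormal_of_map_phi0 hR)
  have h3 : ∀ x : Fin k → E7, γ (fun a => R (x a)) = β (fun a => e'.symm (x a)) := by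
    intro x
    change β (fun a => e.symm (e (e'.symm (x a)))) = _
    simp
  have h4 : ∀ x : Fin k → E7, γ (fun a => x a) = β (fun a => e.symm (x a)) := fun x => rfl
  simp only [h3] at h2
  simp_rw [pow_two]
  exact h2

theorem altWedge_comp (f : V →L[ℝ] W) {k l : ℕ} (α : W [⋀^Fin k]→L[ℝ] ℝ)
    (β : W [⋀^Fin l]→L[ℝ] ℝ) :
    altWedge (α.compContinuousLinearMap f) (β.compContinuousLinearMap f) =
      (altWedge α β).compContinuousLinearMap f := by
  ext v
  simp only [altWedge, ContinuousAlternatingMap.smul_apply,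
    ContinuousAlternatingMap.compContinuousLinearMap_apply,
    ContinuousMultilinearMap.alternatization_apply_apply]
  rfl

end Hodge

end

noncomputable section

/-! ## Forms with integer coefficients -/

section Coefficients

variable {k l : ℕ}

/-- The form `∑ c_I e^I`, for a list of pairs `(c_I, I)`. -/
def formOfList (L : List (ℤ × (Fin k → Fin 7))) : E7 [⋀^Fin k]→L[ℝ] ℝ :=
  (L.map fun t => (t.1 : ℝ) • coordForm t.2).sum

/-- The values of `formOfList` on the standard basis. -/
def listCoeff (L : List (ℤ × (Fin k → Fin 7))) (i : Fin k → Fin 7) : ℤ :=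
  (L.map fun t => t.1 * kroneckerDet k t.2 i).sum

theorem formOfList_cons (t : ℤ × (Fin k → Fin 7)) (L : List (ℤ × (Fin k → Fin 7))) :
    formOfList (t :: L) = (t.1 : ℝ) • coordForm t.2 + formOfList L := by
  simp [formOfList]

theorem formOfList_nil : formOfList ([] : List (ℤ × (Fin k → Fin 7))) = 0 := rfl

theorem formOfList_stdVec (L : List (ℤ × (Fin k → Fin 7))) (i : Fin k → Fin 7) :
    formOfList L (fun a => stdVec (i a)) = listCoeff L i := by
  induction L with
  | nil => simp [formOfList, listCoeff]
  | cons t L ih =>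
    rw [formOfList_cons, ContinuousAlternatingMap.add_apply, ih,
      ContinuousAlternatingMap.smul_apply, coordForm_stdVec_eq_kroneckerDet]
    simp [listCoeff]

theorem arrSign_eq_kroneckerDet (h : k + l = 7) (I : Fin k → Fin 7) (J : Fin l → Fin 7) :
    arrSign h I J = kroneckerDet (k + l) (Fin.cast h) (Fin.append I J) := by
  have h1 : Fin.append (fun a => stdVec (I a)) (fun a => stdVec (J a)) =
      fun a => stdVec (Fin.append I J a) := by
    funext a
    induction a using Fin.addCases <;> simp
  have h2 := volE7_append_stdVec h I J
  rw [h1, volE7, coordForm_stdVec_eq_kroneckerDet] at h2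
  exact (Int.cast_injective h2).symm

theorem star0_add (h : k + l = 7) (α β : E7 [⋀^Fin k]→L[ℝ] ℝ) :
    star0 h (α + β) = star0 h α + star0 h β := by
  ext w
  simp only [star0_apply, ContinuousAlternatingMap.add_apply, add_mul, Finset.sum_add_distrib]

theorem star0_smul (h : k + l = 7) (r : ℝ) (α : E7 [⋀^Fin k]→L[ℝ] ℝ) :
    star0 h (r • α) = r • star0 h α := by
  ext w
  simp only [star0_apply, ContinuousAlternatingMap.smul_apply, smul_eq_mul, Finset.mul_sum,
    mul_assoc]

theorem star0_zero (h : k + l = 7) : star0 h (0 : E7 [⋀^Fin k]→L[ℝ] ℝ) = 0 := by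
  ext w
  simp [star0_apply]

theorem star0_coordForm_stdVec (h : k + l = 7) {I : Fin k → Fin 7} (hI : StrictMono I)
    (j : Fin l → Fin 7) :
    star0 h (coordForm I) (fun a => stdVec (j a)) = arrSign h I j := by
  rw [star0_apply, Finset.sum_eq_single (OrderEmbedding.ofStrictMono I hI)]
  · rw [coordForm_stdVec_of_strictMono hI (OrderEmbedding.strictMono _), if_pos (show ⇑(OrderEmbedding.ofStrictMono I hI) = I from rfl),
      one_mul]
    exact volE7_append_stdVec h I j
  · intro J _ hJ
    rw [coordForm_stdVec_of_strictMono hI J.strictMono, if_neg, zero_mul]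
    intro h
    exact hJ (by ext a; exact congrArg Fin.val (congrFun h a))
  · simp

theorem star0_formOfList_stdVec (h : k + l = 7) (L : List (ℤ × (Fin k → Fin 7)))
    (hL : ∀ t ∈ L, StrictMono t.2) (j : Fin l → Fin 7) :
    star0 h (formOfList L) (fun a => stdVec (j a)) =
      ((L.map fun t => t.1 * kroneckerDet (k + l) (Fin.cast h) (Fin.append t.2 j)).sum : ℤ) := by
  induction L with
  | nil => simp [formOfList_nil, star0_zero]
  | cons t L ih =>
    rw [formOfList_cons, star0_add, star0_smul, ContinuousAlternatingMap.add_apply,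
      ContinuousAlternatingMap.smul_apply, ih fun t ht => hL t (List.mem_cons_of_mem _ ht),
      star0_coordForm_stdVec h (hL t List.mem_cons_self), arrSign_eq_kroneckerDet]
    simp

/-- The alternating sum defining `2! 2! (α ∧ α)`, on the standard basis. -/
def wedgeSquareCoeff (c : (Fin 2 → Fin 7) → ℤ) (i : Fin 4 → Fin 7) : ℤ :=
  ∑ σ : Equiv.Perm (Fin 4), (Equiv.Perm.sign σ : ℤ) *
    (c ![i (σ 0), i (σ 1)] * c ![i (σ 2), i (σ 3)])

theorem altWedge_self_stdVec {α : E7 [⋀^Fin 2]→L[ℝ] ℝ} {c : (Fin 2 → Fin 7) → ℤ}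
    (hα : ∀ i : Fin 2 → Fin 7, α (fun a => stdVec (i a)) = c i) (i : Fin 4 → Fin 7) :
    altWedge α α (fun a => stdVec (i a)) = (1 / 4 : ℝ) * wedgeSquareCoeff c i := by
  have h1 : ∀ σ : Equiv.Perm (Fin 4), altProd α α (fun a => stdVec (i (σ a))) =
      c ![i (σ 0), i (σ 1)] * c ![i (σ 2), i (σ 3)] := by
    intro σ
    rw [← hα, ← hα]
    change α _ * α _ = _
    congr 2 <;> (funext a; fin_cases a <;> rfl)
  have h2 : ∀ σ : Equiv.Perm (Fin (2 + 2)), (Equiv.Perm.sign σ) •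
      altProd α α (fun a => stdVec (i (σ a))) =
        ((Equiv.Perm.sign σ : ℤ) : ℝ) * (c ![i (σ 0), i (σ 1)] * c ![i (σ 2), i (σ 3)]) := by
    intro σ
    rw [Units.smul_def, zsmul_eq_mul]
    exact congrArg _ (h1 σ)
  rw [altWedge, ContinuousAlternatingMap.smul_apply,
    ContinuousMultilinearMap.alternatization_apply_apply]
  have h3 : ∑ σ : Equiv.Perm (Fin (2 + 2)), (Equiv.Perm.sign σ) •
      altProd α α ((fun a => stdVec (i a)) ∘ σ) = wedgeSquareCoeff c i := by
    rw [wedgeSquareCoeff]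
    push_cast
    exact Finset.sum_congr rfl fun σ _ => h2 σ
  rw [h3]
  norm_num [Nat.factorial]

theorem sum_sq_two_form {α : E7 [⋀^Fin 2]→L[ℝ] ℝ} {c : (Fin 2 → Fin 7) → ℤ}
    (hα : ∀ i : Fin 2 → Fin 7, α (fun a => stdVec (i a)) = c i) :
    ∑ I : Fin 2 ↪o Fin 7, (α (fun a => stdVec (I a))) ^ 2 =
      (1 / 2 : ℝ) * (∑ i : Fin 2 → Fin 7, c i ^ 2 : ℤ) := by
  have h := sum_eq_factorial_mul_sum_orderEmb (n := 7)
    (fun i : Fin 2 → Fin 7 => (α (fun a => stdVec (i a))) ^ 2) ?_ ?_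
  · simp only [Nat.factorial] at h
    have h1 : ∑ i : Fin 2 → Fin 7, (α (fun a => stdVec (i a))) ^ 2 =
        (∑ i : Fin 2 → Fin 7, c i ^ 2 : ℤ) := by
      push_cast
      exact Finset.sum_congr rfl fun i _ => by rw [hα]
    rw [← h1, h]
    push_cast
    ring
  · intro i σ
    have hA := α.toAlternatingMap.map_perm (fun a => stdVec (i a)) σ
    change α (fun a => stdVec ((i ∘ σ) a)) = _ at hA
    change (α (fun a => stdVec ((i ∘ σ) a))) ^ 2 = _
    rw [hA]
    rcases Int.units_eq_one_or (Equiv.Perm.sign σ) with h | h <;> simp [h]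
  · intro i hi
    obtain ⟨a, b, hab, hne⟩ : ∃ a b, i a = i b ∧ a ≠ b :=
      Function.not_injective_iff.1 hi
    have := α.toAlternatingMap.map_eq_zero_of_eq (fun a => stdVec (i a)) (by simp [hab]) hne
    change (α (fun a => stdVec (i a))) ^ 2 = 0
    rw [show α (fun a => stdVec (i a)) = 0 from this]
    simp

end Coefficients

/-! ## Invariant exterior derivatives -/

/-- The exterior derivative of invariant forms, for a coframe with structure map `C`. -/
def structDeriv {k : ℕ} (C : E7 →L[ℝ] E7 →L[ℝ] E7) (α : E7 [⋀^Fin k]→L[ℝ] ℝ) :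
    E7 [⋀^Fin (k + 1)]→L[ℝ] ℝ :=
  .alternatizeUncurryFin (α.fderivCompContinuousLinearMap (.id ℝ E7) ∘L C)

theorem structDeriv_apply {k : ℕ} (C : E7 →L[ℝ] E7 →L[ℝ] E7) (α : E7 [⋀^Fin k]→L[ℝ] ℝ)
    (v : Fin (k + 1) → E7) :
    structDeriv C α v = ∑ a : Fin (k + 1), (-1) ^ (a : ℕ) * ∑ b : Fin k,
      α (Function.update (fun c => v (a.succAbove c)) b (C (v a) (v (a.succAbove b)))) := by
  simp only [structDeriv, ContinuousAlternatingMap.alternatizeUncurryFin_apply,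
    ContinuousLinearMap.comp_apply, ContinuousAlternatingMap.fderivCompContinuousLinearMap_apply,
    zsmul_eq_mul, Int.cast_pow, Int.cast_neg, Int.cast_one]
  refine Finset.sum_congr rfl fun a _ => ?_
  congr 1
  refine Finset.sum_congr rfl fun b _ => ?_
  congr 1
  funext c
  by_cases h : c = b
  · subst h; simp [Fin.removeNth]
  · simp [h, Fin.removeNth]

theorem structDeriv_smul_left {k : ℕ} (r : ℝ) (C : E7 →L[ℝ] E7 →L[ℝ] E7)
    (α : E7 [⋀^Fin k]→L[ℝ] ℝ) : structDeriv (r • C) α = r • structDeriv C α := by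
  rw [structDeriv, ContinuousLinearMap.comp_smul,
    ContinuousAlternatingMap.alternatizeUncurryFin_smul, structDeriv]

/-- The structure map `C(u, v) = ∑ c u_p v_q e_r`, for a list of quadruples `(c, p, q, r)`. -/
def structOfList (L : List (ℤ × Fin 7 × Fin 7 × Fin 7)) : E7 →L[ℝ] E7 →L[ℝ] E7 :=
  (L.map fun t => (t.1 : ℝ) • (EuclideanSpace.proj (𝕜 := ℝ) t.2.1).smulRight
    ((EuclideanSpace.proj (𝕜 := ℝ) t.2.2.1).smulRight (stdVec t.2.2.2))).sum

theorem structOfList_apply (L : List (ℤ × Fin 7 × Fin 7 × Fin 7)) (u v : E7) :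
    structOfList L u v =
      (L.map fun t => ((t.1 : ℝ) * (u t.2.1 * v t.2.2.1)) • stdVec t.2.2.2).sum := by
  induction L with
  | nil => simp [structOfList]
  | cons t L ih =>
    have : structOfList (t :: L) = (t.1 : ℝ) • (EuclideanSpace.proj (𝕜 := ℝ) t.2.1).smulRight
        ((EuclideanSpace.proj (𝕜 := ℝ) t.2.2.1).smulRight (stdVec t.2.2.2)) + structOfList L := by
      simp [structOfList]
    rw [this, add_apply, add_apply, ih]
    simp [smul_smul, mul_assoc]

/-- The integral version of `structDeriv`, on the standard basis. -/
def structDerivCoeff {k : ℕ} (L : List (ℤ × Fin 7 × Fin 7 × Fin 7)) (c : (Fin k → Fin 7) → ℤ)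
    (i : Fin (k + 1) → Fin 7) : ℤ :=
  ∑ a : Fin (k + 1), (-1) ^ (a : ℕ) * ∑ b : Fin k, (L.map fun t =>
    if t.2.1 = i a then if t.2.2.1 = i (a.succAbove b) then
      t.1 * c (Function.update (fun c => i (a.succAbove c)) b t.2.2.2) else 0 else 0).sum

/-- On basis vectors the structure map contributes one term for each list entry whose two source
indices match, and that term replaces one argument by a basis vector again. So the values stay
integral. -/
theorem structDeriv_stdVec {k : ℕ} (L : List (ℤ × Fin 7 × Fin 7 × Fin 7))
    {α : E7 [⋀^Fin k]→L[ℝ] ℝ} {c : (Fin k → Fin 7) → ℤ}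
    (hα : ∀ i : Fin k → Fin 7, α (fun a => stdVec (i a)) = c i) (i : Fin (k + 1) → Fin 7) :
    structDeriv (structOfList L) α (fun a => stdVec (i a)) = structDerivCoeff L c i := by
  rw [structDeriv_apply, structDerivCoeff]
  push_cast
  refine Finset.sum_congr rfl fun a _ => ?_
  congr 1
  refine Finset.sum_congr rfl fun b _ => ?_
  rw [structOfList_apply]
  induction L with
  | nil =>
    simp only [List.map_nil, List.sum_nil]
    exact α.map_coord_zero b (by simp)
  | cons t L ih =>
    simp only [List.map_cons, List.sum_cons]
    rw [α.map_update_add, ih, α.map_update_smul]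
    congr 1
    have h1 : Function.update (fun c => stdVec (i (a.succAbove c))) b (stdVec t.2.2.2) =
        fun c => stdVec (Function.update (fun c => i (a.succAbove c)) b t.2.2.2 c) := by
      funext c
      by_cases h : c = b
      · subst h; simp
      · simp [h]
    rw [h1, hα]
    by_cases h2 : t.2.1 = i a <;> by_cases h3 : t.2.2.1 = i (a.succAbove b) <;>
      simp [h2, h3]

/-- Two forms whose values on the standard basis are given by integral functions. -/
theorem alternating_ext_of_coeff {k : ℕ} {α β : E7 [⋀^Fin k]→L[ℝ] ℝ} (r s : ℝ)
    {c d : (Fin k → Fin 7) → ℤ}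
    (hα : ∀ i : Fin k → Fin 7, r * α (fun a => stdVec (i a)) = c i)
    (hβ : ∀ i : Fin k → Fin 7, s * β (fun a => stdVec (i a)) = d i)
    (h : ∀ i : Fin k → Fin 7, StrictMono i → c i = d i) : r • α = s • β := by
  refine alternating_ext fun i hi => ?_
  rw [ContinuousAlternatingMap.smul_apply, ContinuousAlternatingMap.smul_apply, smul_eq_mul,
    smul_eq_mul, hα, hβ, h i hi]

/-- In this family the order hypotheses stand between the quantifiers, so that an exhaustive
evaluation discards a multi-index as soon as an initial segment fails to increase. -/
theorem forall_strictMono_two {P : (Fin 2 → Fin 7) → Prop}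
    (h : ∀ a b : Fin 7, a < b → P ![a, b]) (i : Fin 2 → Fin 7) (hi : StrictMono i) : P i := by
  have : i = ![i 0, i 1] := by funext a; fin_cases a <;> rfl
  rw [this]
  exact h _ _ (hi (by decide))

theorem forall_strictMono_three {P : (Fin 3 → Fin 7) → Prop}
    (h : ∀ a b : Fin 7, a < b → ∀ c, b < c → P ![a, b, c]) (i : Fin 3 → Fin 7)
    (hi : StrictMono i) : P i := by
  have : i = ![i 0, i 1, i 2] := by funext a; fin_cases a <;> rfl
  rw [this]
  exact h _ _ (hi (by decide)) _ (hi (by decide))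

theorem forall_strictMono_four {P : (Fin 4 → Fin 7) → Prop}
    (h : ∀ a b : Fin 7, a < b → ∀ c, b < c → ∀ d, c < d → P ![a, b, c, d]) (i : Fin 4 → Fin 7)
    (hi : StrictMono i) : P i := by
  have : i = ![i 0, i 1, i 2, i 3] := by funext a; fin_cases a <;> rfl
  rw [this]
  exact h _ _ (hi (by decide)) _ (hi (by decide)) _ (hi (by decide))

theorem forall_strictMono_five {P : (Fin 5 → Fin 7) → Prop}
    (h : ∀ a b : Fin 7, a < b → ∀ c, b < c → ∀ d, c < d → ∀ e, d < e → P ![a, b, c, d, e])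
    (i : Fin 5 → Fin 7) (hi : StrictMono i) : P i := by
  have : i = ![i 0, i 1, i 2, i 3, i 4] := by funext a; fin_cases a <;> rfl
  rw [this]
  exact h _ _ (hi (by decide)) _ (hi (by decide)) _ (hi (by decide)) _ (hi (by decide))

/-- The components of `φ₀`. -/
def phiList : List (ℤ × (Fin 3 → Fin 7)) := [(1, ![0, 1, 6]), (1, ![2, 3, 6]), (1, ![4, 5, 6]),
    (1, ![0, 2, 4]), (-1, ![0, 3, 5]), (-1, ![1, 2, 5]), (-1, ![1, 3, 4])]

set_option maxRecDepth 100000 in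
theorem phiCoeff_eq_listCoeff : ∀ i : Fin 3 → Fin 7, StrictMono i →
    phiCoeff i = listCoeff phiList i :=
  forall_strictMono_three (by decide +kernel)

theorem phi0_eq_formOfList : phi0 = formOfList phiList := by
  have := alternating_ext_of_coeff 1 1 (fun i => by rw [one_mul, phi0_stdVec])
    (fun i => by rw [one_mul, formOfList_stdVec phiList]) phiCoeff_eq_listCoeff
  rwa [one_smul, one_smul] at this

/-- The components of `* φ₀`. -/
def psiList : List (ℤ × (Fin 4 → Fin 7)) := [(1, ![2, 3, 4, 5]), (1, ![0, 1, 4, 5]),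
  (1, ![0, 1, 2, 3]), (-1, ![1, 3, 5, 6]), (1, ![1, 2, 4, 6]), (1, ![0, 3, 4, 6]),
  (1, ![0, 2, 5, 6])]

theorem three_add_four_eq : 3 + 4 = 7 := rfl

theorem four_add_three_eq : 4 + 3 = 7 := rfl

theorem strictMono_phiList : ∀ t ∈ phiList, StrictMono t.2 := by
  decide

set_option maxRecDepth 100000 in
theorem star0_phi_coeff : ∀ j : Fin 4 → Fin 7, StrictMono j →
    (phiList.map fun t => t.1 * kroneckerDet (3 + 4) (Fin.cast three_add_four_eq)
      (Fin.append t.2 j)).sum = listCoeff psiList j :=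
  forall_strictMono_four (by decide +kernel)

theorem star0_phi0 : star0 three_add_four_eq phi0 = formOfList psiList := by
  have := alternating_ext_of_coeff 1 1
    (fun j => by rw [one_mul, star0_formOfList_stdVec three_add_four_eq phiList strictMono_phiList])
    (fun j => by rw [one_mul, formOfList_stdVec psiList]) star0_phi_coeff
  rw [one_smul, one_smul] at this
  rw [phi0_eq_formOfList, this]

section Structure

/-- The components of `φ₀ - e^{127}`. -/
def omegaList : List (ℤ × (Fin 3 → Fin 7)) := [(1, ![2, 3, 6]), (1, ![4, 5, 6]),
    (1, ![0, 2, 4]), (-1, ![0, 3, 5]), (-1, ![1, 2, 5]), (-1, ![1, 3, 4])]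

/-- An invariant coframe for which `φ₀` is ERP with torsion form `τ`, `|τ|² = 6 n` and
`τ ∧ τ = - 6 n e^{3456}`. -/
structure IsERPStructure (L : List (ℤ × Fin 7 × Fin 7 × Fin 7)) (θ : List (ℤ × (Fin 5 → Fin 7)))
    (τ : List (ℤ × (Fin 2 → Fin 7))) (n : ℤ) : Prop where
  closed : ∀ a b : Fin 7, a < b → ∀ c, b < c → ∀ d, c < d →
    structDerivCoeff L (listCoeff phiList) ![a, b, c, d] = 0
  deriv_psi : ∀ a b : Fin 7, a < b → ∀ c, b < c → ∀ d, c < d → ∀ e, d < e →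
    structDerivCoeff L (listCoeff psiList) ![a, b, c, d, e] = listCoeff θ ![a, b, c, d, e]
  mono : ∀ t ∈ θ, StrictMono t.2
  torsion : ∀ a b : Fin 7, a < b → (θ.map fun t => t.1 * kroneckerDet (5 + 2)
    (Fin.cast five_add_two_eq) (Fin.append t.2 ![a, b])).sum =
      -listCoeff τ ![a, b]
  deriv_tau : ∀ a b : Fin 7, a < b → ∀ c, b < c →
    structDerivCoeff L (listCoeff τ) ![a, b, c] = n * listCoeff omegaList ![a, b, c]
  -- The sum runs over ordered pairs and counts every component twice, so this says |τ|² = 6n.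
  norm : ∑ i : Fin 2 → Fin 7, listCoeff τ i ^ 2 = 12 * n
  -- The alternating sum is not divided by 2! 2! = 4, so this says that τ ∧ τ is -6n times the fibre
  -- volume.
  square : ∀ a b : Fin 7, a < b → ∀ c, b < c → ∀ d, c < d →
    wedgeSquareCoeff (listCoeff τ) ![a, b, c, d] = -(24 * n) *
      kroneckerDet 4 ![2, 3, 4, 5] ![a, b, c, d]

end Structure

/-- The structure map of `G_J`. -/
def structListGJ : List (ℤ × Fin 7 × Fin 7 × Fin 7) :=
  [(-1, 6, 2, 2), (-1, 0, 2, 2), (-1, 1, 2, 2), (-1, 6, 3, 3), (1, 0, 3, 3), (1, 1, 3, 3),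
   (1, 6, 4, 4), (-1, 0, 4, 4), (1, 1, 4, 4), (1, 6, 5, 5), (1, 0, 5, 5), (-1, 1, 5, 5)]

/-- The components of `d * φ` on `G_J`. -/
def thetaListGJ : List (ℤ × (Fin 5 → Fin 7)) :=
  [(2, ![0, 1, 4, 5, 6]), (-2, ![0, 1, 2, 3, 6]), (-2, ![0, 1, 3, 5, 6]), (-2, ![0, 1, 2, 4, 6]),
   (-2, ![0, 1, 3, 4, 6]), (2, ![0, 1, 2, 5, 6])]

/-- The components of the torsion form of `G_J`. -/
def tauListGJ : List (ℤ × (Fin 2 → Fin 7)) :=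
  [(-2, ![2, 3]), (2, ![4, 5]), (-2, ![2, 4]), (-2, ![3, 5]), (2, ![2, 5]), (-2, ![3, 4])]

set_option maxRecDepth 100000 in
-- The torsion is spread evenly over the three anti-self-dual forms e³⁴ - e⁵⁶, e³⁵ + e⁴⁶, e³⁶ - e⁴⁵
-- of the fibre, while that of Bryant's space is a multiple of the first. Its square is nevertheless
-- a multiple of the fibre volume in both cases.
theorem isERPStructure_GJ : IsERPStructure structListGJ thetaListGJ tauListGJ 4 where
  closed := by decide +kernel
  deriv_psi := by decide +kernel
  mono := by decide
  torsion := by decide +kernel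
  deriv_tau := by decide +kernel
  norm := by decide +kernel
  square := by decide +kernel

/-- The structure map of the solvable group acting simply transitively on Bryant's space. -/
def structListBryant : List (ℤ × Fin 7 × Fin 7 × Fin 7) :=
  [(-2, 6, 0, 0), (-2, 6, 1, 1), (-1, 6, 2, 2), (-1, 6, 3, 3), (1, 6, 4, 4), (1, 6, 5, 5),
   (-2, 1, 4, 2), (-2, 0, 5, 2), (-2, 0, 4, 3), (2, 1, 5, 3)]

/-- The components of `d * φ` on Bryant's space. -/
def thetaListBryant : List (ℤ × (Fin 5 → Fin 7)) :=
  [(-6, ![0, 1, 2, 3, 6]), (6, ![0, 1, 4, 5, 6])]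

/-- The components of the torsion form of Bryant's space. -/
def tauListBryant : List (ℤ × (Fin 2 → Fin 7)) := [(-6, ![2, 3]), (6, ![4, 5])]

set_option maxRecDepth 100000 in
theorem isERPStructure_bryant :
    IsERPStructure structListBryant thetaListBryant tauListBryant 12 where
  closed := by decide +kernel
  deriv_psi := by decide +kernel
  mono := by decide
  torsion := by decide +kernel
  deriv_tau := by decide +kernel
  norm := by decide +kernel
  square := by decide +kernel

end

noncomputable section

/-! ## Pullbacks of forms on manifolds -/

/-- The derivative of a map of manifolds, as an endomorphism of the model space. -/
def tangentDeriv {M N : Type*} [TopologicalSpace M] [ChartedSpace E7 M]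
    [TopologicalSpace N] [ChartedSpace E7 N] (f : M → N) (x : M) : E7 →L[ℝ] E7 :=
  mfderiv I7 I7 f x

namespace DiffForm

open Filter Topology

variable {M N P : Type*} [TopologicalSpace M] [ChartedSpace E7 M]
  [TopologicalSpace N] [ChartedSpace E7 N] [TopologicalSpace P] [ChartedSpace E7 P] {k : ℕ}

/-- The value of a form at a point, as a form on the model space. -/
def val (η : DiffForm k M) (p : M) : E7 [⋀^Fin k]→L[ℝ] ℝ := η p

theorem ext_val {η θ : DiffForm k M} (h : ∀ p, val η p = val θ p) : η = θ := funext h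

theorem pullback_val (f : M → N) (η : DiffForm k N) (x : M) :
    val (pullback f η) x = (val η (f x)).compContinuousLinearMap (tangentDeriv f x) := rfl

theorem d_val (η : DiffForm k M) (p : M) : val (d η) p =
    (extDeriv (inChart η p) (chartAt E7 p p)).compContinuousLinearMap
      (tangentDeriv (chartAt E7 p) p) := rfl

theorem tangentDeriv_congr {f g : M → N} {x : M} (h : f =ᶠ[𝓝 x] g) :
    tangentDeriv f x = tangentDeriv g x := h.mfderiv_eq

theorem tangentDeriv_comp {g : N → P} {f : M → N} {x : M} (hg : MDifferentiableAt I7 I7 g (f x))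
    (hf : MDifferentiableAt I7 I7 f x) :
    tangentDeriv (fun y => g (f y)) x = (tangentDeriv g (f x)).comp (tangentDeriv f x) :=
  mfderiv_comp x hg hf

theorem tangentDeriv_eq_fderiv (f : E7 → E7) (x : E7) : tangentDeriv f x = fderiv ℝ f x :=
  mfderiv_eq_fderiv

theorem pullback_congr {f g : M → N} {x : M} (h : f =ᶠ[𝓝 x] g) (η : DiffForm k N) :
    val (pullback f η) x = val (pullback g η) x := by
  rw [pullback_val, pullback_val, tangentDeriv_congr h, h.eq_of_nhds]

theorem pullback_comp {g : N → P} {f : M → N} {x : M} (hg : MDifferentiableAt I7 I7 g (f x))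
    (hf : MDifferentiableAt I7 I7 f x) (η : DiffForm k P) :
    val (pullback (fun y => g (f y)) η) x = val (pullback f (pullback g η)) x := by
  rw [pullback_val, pullback_val, pullback_val, tangentDeriv_comp hg hf]
  rfl

theorem pullback_eq_fderiv (f : E7 → E7) (η : DiffForm k E7) (x : E7) :
    val (pullback f η) x = (val η (f x)).compContinuousLinearMap (fderiv ℝ f x) := by
  rw [pullback_val, tangentDeriv_eq_fderiv]

theorem inChart_eqOn {s : E7 → M} {p : M}
    (hs : Set.EqOn (chartAt E7 p).symm s (chartAt E7 p).target) (η : DiffForm k M) :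
    Set.EqOn (inChart η p) (val (pullback s η)) (chartAt E7 p).target := fun _ hy =>
  pullback_congr (hs.eventuallyEq_of_mem ((chartAt E7 p).open_target.mem_nhds hy)) η

/-- When all chart inverses are restrictions of a single map `s`, smoothness can be tested on the
one Euclidean form obtained by pulling back along `s`. -/
theorem isSmooth_of_pullback {s : E7 → M}
    (hs : ∀ p, Set.EqOn (chartAt E7 p).symm s (chartAt E7 p).target) {η : DiffForm k M}
    (h : ContDiff ℝ ∞ (val (pullback s η))) : IsSmooth η := fun p =>
  h.contDiffOn.congr (inChart_eqOn (hs p) η)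

variable [IsManifold I7 ∞ M]

/-- Near `y` the pullback by `s` factors through the preferred chart at `s y`. This presents it as a
Euclidean pullback of the chart expression, which is how the exterior derivative is defined. -/
theorem pullback_eventuallyEq_inChart {s : E7 → M} {y : E7} (hs : ContMDiffAt I7 I7 ∞ s y)
    (η : DiffForm k M) :
    val (pullback s η) =ᶠ[𝓝 y] fun z =>
      (inChart η (s y) (chartAt E7 (s y) (s z))).compContinuousLinearMap
        (fderiv ℝ (fun z => chartAt E7 (s y) (s z)) z) := by
  have : IsManifold I7 1 M := .of_le (n := ∞) (by simp)
  have h1 : ∀ᶠ z in 𝓝 y, s z ∈ (chartAt E7 (s y)).source :=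
    hs.continuousAt.eventually ((chartAt E7 (s y)).open_source.mem_nhds (mem_chart_source E7 _))
  have h2 : ∀ᶠ z in 𝓝 y, ContMDiffAt I7 I7 1 s z := by
    have h3 : ContMDiffAt I7 I7 1 s y := hs.of_le (by simp)
    exact (contMDiffAt_iff_contMDiffAt_nhds (by simp)).1 h3
  filter_upwards [h1.eventually_nhds, h2] with z hz hz2
  have hd : MDifferentiableAt I7 I7 s z := hz2.mdifferentiableAt one_ne_zero
  have hzs := hz.self_of_nhds
  have hc : MDifferentiableAt I7 I7 (chartAt E7 (s y)) (s z) :=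
    mdifferentiableAt_atlas (chart_mem_atlas _ _) hzs
  have hcs : MDifferentiableAt I7 I7 (chartAt E7 (s y)).symm (chartAt E7 (s y) (s z)) :=
    mdifferentiableAt_atlas_symm (chart_mem_atlas _ _) ((chartAt E7 (s y)).map_source hzs)
  refine Eq.trans ?_ (pullback_eq_fderiv (fun z => chartAt E7 (s y) (s z)) (inChart η (s y)) z)
  rw [inChart, ← pullback_comp (f := fun z => chartAt E7 (s y) (s z)) hcs (hc.comp z hd)]
  refine pullback_congr ?_ η
  filter_upwards [hz] with w hw
  exact ((chartAt E7 (s y)).left_inv hw).symm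

/-- Naturality of d. The definition uses only the preferred chart at each point; it transfers to any
smooth `s` because, between Euclidean spaces, d commutes with pullback along the chart expression of
`s`. -/
theorem pullback_d {s : E7 → M} {y : E7} (hs : ContMDiffAt I7 I7 ∞ s y)
    {η : DiffForm k M} (hη : IsSmooth η) :
    val (pullback s (d η)) y = extDeriv (val (pullback s η)) y := by
  have : IsManifold I7 1 M := .of_le (n := ∞) (by simp)
  have hd : MDifferentiableAt I7 I7 s y := hs.mdifferentiableAt (by simp)
  have hc : MDifferentiableAt I7 I7 (chartAt E7 (s y)) (s y) :=
    mdifferentiableAt_atlas (chart_mem_atlas _ _) (mem_chart_source E7 _)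
  have hF : ContDiffAt ℝ ∞ (fun z => chartAt E7 (s y) (s z)) y := by
    rw [← contMDiffAt_iff_contDiffAt]
    exact (contMDiffAt_of_mem_maximalAtlas (IsManifold.chart_mem_maximalAtlas (s y))
      (mem_chart_source E7 _)).comp y hs
  have hω : DifferentiableAt ℝ (inChart η (s y)) (chartAt E7 (s y) (s y)) :=
    ((hη (s y)).contDiffAt ((chartAt E7 (s y)).open_target.mem_nhds
      (mem_chart_target E7 _))).differentiableAt (by simp)
  rw [(pullback_eventuallyEq_inChart hs η).extDeriv_eq]
  refine Eq.trans ?_ (extDeriv_pullback (f := fun z => chartAt E7 (s y) (s z)) hω hF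
    (by rw [minSmoothness_of_isRCLikeNormedField]; exact ENat.LEInfty.out)).symm
  rw [pullback_val, d_val, ← tangentDeriv_eq_fderiv, tangentDeriv_comp hc hd]
  ext v
  simp only [ContinuousAlternatingMap.compContinuousLinearMap_apply, ContinuousLinearMap.coe_comp]
  rfl

end DiffForm

/-! ## Coframes with constant structure map -/

theorem contDiff_of_stdVec {k : ℕ} {f : E7 → E7 [⋀^Fin k]→L[ℝ] ℝ}
    (h : ∀ i : Fin k → Fin 7, ContDiff ℝ ∞ fun y => f y (fun a => stdVec (i a))) :
    ContDiff ℝ ∞ f := by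
  have h1 : f = fun y => ∑ I : Fin k ↪o Fin 7, (f y (fun a => stdVec (I a))) • coordForm I := by
    funext y
    refine alternating_ext fun i hi => ?_
    rw [ContinuousAlternatingMap.sum_apply, Finset.sum_eq_single (OrderEmbedding.ofStrictMono i hi)]
    · rw [ContinuousAlternatingMap.smul_apply,
        coordForm_stdVec_of_strictMono (OrderEmbedding.strictMono _) hi, if_pos (by rfl)]
      simp
    · intro J _ hJ
      rw [ContinuousAlternatingMap.smul_apply,
        coordForm_stdVec_of_strictMono (OrderEmbedding.strictMono _) hi, if_neg, smul_zero]
      intro h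
      exact hJ (by ext a; exact congrArg Fin.val (congrFun h a).symm)
    · simp
  rw [h1]
  exact ContDiff.sum fun I _ => (h I).smul contDiff_const

theorem ContDiff.form_comp {k : ℕ} {K : E7 → E7 →L[ℝ] E7} (hK : ContDiff ℝ ∞ K)
    (β : E7 [⋀^Fin k]→L[ℝ] ℝ) : ContDiff ℝ ∞ fun y => β.compContinuousLinearMap (K y) := by
  refine contDiff_of_stdVec fun i => ?_
  have : ContDiff ℝ ∞ fun y => fun a => K y (stdVec (i a)) :=
    contDiff_pi.2 fun a => hK.clm_apply contDiff_const
  exact (β.toContinuousMultilinearMap.contDiff).comp this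

/-- A coframe `K` on an open set with `dK(u, v) = C(K u, K v)`, before antisymmetrization. -/
structure IsCoframeOn (V : Set E7) (C : E7 →L[ℝ] E7 →L[ℝ] E7) (K : E7 → E7 ≃L[ℝ] E7) : Prop where
  isOpen : IsOpen V
  hasFDerivAt : ∀ y ∈ V, HasFDerivAt (fun y => (K y : E7 →L[ℝ] E7))
    (((ContinuousLinearMap.compL ℝ E7 E7 E7).flip (K y)).comp (C.comp (K y : E7 →L[ℝ] E7))) y

/-- By the product rule, differentiating `β(K·, …, K·)` replaces one factor `K v` by `C(K u, K v)`.
The result is again a constant form evaluated on `K`, and alternation gives `structDeriv` (the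
Maurer–Cartan computation). -/
theorem IsCoframeOn.extDeriv {V : Set E7} {C : E7 →L[ℝ] E7 →L[ℝ] E7} {K : E7 → E7 ≃L[ℝ] E7}
    (hK : IsCoframeOn V C K) {k : ℕ} (β : E7 [⋀^Fin k]→L[ℝ] ℝ) {y : E7} (hy : y ∈ V) :
    extDeriv (fun y => β.compContinuousLinearMap (K y : E7 →L[ℝ] E7)) y =
      (structDeriv C β).compContinuousLinearMap (K y : E7 →L[ℝ] E7) := by
  have h := (hasFDerivAt_const β y).continuousAlternatingMapCompContinuousLinearMap
    (hK.hasFDerivAt y hy)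
  rw [ContinuousLinearMap.comp_zero, zero_add] at h
  rw [_root_.extDeriv, h.fderiv]
  ext v
  rw [ContinuousAlternatingMap.compContinuousLinearMap_apply, structDeriv_apply,
    ContinuousAlternatingMap.alternatizeUncurryFin_apply]
  refine Finset.sum_congr rfl fun a _ => ?_
  rw [zsmul_eq_mul, Int.cast_pow, Int.cast_neg, Int.cast_one]
  congr 1
  rw [ContinuousLinearMap.comp_apply, ContinuousAlternatingMap.fderivCompContinuousLinearMap_apply]
  refine Finset.sum_congr rfl fun b _ => ?_
  congr 1
  funext c
  by_cases h : c = b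
  · subst h; simp [Fin.removeNth]
  · simp [h, Fin.removeNth]

/-! ## `G₂`-structures in adapted coframes -/

section Frame

open DiffForm

variable {M : Type*} [TopologicalSpace M] [ChartedSpace E7 M]

/-- A parametrization `s` of an open part of `M` in which `φ` is `φ₀` in the coframe `K`. -/
structure IsAdaptedOn (V : Set E7) (s : E7 → M) (φ : DiffForm 3 M)
    (C : E7 →L[ℝ] E7 →L[ℝ] E7) (K : E7 → E7 ≃L[ℝ] E7) : Prop extends IsCoframeOn V C K where
  contMDiffAt : ∀ y ∈ V, ContMDiffAt I7 I7 ∞ s y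
  exists_equiv : ∀ y ∈ V, ∃ e : E7 ≃L[ℝ] E7, (e : E7 →L[ℝ] E7) = tangentDeriv s y
  pullback_eq : ∀ y ∈ V,
    val (pullback s φ) y = phi0.compContinuousLinearMap (K y : E7 →L[ℝ] E7)

variable {V : Set E7} {s : E7 → M} {φ : DiffForm 3 M} {C : E7 →L[ℝ] E7 →L[ℝ] E7}
  {K : E7 → E7 ≃L[ℝ] E7}

/-- `η` has constant components `β` in the coframe `K`. -/
def HasComponentsOn (V : Set E7) (s : E7 → M) (K : E7 → E7 ≃L[ℝ] E7) {k : ℕ} (η : DiffForm k M)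
    (β : E7 [⋀^Fin k]→L[ℝ] ℝ) : Prop :=
  ∀ y ∈ V, val (pullback s η) y = β.compContinuousLinearMap (K y : E7 →L[ℝ] E7)

/-- The composite of `K y` with the inverse of the derivative of `s` is a system of coordinates on
the tangent space at `s y`. There the form φ is φ₀, and every form with constant components in `K`
takes its component value. -/
theorem IsAdaptedOn.exists_coords (h : IsAdaptedOn V s φ C K) {y : E7} (hy : y ∈ V) :
    ∃ c : E7 ≃L[ℝ] E7,
      (∀ {k : ℕ} {η : DiffForm k M} {β : E7 [⋀^Fin k]→L[ℝ] ℝ}, HasComponentsOn V s K η β →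
        β.compContinuousLinearMap (c : E7 →L[ℝ] E7) = val η (s y)) ∧
      ∀ v, c (tangentDeriv s y v) = K y v := by
  obtain ⟨e, he⟩ := h.exists_equiv y hy
  refine ⟨e.symm.trans (K y), ?_, ?_⟩
  · intro k η β hη
    have h1 := hη y hy
    rw [pullback_val, ← he] at h1
    have h2 := congrArg (fun γ : E7 [⋀^Fin k]→L[ℝ] ℝ =>
      γ.compContinuousLinearMap (e.symm : E7 →L[ℝ] E7)) h1
    refine Eq.trans h2.symm ?_
    ext v
    simp [Function.comp_def]
  · intro v
    rw [← he]
    simp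

theorem IsAdaptedOn.isPositiveForm (h : IsAdaptedOn V s φ C K) {y : E7} (hy : y ∈ V) :
    IsPositiveForm (φ (s y)) := by
  obtain ⟨c, hc, -⟩ := h.exists_coords hy
  exact ⟨c, hc h.pullback_eq⟩

theorem IsAdaptedOn.hodgeStar (h : IsAdaptedOn V s φ C K) {k l : ℕ} (hkl : k + l = 7)
    {y : E7} (hy : y ∈ V) {η β : E7 [⋀^Fin k]→L[ℝ] ℝ}
    (hη : η.compContinuousLinearMap (tangentDeriv s y) =
      β.compContinuousLinearMap (K y : E7 →L[ℝ] E7)) :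
    (hodgeStar (val φ (s y)) hkl η).compContinuousLinearMap (tangentDeriv s y) =
      (star0 hkl β).compContinuousLinearMap (K y : E7 →L[ℝ] E7) := by
  obtain ⟨c, hc, hcK⟩ := h.exists_coords hy
  have h1 : η.compContinuousLinearMap (c.symm : E7 →L[ℝ] E7) = β := by
    ext v
    have h2 := congrArg (fun γ : E7 [⋀^Fin k]→L[ℝ] ℝ => γ (fun a => (K y).symm (v a))) hη
    have h3 : ∀ w, tangentDeriv s y ((K y).symm w) = c.symm w := by
      intro w
      apply c.injective
      rw [hcK]
      simp
    simpa [Function.comp_def, h3] using h2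
  rw [hodgeStar_of_coords c (hc h.pullback_eq), h1]
  ext v
  simp [Function.comp_def, hcK]

theorem IsAdaptedOn.g2Star (h : IsAdaptedOn V s φ C K) {k l : ℕ} (hkl : k + l = 7)
    {η : DiffForm k M} {β : E7 [⋀^Fin k]→L[ℝ] ℝ} (hη : HasComponentsOn V s K η β) :
    HasComponentsOn V s K (g2Star φ hkl η) (star0 hkl β) := fun y hy =>
  h.hodgeStar hkl hy (hη y hy)

theorem IsAdaptedOn.formNormSq (h : IsAdaptedOn V s φ C K) {k : ℕ}
    {η : DiffForm k M} {β : E7 [⋀^Fin k]→L[ℝ] ℝ} (hη : HasComponentsOn V s K η β)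
    {y : E7} (hy : y ∈ V) :
    formNormSq (val φ (s y)) (val η (s y)) =
      ∑ I : Fin k ↪o Fin 7, (β (fun a => stdVec (I a))) ^ 2 := by
  obtain ⟨c, hc, -⟩ := h.exists_coords hy
  rw [formNormSq_of_coords c (hc h.pullback_eq), ← hc hη]
  refine Finset.sum_congr rfl fun I _ => ?_
  simp [Function.comp_def]

theorem IsAdaptedOn.d [IsManifold I7 ∞ M] (h : IsAdaptedOn V s φ C K) {k : ℕ} {η : DiffForm k M}
    {β : E7 [⋀^Fin k]→L[ℝ] ℝ} (hη : HasComponentsOn V s K η β) (hs : IsSmooth η) :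
    HasComponentsOn V s K (DiffForm.d η) (structDeriv C β) := by
  intro y hy
  rw [pullback_d (h.contMDiffAt y hy) hs]
  have h1 : val (pullback s η) =ᶠ[nhds y]
      fun z => β.compContinuousLinearMap (K z : E7 →L[ℝ] E7) := by
    filter_upwards [h.isOpen.mem_nhds hy] with z hz
    exact hη z hz
  exact h1.extDeriv_eq.trans (h.toIsCoframeOn.extDeriv β hy)

theorem HasComponentsOn.neg {k : ℕ} {η : DiffForm k M} {β : E7 [⋀^Fin k]→L[ℝ] ℝ}
    (h : HasComponentsOn V s K η β) : HasComponentsOn V s K (-η) (-β) := by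
  intro y hy
  have h1 := h y hy
  have h2 : val (pullback s (-η)) y = -(val (pullback s η) y) := rfl
  rw [h2, h1]
  rfl

theorem IsAdaptedOn.torsion [IsManifold I7 ∞ M] (h : IsAdaptedOn V s φ C K)
    (h4 : IsSmooth (_root_.g2Star φ three_add_four_eq φ)) :
    HasComponentsOn V s K (g2Torsion φ)
      (-star0 five_add_two_eq (structDeriv C (star0 three_add_four_eq phi0))) :=
  (h.g2Star five_add_two_eq (h.d (h.g2Star three_add_four_eq h.pullback_eq) h4)).neg

theorem HasComponentsOn.contDiff {k : ℕ} {η : DiffForm k M} {β : E7 [⋀^Fin k]→L[ℝ] ℝ}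
    (h : HasComponentsOn Set.univ s K η β)
    (hK : ContDiff ℝ ∞ fun y => (K y : E7 →L[ℝ] E7)) : ContDiff ℝ ∞ (val (pullback s η)) := by
  rw [show val (pullback s η) = _ from funext fun y => h y (Set.mem_univ y)]
  exact hK.form_comp β

theorem HasComponentsOn.isSmooth {k : ℕ} {η : DiffForm k M} {β : E7 [⋀^Fin k]→L[ℝ] ℝ}
    (h : HasComponentsOn Set.univ s K η β)
    (hK : ContDiff ℝ ∞ fun y => (K y : E7 →L[ℝ] E7))
    (hs : ∀ p, Set.EqOn (chartAt E7 p).symm s (chartAt E7 p).target) : IsSmooth η :=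
  isSmooth_of_pullback hs (h.contDiff hK)

theorem HasComponentsOn.eq_of_surjective (h : IsAdaptedOn Set.univ s φ C K)
    (hs : Function.Surjective s) {k : ℕ} {η θ : DiffForm k M} {β : E7 [⋀^Fin k]→L[ℝ] ℝ}
    (hη : HasComponentsOn Set.univ s K η β) (hθ : HasComponentsOn Set.univ s K θ β) : η = θ := by
  refine ext_val fun p => ?_
  obtain ⟨y, rfl⟩ := hs p
  obtain ⟨c, hc, -⟩ := h.exists_coords (Set.mem_univ y)
  rw [← hc hη, ← hc hθ]

end Frame

/-! ## Extremally Ricci pinched structures -/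

namespace IsERPStructure

variable {L : List (ℤ × Fin 7 × Fin 7 × Fin 7)} {θ : List (ℤ × (Fin 5 → Fin 7))}
  {τ : List (ℤ × (Fin 2 → Fin 7))} {n : ℤ}

theorem structDeriv_phi0 (h : IsERPStructure L θ τ n) : structDeriv (structOfList L) phi0 = 0 := by
  rw [phi0_eq_formOfList]
  refine alternating_ext fun i hi => ?_
  rw [structDeriv_stdVec L (formOfList_stdVec phiList)]
  have := forall_strictMono_four (P := fun i => structDerivCoeff L (listCoeff phiList) i = 0)
    h.closed i hi
  rw [this]
  simp

theorem structDeriv_star_phi0 (h : IsERPStructure L θ τ n) :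
    structDeriv (structOfList L) (star0 three_add_four_eq phi0) = formOfList θ := by
  rw [star0_phi0]
  refine alternating_ext fun i hi => ?_
  rw [structDeriv_stdVec L (formOfList_stdVec psiList), formOfList_stdVec]
  exact congrArg _ (forall_strictMono_five (P := fun i =>
    structDerivCoeff L (listCoeff psiList) i = listCoeff θ i) h.deriv_psi i hi)

theorem star0_theta (h : IsERPStructure L θ τ n) :
    -star0 five_add_two_eq (formOfList θ) = formOfList τ := by
  refine alternating_ext fun i hi => ?_
  rw [ContinuousAlternatingMap.neg_apply, star0_formOfList_stdVec five_add_two_eq θ h.mono,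
    formOfList_stdVec]
  rw [forall_strictMono_two (P := fun i => (θ.map fun t => t.1 * kroneckerDet (5 + 2)
    (Fin.cast five_add_two_eq) (Fin.append t.2 i)).sum = -listCoeff τ i) h.torsion i hi]
  simp

theorem structDeriv_tau (h : IsERPStructure L θ τ n) :
    structDeriv (structOfList L) (formOfList τ) = (n : ℝ) • formOfList omegaList := by
  refine alternating_ext fun i hi => ?_
  rw [structDeriv_stdVec L (formOfList_stdVec τ), ContinuousAlternatingMap.smul_apply,
    formOfList_stdVec]
  rw [forall_strictMono_three (P := fun i => structDerivCoeff L (listCoeff τ) i =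
    n * listCoeff omegaList i) h.deriv_tau i hi]
  simp

theorem sum_sq_tau (h : IsERPStructure L θ τ n) :
    ∑ I : Fin 2 ↪o Fin 7, (formOfList τ (fun a => stdVec (I a))) ^ 2 = 6 * n := by
  rw [sum_sq_two_form (formOfList_stdVec τ), h.norm]
  push_cast
  ring

theorem altWedge_tau (h : IsERPStructure L θ τ n) :
    altWedge (formOfList τ) (formOfList τ) = (-(6 * n) : ℝ) • coordForm ![2, 3, 4, 5] := by
  refine alternating_ext fun i hi => ?_
  have h1 : wedgeSquareCoeff (listCoeff τ) i = -(24 * n) * kroneckerDet 4 ![2, 3, 4, 5] i :=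
    forall_strictMono_four (P := fun i => wedgeSquareCoeff (listCoeff τ) i =
      -(24 * n) * kroneckerDet 4 ![2, 3, 4, 5] i) h.square i hi
  refine (altWedge_self_stdVec (formOfList_stdVec τ) i).trans ?_
  rw [ContinuousAlternatingMap.smul_apply, coordForm_stdVec_eq_kroneckerDet, h1, smul_eq_mul]
  push_cast
  ring

end IsERPStructure

theorem strictMono_quad : StrictMono (![2, 3, 4, 5] : Fin 4 → Fin 7) := by decide

set_option maxRecDepth 100000 in
theorem arrSign_quad_coeff : ∀ j : Fin 3 → Fin 7, StrictMono j →
    kroneckerDet (4 + 3) (Fin.cast four_add_three_eq) (Fin.append ![2, 3, 4, 5] j) =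
      kroneckerDet 3 ![0, 1, 6] j :=
  forall_strictMono_three (by decide +kernel)

theorem star0_quad :
    star0 four_add_three_eq (coordForm ![2, 3, 4, 5]) = coordForm ![0, 1, 6] := by
  refine alternating_ext fun j hj => ?_
  rw [star0_coordForm_stdVec four_add_three_eq strictMono_quad, coordForm_stdVec_eq_kroneckerDet,
    arrSign_eq_kroneckerDet, arrSign_quad_coeff j hj]

theorem phi0_eq_add_omega : phi0 = coordForm ![0, 1, 6] + formOfList omegaList := by
  rw [phi0_eq_formOfList, phiList, formOfList_cons, omegaList]
  simp

section Frame

open DiffForm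

variable {M : Type*} [TopologicalSpace M] [ChartedSpace E7 M] [IsManifold I7 ∞ M]
  {s : E7 → M} {φ : DiffForm 3 M}
  {K : E7 → E7 ≃L[ℝ] E7} {L : List (ℤ × Fin 7 × Fin 7 × Fin 7)} {θ : List (ℤ × (Fin 5 → Fin 7))}
  {τ : List (ℤ × (Fin 2 → Fin 7))} {n : ℤ}

/-- The torsion is linear in the structure map. The scale `r` is needed for multiples of a form:
multiplying a coframe by a constant divides its structure map by that constant. -/
theorem IsERPStructure.torsion_smul {V : Set E7} (hL : IsERPStructure L θ τ n) {r : ℝ}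
    (h : IsAdaptedOn V s φ (r • structOfList L) K)
    (h4 : IsSmooth (_root_.g2Star φ three_add_four_eq φ)) :
    HasComponentsOn V s K (g2Torsion φ) (r • formOfList τ) := by
  have := h.torsion h4
  rwa [structDeriv_smul_left, hL.structDeriv_star_phi0, star0_smul,
    show -(r • star0 five_add_two_eq (formOfList θ)) = r • formOfList τ by
      rw [← hL.star0_theta]; ext v; simp] at this

theorem IsERPStructure.torsion_eq (hL : IsERPStructure L θ τ n)
    (h : IsAdaptedOn Set.univ s φ (structOfList L) K)
    (hK : ContDiff ℝ ∞ fun y => (K y : E7 →L[ℝ] E7))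
    (hc : ∀ p, Set.EqOn (chartAt E7 p).symm s (chartAt E7 p).target) :
    HasComponentsOn Set.univ s K (g2Torsion φ) (formOfList τ) := by
  have := hL.torsion_smul (r := 1) (by rwa [one_smul])
    ((h.g2Star three_add_four_eq h.pullback_eq).isSmooth hK hc)
  rwa [one_smul] at this

/-- With |τ|² = 6n and *(τ ∧ τ) = -6n e¹²⁷, the right-hand side of the ERP equation is n φ₀ - n
e¹²⁷, which is the computed value of dτ. Surjectivity of `s` carries the equation to every point. -/
theorem IsERPStructure.isERP (hL : IsERPStructure L θ τ n)
    (h : IsAdaptedOn Set.univ s φ (structOfList L) K)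
    (hK : ContDiff ℝ ∞ fun y => (K y : E7 →L[ℝ] E7))
    (hc : ∀ p, Set.EqOn (chartAt E7 p).symm s (chartAt E7 p).target)
    (hs : Function.Surjective s) : IsERP φ where
  smooth := HasComponentsOn.isSmooth h.pullback_eq hK hc
  positive := fun p => by
    obtain ⟨y, rfl⟩ := hs p
    exact h.isPositiveForm (Set.mem_univ y)
  closed := by
    refine HasComponentsOn.eq_of_surjective h hs (h.d h.pullback_eq
      (HasComponentsOn.isSmooth h.pullback_eq hK hc)) ?_
    rw [hL.structDeriv_phi0]
    exact fun y _ => rfl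
  erp := fun p => by
    obtain ⟨y, rfl⟩ := hs p
    have hτ := hL.torsion_eq h hK hc
    have hdτ := h.d hτ (hτ.isSmooth hK hc)
    have hn := h.formNormSq hτ (Set.mem_univ y)
    rw [hL.sum_sq_tau] at hn
    obtain ⟨c, hcc, hcK⟩ := h.exists_coords (Set.mem_univ y)
    rw [hL.structDeriv_tau] at hdτ
    have h1 : val (d (g2Torsion φ)) (s y) = _ := (hcc hdτ).symm
    have h2 : val φ (s y) = _ := (hcc h.pullback_eq).symm
    have h3 : val (g2Torsion φ) (s y) = _ := (hcc hτ).symm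
    have h4 : hodgeStar (val φ (s y)) four_add_three_eq
        (altWedge (val (g2Torsion φ) (s y)) (val (g2Torsion φ) (s y))) =
        ((-(6 * n) : ℝ) • coordForm ![0, 1, 6]).compContinuousLinearMap (c : E7 →L[ℝ] E7) := by
      have hw : altWedge ((formOfList τ).compContinuousLinearMap (c : E7 →L[ℝ] E7))
          ((formOfList τ).compContinuousLinearMap (c : E7 →L[ℝ] E7)) =
          ((-(6 * n) : ℝ) • coordForm ![2, 3, 4, 5]).compContinuousLinearMap (c : E7 →L[ℝ] E7) := by
        rw [altWedge_comp, hL.altWedge_tau]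
      rw [hodgeStar_of_coords c h2.symm, h3]
      refine congrArg (fun γ : E7 [⋀^Fin 3]→L[ℝ] ℝ =>
        γ.compContinuousLinearMap (c : E7 →L[ℝ] E7)) ?_
      have h5 : (altWedge ((formOfList τ).compContinuousLinearMap (c : E7 →L[ℝ] E7))
          ((formOfList τ).compContinuousLinearMap (c : E7 →L[ℝ] E7))).compContinuousLinearMap
            (c.symm : E7 →L[ℝ] E7) = (-(6 * n) : ℝ) • coordForm ![2, 3, 4, 5] := by
        rw [hw]
        ext v
        simp [Function.comp_def]
      refine (congrArg (star0 four_add_three_eq) h5).trans ?_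
      rw [star0_smul, star0_quad]
    change val (d (g2Torsion φ)) (s y) = ((1 / 6 : ℝ) * formNormSq (val φ (s y))
      (val (g2Torsion φ) (s y))) • val φ (s y) + (1 / 6 : ℝ) • hodgeStar (val φ (s y))
        four_add_three_eq (altWedge (val (g2Torsion φ) (s y)) (val (g2Torsion φ) (s y)))
    rw [h1, h4, hn, h2, phi0_eq_add_omega]
    ext v
    simp only [ContinuousAlternatingMap.compContinuousLinearMap_apply,
      ContinuousAlternatingMap.add_apply, ContinuousAlternatingMap.smul_apply, smul_eq_mul]
    ring

end Frame

end

noncomputable section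

/-! ## Manifolds with global coordinates -/

section GlobalCoords

open DiffForm

theorem contDiff_coframe {K : E7 → E7 ≃L[ℝ] E7}
    (h : ∀ v i, ContDiff ℝ ∞ fun y => K y v i) :
    ContDiff ℝ ∞ fun y => (K y : E7 →L[ℝ] E7) :=
  contDiff_clm_apply_iff.2 fun v => contDiff_euclidean.2 fun i => h v i

/-- Smoothness supplies the derivative of `K`; it is then identified from the one-variable
derivatives of the entries along lines. -/
theorem isCoframeOn_univ {K : E7 → E7 ≃L[ℝ] E7} {C : E7 →L[ℝ] E7 →L[ℝ] E7}
    (hK : ContDiff ℝ ∞ fun y => (K y : E7 →L[ℝ] E7))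
    (h : ∀ y u v i, HasDerivAt (fun t : ℝ => K (y + t • u) v i) (C (K y u) (K y v) i) 0) :
    IsCoframeOn Set.univ C K where
  isOpen := isOpen_univ
  hasFDerivAt := by
    intro y _
    have hd := ((hK.differentiable (by simp)) y).hasFDerivAt
    refine hd.congr_fderiv ?_
    ext u v i
    have hl : HasDerivAt (fun t : ℝ => y + t • u) u 0 := by
      simpa using ((hasDerivAt_id (0 : ℝ)).smul_const u).const_add y
    have hd0 : HasFDerivAt (fun y => (K y : E7 →L[ℝ] E7))
        (fderiv ℝ (fun y => (K y : E7 →L[ℝ] E7)) y) (y + (0 : ℝ) • u) := by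
      rw [zero_smul, add_zero]; exact hd
    have h1 := hd0.comp_hasDerivAt (0 : ℝ) hl
    have h2 := ((EuclideanSpace.proj (𝕜 := ℝ) i).comp
      (ContinuousLinearMap.apply ℝ E7 v)).hasFDerivAt.comp_hasDerivAt (0 : ℝ) h1
    exact h2.unique (h y u v i)

variable {M : Type*} [TopologicalSpace M] [ChartedSpace E7 M]

/-- The charts of `M` all agree with a fixed homeomorphism to the model space. -/
structure IsGlobalCoords (h : M ≃ₜ E7) : Prop where
  source_eq : ∀ p : M, (chartAt E7 p).source = Set.univ
  coe_eq : ∀ p : M, ⇑(chartAt E7 p) = h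

variable {h : M ≃ₜ E7}

theorem IsGlobalCoords.eqOn_symm (hh : IsGlobalCoords h) (p : M) :
    Set.EqOn (chartAt E7 p).symm h.symm (chartAt E7 p).target := by
  intro y hy
  apply h.injective
  rw [← hh.coe_eq p, (chartAt E7 p).right_inv hy, hh.coe_eq p, h.apply_symm_apply]

theorem IsGlobalCoords.target_eq (hh : IsGlobalCoords h) (p : M) :
    (chartAt E7 p).target = Set.univ := by
  refine Set.eq_univ_of_forall fun y => ?_
  have := (chartAt E7 p).map_source (x := h.symm y) (by rw [hh.source_eq]; trivial)
  rwa [hh.coe_eq, h.apply_symm_apply] at this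

variable [IsManifold I7 ∞ M]

theorem IsGlobalCoords.contMDiff (hh : IsGlobalCoords h) : ContMDiff I7 I7 ∞ h := by
  intro p
  rw [← hh.coe_eq p]
  exact contMDiffAt_of_mem_maximalAtlas (IsManifold.chart_mem_maximalAtlas p)
    (mem_chart_source E7 p)

theorem IsGlobalCoords.contMDiff_symm (hh : IsGlobalCoords h) : ContMDiff I7 I7 ∞ h.symm := by
  have h1 := contMDiffOn_chart_symm (I := I7) (n := ∞) (x := h.symm 0)
  rw [hh.target_eq] at h1
  have h2 := hh.eqOn_symm (h.symm 0)
  rw [hh.target_eq] at h2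
  exact contMDiffOn_univ.1 (h1.congr fun y hy => (h2 hy).symm)

theorem IsGlobalCoords.exists_equiv (hh : IsGlobalCoords h) (y : E7) :
    ∃ e : E7 ≃L[ℝ] E7, (e : E7 →L[ℝ] E7) = tangentDeriv h.symm y := by
  have h1 : MDifferentiableAt I7 I7 h (h.symm y) := hh.contMDiff.mdifferentiableAt (by simp)
  have h2 : MDifferentiableAt I7 I7 h.symm (h (h.symm y)) :=
    hh.contMDiff_symm.mdifferentiableAt (by simp)
  have h3 := tangentDeriv_comp h2 h1
  have h4 := tangentDeriv_comp (g := h) (f := h.symm) (x := y) h1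
    (hh.contMDiff_symm.mdifferentiableAt (by simp))
  have h5 : tangentDeriv (fun z : M => z) (h.symm y) = .id ℝ E7 := mfderiv_id
  simp only [h.apply_symm_apply, h.symm_apply_apply, tangentDeriv_eq_fderiv, fderiv_fun_id, h5]
    at h3 h4
  exact ⟨.equivOfInverse (tangentDeriv h.symm y) (tangentDeriv h (h.symm y))
    (fun v => (DFunLike.congr_fun h4 v).symm) (fun v => (DFunLike.congr_fun h3 v).symm), rfl⟩

/-- Forms which are pullbacks by translates of the coordinates, for a group of affine maps. -/
theorem IsGlobalCoords.val_pullback (hh : IsGlobalCoords h) {k : ℕ} (α : E7 [⋀^Fin k]→L[ℝ] ℝ)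
    {F : M → E7} {A : E7 →L[ℝ] E7} {c : E7} (hF : ∀ z, F (h.symm z) = A z + c) (y : E7)
    {η : DiffForm k M}
    (hη : val η (h.symm y) = α.compContinuousLinearMap (tangentDeriv F (h.symm y))) :
    val (pullback h.symm η) y = α.compContinuousLinearMap A := by
  have hF' : F = fun p => A (h p) + c := by
    funext p
    rw [← hF, h.symm_apply_apply]
  have h1 : ContMDiff I7 I7 ∞ F := by
    have h2 : ContMDiff I7 I7 ∞ fun z : E7 => A z + c :=
      (A.contDiff.add contDiff_const).contMDiff
    rw [hF']
    exact h2.comp hh.contMDiff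
  have h2 : tangentDeriv (fun z => F (h.symm z)) y = A := by
    rw [tangentDeriv_eq_fderiv]
    simp only [hF, fderiv_add_const]
    exact A.fderiv
  rw [pullback_val, hη, ← h2,
    tangentDeriv_comp (h1.mdifferentiableAt (by simp))
      (hh.contMDiff_symm.mdifferentiableAt (by simp))]
  rfl

theorem IsGlobalCoords.isAdaptedOn (hh : IsGlobalCoords h) {φ : DiffForm 3 M}
    {K : E7 → E7 ≃L[ℝ] E7} {C : E7 →L[ℝ] E7 →L[ℝ] E7} (hK : IsCoframeOn Set.univ C K)
    (hφ : ∀ y, val (pullback h.symm φ) y = phi0.compContinuousLinearMap (K y : E7 →L[ℝ] E7)) :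
    IsAdaptedOn Set.univ h.symm φ C K where
  toIsCoframeOn := hK
  contMDiffAt := fun y _ => hh.contMDiff_symm y
  exists_equiv := fun y _ => hh.exists_equiv y
  pullback_eq := fun y _ => hφ y

end GlobalCoords

/-! ## The group `G_J` -/

instance : IsManifold I7 ∞ GJ := GJ.coords.isOpenEmbedding.isManifold_singleton

theorem GJ.isGlobalCoords : IsGlobalCoords GJ.coords where
  source_eq := fun _ => rfl
  coe_eq := fun _ => rfl

/-- The product of `G_J` in coordinates. -/
def GJ.mulCoords (x z : E7) : E7 := !₂[x 0 + z 0, x 1 + z 1,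
  x 2 + Real.exp (x 6 + x 0 + x 1) * z 2, x 3 + Real.exp (x 6 - x 0 - x 1) * z 3,
  x 4 + Real.exp (-x 6 + x 0 - x 1) * z 4, x 5 + Real.exp (-x 6 - x 0 + x 1) * z 5, x 6 + z 6]

theorem expElem_mul (x z : E7) : expElem x * expElem z = expElem (x + z) := by
  refine Subtype.ext (Subtype.ext ?_)
  change NormedSpace.exp (aElem x) * NormedSpace.exp (aElem z) = NormedSpace.exp (aElem (x + z))
  rw [← Matrix.exp_add_of_commute _ _ (diagAlg_commute (aElem_mem x) (aElem_mem z))]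
  congr 1
  simp only [aElem, PiLp.add_apply, add_smul]
  abel

theorem expElem_congr {x z : E7} (h0 : x 0 = z 0) (h1 : x 1 = z 1) (h6 : x 6 = z 6) :
    expElem x = expElem z := by
  refine Subtype.ext (Subtype.ext ?_)
  change NormedSpace.exp (aElem x) = NormedSpace.exp (aElem z)
  simp only [aElem, h0, h1, h6]

theorem GJ.ofCoords_mul (x z : E7) :
    GJ.ofCoords x * GJ.ofCoords z = GJ.ofCoords (GJ.mulCoords x z) := by
  refine LinSemidirect.ext ?_ ?_
  · change expElem x * expElem z = expElem _
    rw [expElem_mul]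
    exact expElem_congr rfl rfl rfl
  · change ![x 2, x 3, x 4, x 5] + (⟨expElem x, ![x 2, x 3, x 4, x 5]⟩ : GJ).mat *ᵥ
      ![z 2, z 3, z 4, z 5] = ![_, _, _, _]
    rw [expElem_mat]
    funext i
    fin_cases i <;> simp [Matrix.mulVec_diagonal, GJ.mulCoords]

/-- The left-invariant coframe of `G_J`. -/
def GJ.coframe (y : E7) : E7 ≃L[ℝ] E7 :=
  LinearEquiv.toContinuousLinearEquiv
    { toFun := fun v => !₂[v 0, v 1, Real.exp (-(y 6 + y 0 + y 1)) * v 2,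
        Real.exp (-(y 6 - y 0 - y 1)) * v 3, Real.exp (-(-y 6 + y 0 - y 1)) * v 4,
        Real.exp (-(-y 6 - y 0 + y 1)) * v 5, v 6]
      invFun := fun v => !₂[v 0, v 1, Real.exp (y 6 + y 0 + y 1) * v 2,
        Real.exp (y 6 - y 0 - y 1) * v 3, Real.exp (-y 6 + y 0 - y 1) * v 4,
        Real.exp (-y 6 - y 0 + y 1) * v 5, v 6]
      map_add' := fun u v => by
        ext i; fin_cases i <;> simp [mul_add]
      map_smul' := fun c v => by
        ext i; fin_cases i <;> simp [mul_left_comm]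
      left_inv := fun v => by
        ext i; fin_cases i <;> simp [← mul_assoc, ← Real.exp_add] <;> ring_nf <;> simp
      right_inv := fun v => by
        ext i; fin_cases i <;> simp [← mul_assoc, ← Real.exp_add] <;> ring_nf <;> simp }

theorem GJ.coframe_apply (y v : E7) : GJ.coframe y v =
    !₂[v 0, v 1, Real.exp (-(y 6 + y 0 + y 1)) * v 2,
        Real.exp (-(y 6 - y 0 - y 1)) * v 3, Real.exp (-(-y 6 + y 0 - y 1)) * v 4,
        Real.exp (-(-y 6 - y 0 + y 1)) * v 5, v 6] := rfl

theorem GJ.mulCoords_coframe (y z : E7) : GJ.mulCoords y (GJ.coframe y (z - y)) = z := by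
  ext i
  fin_cases i <;> simp [GJ.mulCoords, GJ.coframe_apply, ← mul_assoc, ← Real.exp_add] <;> ring_nf <;>
    simp

theorem GJ.contDiff_coframe : ContDiff ℝ ∞ fun y => (GJ.coframe y : E7 →L[ℝ] E7) := by
  refine _root_.contDiff_coframe fun v i => ?_
  fin_cases i <;> simp [GJ.coframe_apply] <;> fun_prop

theorem GJ.isCoframeOn : IsCoframeOn Set.univ (structOfList structListGJ) GJ.coframe := by
  refine isCoframeOn_univ GJ.contDiff_coframe fun y u v i => ?_
  have hp : ∀ j : Fin 7, HasDerivAt (fun t : ℝ => (y + t • u) j) (u j) 0 := by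
    intro j
    simpa using ((hasDerivAt_id (0 : ℝ)).mul_const (u j)).const_add (y j)
  fin_cases i
  · exact (hasDerivAt_const (0 : ℝ) (v 0)).congr_deriv
      (by simp [structOfList_apply, structListGJ, GJ.coframe_apply])
  · exact (hasDerivAt_const (0 : ℝ) (v 1)).congr_deriv
      (by simp [structOfList_apply, structListGJ, GJ.coframe_apply])
  · exact ((((hp 6).add (hp 0)).add (hp 1)).neg.exp.mul_const (v 2)).congr_deriv
      (by simp [structOfList_apply, structListGJ, GJ.coframe_apply]; ring)
  · exact ((((hp 6).sub (hp 0)).sub (hp 1)).neg.exp.mul_const (v 3)).congr_deriv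
      (by simp [structOfList_apply, structListGJ, GJ.coframe_apply]; ring)
  · exact ((((hp 6).neg.add (hp 0)).sub (hp 1)).neg.exp.mul_const (v 4)).congr_deriv
      (by simp [structOfList_apply, structListGJ, GJ.coframe_apply]; ring)
  · exact ((((hp 6).neg.sub (hp 0)).add (hp 1)).neg.exp.mul_const (v 5)).congr_deriv
      (by simp [structOfList_apply, structListGJ, GJ.coframe_apply]; ring)
  · exact (hasDerivAt_const (0 : ℝ) (v 6)).congr_deriv
      (by simp [structOfList_apply, structListGJ, GJ.coframe_apply])

/-- Left translation is affine in these coordinates, z ↦ y + K_y⁻¹ z. Hence translation by the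
inverse has linear part K_y, which is why left-invariant forms have constant components in the
coframe. -/
theorem GJ.coords_inv_mul (y z : E7) :
    GJ.coords ((GJ.coords.symm y)⁻¹ * GJ.coords.symm z) = GJ.coframe y (z - y) := by
  have h1 : GJ.coords.symm y * GJ.coords.symm (GJ.coframe y (z - y)) = GJ.coords.symm z := by
    refine (GJ.ofCoords_mul _ _).trans ?_
    rw [GJ.mulCoords_coframe]
    rfl
  rw [← h1, inv_mul_cancel_left, Homeomorph.apply_symm_apply]

theorem GJ.val_phi (g : GJ) : DiffForm.val GJ.phi g =
    phi0.compContinuousLinearMap (tangentDeriv (fun h => GJ.coords (g⁻¹ * h)) g) := by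
  delta GJ.phi GJ.leftInvariant DiffForm.val DiffForm.pullback tangentDeriv
  rfl

theorem GJ.val_pullback_phi (y : E7) : DiffForm.val (DiffForm.pullback GJ.coords.symm GJ.phi) y =
    phi0.compContinuousLinearMap (GJ.coframe y : E7 →L[ℝ] E7) := by
  refine GJ.isGlobalCoords.val_pullback phi0
    (F := fun h => GJ.coords ((GJ.coords.symm y)⁻¹ * h)) (c := -GJ.coframe y y) ?_ y
    (GJ.val_phi _)
  intro z
  rw [GJ.coords_inv_mul, map_sub, sub_eq_add_neg]
  rfl

theorem GJ.isAdaptedOn : IsAdaptedOn Set.univ GJ.coords.symm GJ.phi (structOfList structListGJ)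
    GJ.coframe :=
  GJ.isGlobalCoords.isAdaptedOn GJ.isCoframeOn GJ.val_pullback_phi

theorem GJ.isERP : IsERP GJ.phi :=
  isERPStructure_GJ.isERP GJ.isAdaptedOn GJ.contDiff_coframe GJ.isGlobalCoords.eqOn_symm
    GJ.coords.symm.surjective

/-! ### The Lie group structure -/

theorem GJ.contDiff_mulCoords : ContDiff ℝ ∞ fun p : E7 × E7 => GJ.mulCoords p.1 p.2 := by
  refine contDiff_euclidean.2 fun i => ?_
  fin_cases i <;> simp [GJ.mulCoords] <;> fun_prop

theorem GJ.mul_eq (g h : GJ) :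
    g * h = GJ.coords.symm (GJ.mulCoords (GJ.coords g) (GJ.coords h)) := by
  refine Eq.trans ?_ (GJ.ofCoords_mul _ _)
  change _ = GJ.ofCoords (GJ.toCoords g) * GJ.ofCoords (GJ.toCoords h)
  rw [GJ.ofCoords_toCoords, GJ.ofCoords_toCoords]

theorem GJ.inv_eq (g : GJ) : g⁻¹ = GJ.coords.symm (-GJ.coframe (GJ.coords g) (GJ.coords g)) := by
  apply GJ.coords.injective
  have h1 : GJ.coords.symm 0 = 1 := by
    refine LinSemidirect.ext (Subtype.ext (Subtype.ext ?_)) ?_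
    · change NormedSpace.exp (aElem 0) = 1
      simp [aElem]
    · change ![_, _, _, _] = 0
      funext i; fin_cases i <;> simp
  have h2 := GJ.coords_inv_mul (GJ.coords g) 0
  rw [h1, mul_one, Homeomorph.symm_apply_apply, zero_sub, map_neg] at h2
  rw [h2, Homeomorph.apply_symm_apply]

instance GJ.lieGroup : LieGroup I7 ∞ GJ where
  contMDiff_mul := by
    have h1 : ContMDiff (I7.prod I7) 𝓘(ℝ, E7 × E7) ∞
        fun p : GJ × GJ => (GJ.coords p.1, GJ.coords p.2) :=
      (GJ.isGlobalCoords.contMDiff.comp contMDiff_fst).prodMk_space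
        (GJ.isGlobalCoords.contMDiff.comp contMDiff_snd)
    have h2 := GJ.isGlobalCoords.contMDiff_symm.comp (GJ.contDiff_mulCoords.contMDiff.comp h1)
    refine h2.congr fun p => GJ.mul_eq p.1 p.2
  contMDiff_inv := by
    have h1 : ContDiff ℝ ∞ fun y => -GJ.coframe y y :=
      (GJ.contDiff_coframe.clm_apply contDiff_id).neg
    have h2 := GJ.isGlobalCoords.contMDiff_symm.comp
      (h1.contMDiff.comp GJ.isGlobalCoords.contMDiff)
    exact h2.congr fun g => GJ.inv_eq g

instance GJ.isTopologicalGroup : IsTopologicalGroup GJ :=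
  topologicalGroup_of_lieGroup I7 ∞

theorem GJ.pullback_mul_left (g : GJ) :
    DiffForm.pullback (fun h : GJ => g * h) GJ.phi = GJ.phi := by
  refine DiffForm.ext_val fun h => ?_
  have hg : MDifferentiableAt I7 I7 (fun h : GJ => g * h) h :=
    (contMDiff_mul_left (I := I7) (n := ∞) (a := g)).mdifferentiableAt (by simp)
  have hF : MDifferentiableAt I7 I7 (fun k => GJ.coords ((g * h)⁻¹ * k)) (g * h) :=
    (GJ.isGlobalCoords.contMDiff.comp
      (contMDiff_mul_left (I := I7) (n := ∞) (a := (g * h)⁻¹))).mdifferentiableAt (by simp)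
  have h2 : (fun k => GJ.coords ((g * h)⁻¹ * (g * k))) = fun k => GJ.coords (h⁻¹ * k) := by
    funext k
    congr 1
    group
  rw [DiffForm.pullback_val, GJ.val_phi, GJ.val_phi, ← h2, DiffForm.tangentDeriv_comp hF hg]
  ext v
  simp only [ContinuousAlternatingMap.compContinuousLinearMap_apply, ContinuousLinearMap.coe_comp]
  rfl

theorem GJ.simplyConnectedSpace : SimplyConnectedSpace GJ := by
  have : ContractibleSpace GJ := GJ.coords.contractibleSpace
  infer_instance

end

noncomputable section

/-! ### Solvability -/

theorem expA_mul_comm (a b : expA) : a * b = b * a := by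
  obtain ⟨D, hD, h⟩ := a.2
  obtain ⟨D', hD', h'⟩ := b.2
  refine Subtype.ext (Subtype.ext ?_)
  change (a : Matrix.SpecialLinearGroup (Fin 4) ℝ).1 * (b : Matrix.SpecialLinearGroup (Fin 4) ℝ).1 =
    (b : Matrix.SpecialLinearGroup (Fin 4) ℝ).1 * (a : Matrix.SpecialLinearGroup (Fin 4) ℝ).1
  rw [h, h', ← Matrix.exp_add_of_commute _ _ (diagAlg_commute hD hD'),
    ← Matrix.exp_add_of_commute _ _ (diagAlg_commute hD' hD), add_comm]

/-- The linear part of an element of `G_J`. -/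
def GJ.linHom : GJ →* expA where
  toFun := LinSemidirect.lin
  map_one' := rfl
  map_mul' := fun _ _ => rfl

/-- The linear part is a homomorphism to an abelian group, and its kernel, the group of
translations, is abelian. -/
theorem GJ.isSolvable : Group.IsSolvable GJ := by
  have h1 : Group.IsSolvable expA := Group.isSolvable_of_comm expA_mul_comm
  have h2 : Group.IsSolvable GJ.linHom.ker := by
    refine Group.isSolvable_of_comm fun a b => Subtype.ext ?_
    have ha : a.1.lin = 1 := a.2
    have hb : b.1.lin = 1 := b.2
    refine LinSemidirect.ext (expA_mul_comm _ _) ?_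
    change a.1.vec + a.1.mat *ᵥ b.1.vec = b.1.vec + b.1.mat *ᵥ a.1.vec
    simp [LinSemidirect.mat, ha, hb, add_comm]
  exact Group.isSolvable_of_ker_le_range GJ.linHom.ker.subtype GJ.linHom
    (by rw [Subgroup.range_subtype])

/-! ### Unimodularity -/

section Unimodular

open MeasureTheory MeasureTheory.Measure

theorem GJ.mulCoords_eq_add (x z : E7) : GJ.mulCoords x z = x + (GJ.coframe x).symm z := by
  ext i
  fin_cases i <;> rfl

/-- The exponents sum to the trace of an element of 𝔞, which is zero. Consequently left translations
preserve Lebesgue measure in the coordinates. -/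
theorem GJ.det_coframe_symm (x : E7) :
    LinearMap.det ((GJ.coframe x).symm : E7 →ₗ[ℝ] E7) = 1 := by
  let b := (EuclideanSpace.basisFun (Fin 7) ℝ).toBasis
  rw [← LinearMap.det_toMatrix b]
  have h : LinearMap.toMatrix b b ((GJ.coframe x).symm : E7 →ₗ[ℝ] E7) = Matrix.diagonal
      ![1, 1, Real.exp (x 6 + x 0 + x 1), Real.exp (x 6 - x 0 - x 1), Real.exp (-x 6 + x 0 - x 1),
        Real.exp (-x 6 - x 0 + x 1), 1] := by
    ext i j
    rw [LinearMap.toMatrix_apply]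
    change (GJ.coframe x).symm (b j) i = _
    have hb : b j = EuclideanSpace.single j 1 := by simp [b]
    rw [hb]
    change (!₂[_, _, _, _, _, _, _] : E7) i = _
    fin_cases i <;> fin_cases j <;> simp
  rw [h, Matrix.det_diagonal]
  simp only [Fin.prod_univ_seven, Matrix.cons_val, one_mul, mul_one, ← Real.exp_add]
  rw [← Real.exp_zero]
  congr 1
  ring

instance : LocallyCompactSpace GJ := GJ.coords.isClosedEmbedding.locallyCompactSpace

instance : SecondCountableTopology GJ := GJ.coords.isEmbedding.secondCountableTopology

instance : T2Space GJ := GJ.coords.isEmbedding.t2Space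

section Lebesgue

variable [MeasurableSpace GJ] [BorelSpace GJ]

/-- Lebesgue measure in the coordinates of `G_J`. -/
def GJ.lebesgue : Measure GJ := map GJ.coords.symm volume

theorem GJ.map_lebesgue {f : GJ → GJ} (hf : Measurable f) {F : E7 → E7} (hF : Measurable F)
    (h : ∀ y, f (GJ.coords.symm y) = GJ.coords.symm (F y)) (hv : map F volume = volume) :
    map f GJ.lebesgue = GJ.lebesgue := by
  have hc : Measurable GJ.coords.symm := GJ.coords.symm.continuous.measurable
  have h1 : f ∘ GJ.coords.symm = GJ.coords.symm ∘ F := funext h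
  rw [GJ.lebesgue, map_map hf hc, h1, ← map_map hc hF, hv]

instance GJ.isHaarMeasure_lebesgue : IsHaarMeasure GJ.lebesgue where
  lt_top_of_isCompact := by
    intro K hK
    rw [GJ.lebesgue, map_apply GJ.coords.symm.continuous.measurable hK.measurableSet]
    rw [← Homeomorph.image_eq_preimage_symm]
    exact (hK.image GJ.coords.continuous).measure_lt_top
  map_mul_left_eq_self := by
    intro g
    refine GJ.map_lebesgue (measurable_const_mul g) (F := GJ.mulCoords (GJ.coords g)) ?_ ?_ ?_
    · rw [show GJ.mulCoords (GJ.coords g) = _ from funext (GJ.mulCoords_eq_add _)]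
      fun_prop
    · intro y
      rw [GJ.mul_eq, Homeomorph.apply_symm_apply]
    · have hm : Measurable ((GJ.coframe (GJ.coords g)).symm : E7 →ₗ[ℝ] E7) :=
        (GJ.coframe (GJ.coords g)).symm.continuous.measurable
      rw [show GJ.mulCoords (GJ.coords g) = (fun z => GJ.coords g + z) ∘
          ((GJ.coframe (GJ.coords g)).symm : E7 →ₗ[ℝ] E7) from
        funext (GJ.mulCoords_eq_add _), ← map_map (measurable_const_add _) hm,
        map_linearMap_addHaar_eq_smul_addHaar _ (by rw [GJ.det_coframe_symm]; exact one_ne_zero),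
        GJ.det_coframe_symm]
      simp [map_add_left_eq_self]
  open_pos := by
    intro U hU hne
    rw [GJ.lebesgue, map_apply GJ.coords.symm.continuous.measurable hU.measurableSet]
    refine (hU.preimage GJ.coords.symm.continuous).measure_ne_zero _ ?_
    exact hne.preimage GJ.coords.symm.surjective

end Lebesgue

/-- Right multiplication by an element without translation part only shifts the coordinates by `x`,
and Lebesgue measure is invariant under shifts. -/
theorem GJ.modularCharacterFun_lin {x : E7} (h2 : x 2 = 0) (h3 : x 3 = 0) (h4 : x 4 = 0)
    (h5 : x 5 = 0) : modularCharacterFun (GJ.coords.symm x) = 1 := by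
  borelize GJ
  rw [modularCharacterFun_eq_haarScalarFactor GJ.lebesgue]
  have : map (· * GJ.coords.symm x) GJ.lebesgue = GJ.lebesgue := by
    refine GJ.map_lebesgue (measurable_mul_const _) (F := fun z => z + x) (by fun_prop) ?_
      (map_add_right_eq_self _ _)
    intro y
    refine (GJ.ofCoords_mul _ _).trans ?_
    change GJ.coords.symm _ = _
    congr 1
    ext i
    fin_cases i <;> simp [GJ.mulCoords, h2, h3, h4, h5]
  have hs : ∀ (μ : Measure GJ) [IsFiniteMeasureOnCompacts μ] [IsMulLeftInvariant μ],
      μ = GJ.lebesgue → haarScalarFactor μ GJ.lebesgue = 1 := by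
    rintro _ _ _ rfl
    exact haarScalarFactor_self _
  exact hs _ this

/-- Every translation is a commutator, and a character with commutative values is trivial on
commutators. -/
theorem GJ.modularCharacterFun_vec {x : E7} (h0 : x 0 = 0) (h1 : x 1 = 0) (h6 : x 6 = 0) :
    modularCharacterFun (GJ.coords.symm x) = 1 := by
  -- The element `h` acts on ℝ⁴ by exp(e₇) = Diag(e, e, e⁻¹, e⁻¹), which has no eigenvalue 1; `w`
  -- solves (exp(e₇) - 1) w = x, which is the relation h w = x w h.
  let h : E7 := !₂[0, 0, 0, 0, 0, 0, 1]
  let w : E7 := !₂[0, 0, x 2 / (Real.exp 1 - 1), x 3 / (Real.exp 1 - 1),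
    x 4 / (Real.exp (-1) - 1), x 5 / (Real.exp (-1) - 1), 0]
  have e1 : Real.exp 1 - 1 ≠ 0 := sub_ne_zero.2 (by simp)
  have e2 : Real.exp (-1) - 1 ≠ 0 := sub_ne_zero.2 (by simp)
  have key : GJ.coords.symm h * GJ.coords.symm w =
      GJ.coords.symm x * GJ.coords.symm w * GJ.coords.symm h := by
    change GJ.ofCoords h * GJ.ofCoords w = GJ.ofCoords x * GJ.ofCoords w * GJ.ofCoords h
    rw [GJ.ofCoords_mul, GJ.ofCoords_mul, GJ.ofCoords_mul]
    congr 1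
    ext i
    fin_cases i <;> simp [GJ.mulCoords, h, w, h0, h1, h6] <;> field_simp <;> ring
  have hm := congrArg modularCharacterFun key
  simp only [modularCharacterFun_map_mul] at hm
  have p1 := (modularCharacterFun_pos (GJ.coords.symm h)).ne'
  have p2 := (modularCharacterFun_pos (GJ.coords.symm w)).ne'
  have : modularCharacterFun (GJ.coords.symm x) * (modularCharacterFun (GJ.coords.symm w) *
      modularCharacterFun (GJ.coords.symm h)) = 1 * (modularCharacterFun (GJ.coords.symm w) *
      modularCharacterFun (GJ.coords.symm h)) := by
    rw [← mul_assoc, ← hm, one_mul, mul_comm]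
  exact mul_right_cancel₀ (mul_ne_zero p2 p1) this

theorem GJ.symm_eq_mul (x : E7) : GJ.coords.symm x = GJ.coords.symm !₂[0, 0, x 2, x 3, x 4, x 5, 0] *
    GJ.coords.symm !₂[x 0, x 1, 0, 0, 0, 0, x 6] := by
  refine Eq.trans ?_ (GJ.ofCoords_mul _ _).symm
  change GJ.ofCoords x = _
  congr 1
  ext i
  fin_cases i <;> simp [GJ.mulCoords]

theorem GJ.modularCharacterFun_eq_one (g : GJ) : modularCharacterFun g = 1 := by
  obtain ⟨x, rfl⟩ := GJ.coords.symm.surjective g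
  rw [GJ.symm_eq_mul, modularCharacterFun_map_mul,
    GJ.modularCharacterFun_vec (by simp) (by simp) (by simp),
    GJ.modularCharacterFun_lin (by simp) (by simp) (by simp) (by simp), mul_one]

theorem GJ.isUnimodularGroup : IsUnimodularGroup GJ := by
  borelize GJ
  intro μ hμ
  refine ⟨fun g => ?_⟩
  have h1 := isMulLeftInvariant_eq_smul (map (· * g) μ) μ
  rw [← modularCharacterFun_eq_haarScalarFactor μ g, GJ.modularCharacterFun_eq_one,
    one_smul] at h1
  exact h1

end Unimodular

end

noncomputable section

/-! ## Bryant's homogeneous space -/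

namespace BryantSpace

instance : IsManifold I7 ∞ BryantSpace := coords.isOpenEmbedding.isManifold_singleton

theorem isGlobalCoords : IsGlobalCoords coords where
  source_eq := fun _ => rfl
  coe_eq := fun _ => rfl

/-- The product of the simply transitive subgroup, in coordinates. -/
def mulCoords (x w : E7) : E7 := !₂[x 0 + Real.exp (2 * x 6) * w 0, x 1 + Real.exp (2 * x 6) * w 1,
  x 2 + Real.exp (x 6) * w 2 + 2 * Real.exp (-x 6) * (x 1 * w 4 + x 0 * w 5),
  x 3 + Real.exp (x 6) * w 3 + 2 * Real.exp (-x 6) * (x 0 * w 4 - x 1 * w 5),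
  x 4 + Real.exp (-x 6) * w 4, x 5 + Real.exp (-x 6) * w 5, x 6 + w 6]

theorem sect_mat (x : E7) : (sect x).mat =
    !![(Real.exp (x 6) : ℂ), zeta x * (Real.exp (-x 6) : ℂ); 0, (Real.exp (-x 6) : ℂ)] := rfl

theorem sect_mul (x w : E7) : sect x * sect w = sect (mulCoords x w) := by
  refine LinSemidirect.ext (Subtype.ext (Subtype.ext ?_)) ?_
  · change (sect x).mat * (sect w).mat = (sect (mulCoords x w)).mat
    have h1 : zeta (mulCoords x w) = zeta x + (Real.exp (2 * x 6) : ℂ) * zeta w := by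
      apply Complex.ext <;> simp [zeta, mulCoords, -Complex.ofReal_exp] <;> ring
    have h6 : mulCoords x w 6 = x 6 + w 6 := rfl
    have e2 : Real.exp (2 * x 6) = Real.exp (x 6) * Real.exp (x 6) := by
      rw [← Real.exp_add]; ring_nf
    have e1 : (Real.exp (x 6) : ℂ) * (Real.exp (-x 6) : ℂ) = 1 := by
      rw [← Complex.ofReal_mul, ← Real.exp_add]; simp
    rw [sect_mat, sect_mat, sect_mat, h1, h6, e2, neg_add, Real.exp_add, Real.exp_add]
    ext i j
    fin_cases i <;> fin_cases j <;>
      simp [-Complex.ofReal_exp, Matrix.mul_apply, Fin.sum_univ_two]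
    linear_combination (-(Real.exp (x 6) : ℂ) * zeta w * (Real.exp (-w 6) : ℂ)) * e1
  · change ![_, _] + (sect x).mat *ᵥ ![_, _] = ![_, _]
    rw [sect_mat]
    ext i
    fin_cases i <;> apply Complex.ext <;>
      simp [-Complex.ofReal_exp, zeta, mulCoords] <;> ring

/-- The invariant coframe of the simply transitive subgroup. -/
def coframe (y : E7) : E7 ≃L[ℝ] E7 :=
  LinearEquiv.toContinuousLinearEquiv
    { toFun := fun v => !₂[Real.exp (-(2 * y 6)) * v 0, Real.exp (-(2 * y 6)) * v 1,
        Real.exp (-y 6) * (v 2 - 2 * y 1 * v 4 - 2 * y 0 * v 5),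
        Real.exp (-y 6) * (v 3 - 2 * y 0 * v 4 + 2 * y 1 * v 5),
        Real.exp (y 6) * v 4, Real.exp (y 6) * v 5, v 6]
      invFun := fun w => !₂[Real.exp (2 * y 6) * w 0, Real.exp (2 * y 6) * w 1,
        Real.exp (y 6) * w 2 + 2 * Real.exp (-y 6) * (y 1 * w 4 + y 0 * w 5),
        Real.exp (y 6) * w 3 + 2 * Real.exp (-y 6) * (y 0 * w 4 - y 1 * w 5),
        Real.exp (-y 6) * w 4, Real.exp (-y 6) * w 5, w 6]
      map_add' := fun u v => by
        ext i; fin_cases i <;> simp <;> ring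
      map_smul' := fun c v => by
        ext i; fin_cases i <;> simp <;> ring
      left_inv := fun v => by
        have h1 := mul_inv_cancel₀ (Real.exp_pos (y 6)).ne'
        have h2 := mul_inv_cancel₀ (Real.exp_pos (2 * y 6)).ne'
        ext i
        fin_cases i <;> simp [Real.exp_neg] <;> field_simp <;> ring
      right_inv := fun v => by
        have h1 := mul_inv_cancel₀ (Real.exp_pos (y 6)).ne'
        have h2 := mul_inv_cancel₀ (Real.exp_pos (2 * y 6)).ne'
        ext i
        fin_cases i <;> simp [Real.exp_neg] <;> field_simp <;> ring }

theorem coframe_apply (y v : E7) : coframe y v =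
    !₂[Real.exp (-(2 * y 6)) * v 0, Real.exp (-(2 * y 6)) * v 1,
        Real.exp (-y 6) * (v 2 - 2 * y 1 * v 4 - 2 * y 0 * v 5),
        Real.exp (-y 6) * (v 3 - 2 * y 0 * v 4 + 2 * y 1 * v 5),
        Real.exp (y 6) * v 4, Real.exp (y 6) * v 5, v 6] := rfl

theorem mulCoords_eq_add (y w : E7) : mulCoords y w = y + (coframe y).symm w := by
  change mulCoords y w = y + (!₂[_, _, _, _, _, _, _] : E7)
  ext i
  fin_cases i <;> simp [mulCoords] <;> ring

theorem mulCoords_coframe (y z : E7) : mulCoords y (coframe y (z - y)) = z := by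
  rw [mulCoords_eq_add, ContinuousLinearEquiv.symm_apply_apply, add_sub_cancel]

theorem contDiff_coframe : ContDiff ℝ ∞ fun y => (coframe y : E7 →L[ℝ] E7) := by
  refine _root_.contDiff_coframe fun v i => ?_
  fin_cases i <;> simp [coframe_apply] <;> fun_prop

theorem isCoframeOn : IsCoframeOn Set.univ (structOfList structListBryant) coframe := by
  refine isCoframeOn_univ contDiff_coframe fun y u v i => ?_
  have hp : ∀ j : Fin 7, HasDerivAt (fun t : ℝ => (y + t • u) j) (u j) 0 := by
    intro j
    simpa using ((hasDerivAt_id (0 : ℝ)).mul_const (u j)).const_add (y j)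
  have h1 : Real.exp (-y 6) * Real.exp (y 6) = 1 := by rw [← Real.exp_add]; simp
  have h2 : Real.exp (-(2 * y 6)) = Real.exp (-y 6) ^ 2 := by
    rw [← Real.exp_nat_mul]; ring_nf
  fin_cases i
  · exact (((hp 6).const_mul 2).neg.exp.mul_const (v 0)).congr_deriv
      (by simp [structOfList_apply, structListBryant, coframe_apply]; ring)
  · exact (((hp 6).const_mul 2).neg.exp.mul_const (v 1)).congr_deriv
      (by simp [structOfList_apply, structListBryant, coframe_apply]; ring)
  · refine ((hp 6).neg.exp.mul (((((hp 1).const_mul 2).mul_const (v 4)).const_sub (v 2)).sub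
      (((hp 0).const_mul 2).mul_const (v 5)))).congr_deriv ?_
    simp [structOfList_apply, structListBryant, coframe_apply, h2]
    linear_combination (2 * Real.exp (-y 6) * (u 1 * v 4 + u 0 * v 5)) * h1
  · refine ((hp 6).neg.exp.mul (((((hp 0).const_mul 2).mul_const (v 4)).const_sub (v 3)).add
      (((hp 1).const_mul 2).mul_const (v 5)))).congr_deriv ?_
    simp [structOfList_apply, structListBryant, coframe_apply, h2]
    linear_combination (2 * Real.exp (-y 6) * (u 0 * v 4 - u 1 * v 5)) * h1
  · exact ((hp 6).exp.mul_const (v 4)).congr_deriv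
      (by simp [structOfList_apply, structListBryant, coframe_apply]; ring)
  · exact ((hp 6).exp.mul_const (v 5)).congr_deriv
      (by simp [structOfList_apply, structListBryant, coframe_apply]; ring)
  · exact (hasDerivAt_const (0 : ℝ) (v 6)).congr_deriv
      (by simp [structOfList_apply, structListBryant, coframe_apply])

/-- The elements `sect x` form a group acting simply transitively, with affine left translations in
the coordinates. So the homogeneous space is treated like a Lie group with its left-invariant
coframe. -/
theorem coords_sect_inv_smul (y z : E7) :
    coords ((sect y)⁻¹ • coords.symm z) = coframe y (z - y) := by
  have h1 : sect y • coords.symm (coframe y (z - y)) = coords.symm z := by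
    change sect y • (sect (coframe y (z - y)) • base) = sect z • base
    rw [← mul_smul, sect_mul, mulCoords_coframe]
  rw [← h1, inv_smul_smul, Homeomorph.apply_symm_apply]

theorem val_phi (p : BryantSpace) : DiffForm.val phi p = phi0.compContinuousLinearMap
    (tangentDeriv (fun q => coords ((sect (coords p))⁻¹ • q)) p) := by
  delta phi DiffForm.val DiffForm.pullback tangentDeriv
  rfl

theorem val_pullback_phi (y : E7) : DiffForm.val (DiffForm.pullback coords.symm phi) y =
    phi0.compContinuousLinearMap (coframe y : E7 →L[ℝ] E7) := by
  refine isGlobalCoords.val_pullback phi0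
    (F := fun q => coords ((sect (coords (coords.symm y)))⁻¹ • q)) (c := -coframe y y) ?_ y
    (val_phi _)
  intro z
  rw [Homeomorph.apply_symm_apply, coords_sect_inv_smul, map_sub, sub_eq_add_neg]
  rfl

theorem isAdaptedOn : IsAdaptedOn Set.univ coords.symm phi (structOfList structListBryant)
    coframe :=
  isGlobalCoords.isAdaptedOn isCoframeOn val_pullback_phi

theorem isERP : IsERP phi :=
  isERPStructure_bryant.isERP isAdaptedOn contDiff_coframe isGlobalCoords.eqOn_symm
    coords.symm.surjective

/-! ### The action of `SL₂(ℂ) ⋉ ℂ²` -/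

theorem sect_coords_smul_base (p : BryantSpace) : sect (coords p) • base = p :=
  coords.symm_apply_apply p

theorem isPretransitive : MulAction.IsPretransitive SL2Aff BryantSpace :=
  ⟨fun p q => ⟨sect (coords q) * (sect (coords p))⁻¹, by
    rw [mul_smul]
    nth_rw 2 [← sect_coords_smul_base p]
    rw [inv_smul_smul, sect_coords_smul_base]⟩⟩

theorem herm_smul (g : SL2Aff) (p : BryantSpace) : (g • p).herm = g.mat * p.herm * g.matᴴ := rfl

theorem vec_smul (g : SL2Aff) (p : BryantSpace) : (g • p).vec = g.mat *ᵥ p.vec + g.vec := rfl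

theorem smul_base_eq_iff (g : SL2Aff) : g • base = base ↔
    g.mat ∈ Matrix.unitaryGroup (Fin 2) ℂ ∧ g.vec = 0 := by
  rw [BryantSpace.ext_iff, herm_smul, vec_smul, Matrix.mem_unitaryGroup_iff]
  simp [base, Matrix.star_eq_conjTranspose]

theorem contDiff_zeta : ContDiff ℝ ∞ zeta := by
  have : zeta = fun x : E7 => Complex.ofRealCLM (2 * x 1) +
      Complex.ofRealCLM (2 * x 0) * Complex.I := by
    funext x; exact (Complex.mk_eq_add_mul_I _ _)
  rw [this]
  fun_prop

theorem contDiff_herm (i j : Fin 2) : ContDiff ℝ ∞ fun x => (coords.symm x).herm i j := by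
  have h : ∀ x, (coords.symm x).herm = _ := ofCoords_herm
  simp only [h]
  have he : ∀ c : ℝ, ContDiff ℝ ∞ fun x : E7 => ((Real.exp (c * x 6) : ℝ) : ℂ) := fun c =>
    Complex.ofRealCLM.contDiff.comp (f := fun x : E7 => Real.exp (c * x 6)) (by fun_prop)
  have he1 : ContDiff ℝ ∞ fun x : E7 => ((Real.exp (x 6) : ℝ) : ℂ) := by simpa using he 1
  have he2 : ContDiff ℝ ∞ fun x : E7 => ((Real.exp (-x 6) : ℝ) : ℂ) := by simpa using he (-1)
  have hz := contDiff_zeta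
  have hs : ContDiff ℝ ∞ fun x : E7 => (starRingEnd ℂ) (zeta x) :=
    Complex.conjCLE.contDiff.comp hz
  have hn : ContDiff ℝ ∞ fun x : E7 => ((Complex.normSq (zeta x) : ℝ) : ℂ) := by
    simp only [Complex.normSq_eq_conj_mul_self]
    exact hs.mul hz
  fin_cases i <;> fin_cases j <;> simp [-Complex.ofReal_exp] <;> fun_prop

theorem contDiff_vec (i : Fin 2) : ContDiff ℝ ∞ fun x => (coords.symm x).vec i := by
  have h : ∀ x, (coords.symm x).vec = _ := ofCoords_vec
  simp only [h]
  fin_cases i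
  · have : (fun x : E7 => (⟨x 2, x 3⟩ : ℂ)) = fun x : E7 => Complex.ofRealCLM (x 2) +
        Complex.ofRealCLM (x 3) * Complex.I := by
      funext x; exact (Complex.mk_eq_add_mul_I _ _)
    simp only [Fin.zero_eta, Matrix.cons_val, this]
    fun_prop
  · have : (fun x : E7 => (⟨x 4, -x 5⟩ : ℂ)) = fun x : E7 => Complex.ofRealCLM (x 4) +
        Complex.ofRealCLM (-x 5) * Complex.I := by
      funext x; exact (Complex.mk_eq_add_mul_I _ _)
    simp only [Fin.mk_one, Matrix.cons_val, this]
    fun_prop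

theorem contDiff_smul (g : SL2Aff) : ContDiff ℝ ∞ fun x => coords (g • coords.symm x) := by
  have hh : ∀ i j, ContDiff ℝ ∞ fun x => (g • coords.symm x).herm i j := by
    intro i j
    simp only [herm_smul, Matrix.mul_apply, Fin.sum_univ_two]
    have := contDiff_herm
    fun_prop
  have hv : ∀ i, ContDiff ℝ ∞ fun x => (g • coords.symm x).vec i := by
    intro i
    simp only [vec_smul, Matrix.mulVec, dotProduct, Fin.sum_univ_two, Pi.add_apply]
    have := contDiff_vec
    fun_prop
  have hne : ∀ p : BryantSpace, p.herm 1 1 ≠ 0 := fun p h => by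
    have := herm_pos p
    rw [h] at this; simp at this
  have hz : ContDiff ℝ ∞ fun x => (g • coords.symm x).herm 0 1 / (g • coords.symm x).herm 1 1 := by
    simp only [div_eq_mul_inv]
    exact (hh 0 1).mul ((hh 1 1).inv fun x => hne _)
  have hl : ContDiff ℝ ∞ fun x => Real.log ((g • coords.symm x).herm 1 1).re :=
    (Complex.reCLM.contDiff.comp (hh 1 1)).log fun x => (herm_pos _).ne'
  refine contDiff_euclidean.2 fun i => ?_
  fin_cases i
  · exact (Complex.imCLM.contDiff.comp hz).div_const 2
  · exact (Complex.reCLM.contDiff.comp hz).div_const 2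
  · exact Complex.reCLM.contDiff.comp (hv 0)
  · exact Complex.imCLM.contDiff.comp (hv 0)
  · exact Complex.reCLM.contDiff.comp (hv 1)
  · exact (Complex.imCLM.contDiff.comp (hv 1)).neg
  · exact hl.neg.div_const 2

theorem contMDiff_smul (g : SL2Aff) : ContMDiff I7 I7 ∞ fun p : BryantSpace => g • p := by
  have h := isGlobalCoords.contMDiff_symm.comp
    ((contDiff_smul g).contMDiff.comp isGlobalCoords.contMDiff)
  refine h.congr fun p => ?_
  simp

end BryantSpace

end

noncomputable section

/-! ### The invariance of `φ₀` under `SU(2)` -/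

theorem phi0_apply (x y z : E7) : phi0 ![x, y, z] =
    (x 0 * (y 1 * z 6 - y 6 * z 1) - x 1 * (y 0 * z 6 - y 6 * z 0) + x 6 * (y 0 * z 1 - y 1 * z 0)) +
    (x 2 * (y 3 * z 6 - y 6 * z 3) - x 3 * (y 2 * z 6 - y 6 * z 2) + x 6 * (y 2 * z 3 - y 3 * z 2)) +
    (x 4 * (y 5 * z 6 - y 6 * z 5) - x 5 * (y 4 * z 6 - y 6 * z 4) + x 6 * (y 4 * z 5 - y 5 * z 4)) +
    (x 0 * (y 2 * z 4 - y 4 * z 2) - x 2 * (y 0 * z 4 - y 4 * z 0) + x 4 * (y 0 * z 2 - y 2 * z 0)) -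
    (x 0 * (y 3 * z 5 - y 5 * z 3) - x 3 * (y 0 * z 5 - y 5 * z 0) + x 5 * (y 0 * z 3 - y 3 * z 0)) -
    (x 1 * (y 2 * z 5 - y 5 * z 2) - x 2 * (y 1 * z 5 - y 5 * z 1) + x 5 * (y 1 * z 2 - y 2 * z 1)) -
    (x 1 * (y 3 * z 4 - y 4 * z 3) - x 3 * (y 1 * z 4 - y 4 * z 1) + x 4 * (y 1 * z 3 - y 3 * z 1)) := by
  simp only [phi0, ContinuousAlternatingMap.add_apply, ContinuousAlternatingMap.sub_apply,
    coordForm_apply, Matrix.det_fin_three, Matrix.of_apply, Matrix.cons_val]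
  ring

/-- The action of `[a, b; -b̄, ā]`, `a = p + i q`, `b = r + i s`, on `i 𝔰𝔲(2) ⊕ ℂ²`, in the basis
`e_1, …, e_7`. -/
def su2Action (p q r s : ℝ) (u : E7) : E7 :=
  !₂[(p ^ 2 - q ^ 2 + r ^ 2 - s ^ 2) * u 0 + (2 * p * q - 2 * r * s) * u 1
      - 2 * (p * s + q * r) * u 6,
    (p ^ 2 - q ^ 2 - r ^ 2 + s ^ 2) * u 1 - (2 * p * q + 2 * r * s) * u 0
      - 2 * (p * r - q * s) * u 6,
    p * u 2 - q * u 3 + r * u 4 + s * u 5, p * u 3 + q * u 2 + s * u 4 - r * u 5,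
    -r * u 2 - s * u 3 + p * u 4 - q * u 5, r * u 3 - s * u 2 + p * u 5 + q * u 4,
    (p ^ 2 + q ^ 2 - r ^ 2 - s ^ 2) * u 6 + 2 * (p * r + q * s) * u 1 - 2 * (q * r - p * s) * u 0]

theorem phi0_su2Action_stdVec {p q r s : ℝ} (h : p ^ 2 + q ^ 2 + r ^ 2 + s ^ 2 = 1) :
    ∀ a b : Fin 7, a < b → ∀ c, b < c →
      phi0 ![su2Action p q r s (stdVec a), su2Action p q r s (stdVec b),
        su2Action p q r s (stdVec c)] = phi0 ![stdVec a, stdVec b, stdVec c] := by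
  intro a b hab c hbc
  rw [phi0_apply, phi0_apply]
  fin_cases a <;> fin_cases b <;> first | exact absurd hab (by decide) | skip
  all_goals fin_cases c <;> first | exact absurd hbc (by decide) | skip
  all_goals simp [su2Action]
  -- Let N = p² + q² + r² + s². For arbitrary N the map multiplies lengths by N on e₁, e₂, e₇ and by
  -- √N on the fibre. So the e¹²⁷ term acquires N³ and the other six terms acquire N²; the
  -- multipliers of `h` are the cofactors of N - 1 in N² - 1 and N³ - 1.
  all_goals first
    | ring1
    | linear_combination (p ^ 2 + q ^ 2 + r ^ 2 + s ^ 2 + 1) * h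
    | linear_combination -(p ^ 2 + q ^ 2 + r ^ 2 + s ^ 2 + 1) * h
    | linear_combination ((p ^ 2 + q ^ 2 + r ^ 2 + s ^ 2) ^ 2 +
        (p ^ 2 + q ^ 2 + r ^ 2 + s ^ 2) + 1) * h

/-! ### The isotropy representation of SU(2) at the base point. -/

namespace BryantSpace

theorem coords_symm_zero : coords.symm 0 = base := by
  change sect 0 • base = base
  have : sect 0 = 1 := by
    refine LinSemidirect.ext (Subtype.ext (Subtype.ext ?_)) ?_
    · change (sect 0).mat = 1
      rw [sect_mat]
      ext i j
      fin_cases i <;> fin_cases j <;> simp [zeta, Complex.ext_iff]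
    · change ![_, _] = 0
      ext i
      fin_cases i <;> simp [Complex.ext_iff]
  rw [this, one_smul]

/-- The derivative at the base point of the Hermitian component, in coordinates. -/
def hermDeriv (u : E7) : Matrix (Fin 2) (Fin 2) ℂ :=
  !![((2 * u 6 : ℝ) : ℂ), zeta u; (starRingEnd ℂ) (zeta u), ((-(2 * u 6) : ℝ) : ℂ)]

theorem hasDerivAt_zeta {γ : ℝ → E7} {u : E7} (hγ : HasDerivAt γ u 0) :
    HasDerivAt (fun t => zeta (γ t)) (zeta u) 0 := by
  have hp : ∀ j : Fin 7, HasDerivAt (fun t => γ t j) (u j) 0 := fun j =>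
    (EuclideanSpace.proj (𝕜 := ℝ) j).hasFDerivAt.comp_hasDerivAt (0 : ℝ) hγ
  have h : ∀ x, zeta x = ((2 * x 1 : ℝ) : ℂ) + ((2 * x 0 : ℝ) : ℂ) * Complex.I := fun x =>
    Complex.mk_eq_add_mul_I _ _
  simp only [h]
  exact ((hp 1).const_mul 2).ofReal_comp.add (((hp 0).const_mul 2).ofReal_comp.mul_const _)

theorem hasDerivAt_herm {γ : ℝ → E7} {u : E7} (hγ : HasDerivAt γ u 0) (h0 : γ 0 = 0)
    (i j : Fin 2) :
    HasDerivAt (fun t => (coords.symm (γ t)).herm i j) (hermDeriv u i j) 0 := by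
  have h6 : HasDerivAt (fun t => γ t 6) (u 6) 0 :=
    (EuclideanSpace.proj (𝕜 := ℝ) (6 : Fin 7)).hasFDerivAt.comp_hasDerivAt (0 : ℝ) hγ
  have h06 : γ 0 6 = 0 := by rw [h0]; rfl
  have hz := hasDerivAt_zeta hγ
  have hz0 : zeta (γ 0) = 0 := by rw [h0]; apply Complex.ext <;> simp [zeta]
  have hs : HasDerivAt (fun t => (starRingEnd ℂ) (zeta (γ t))) ((starRingEnd ℂ) (zeta u)) 0 :=
    Complex.conjCLE.hasFDerivAt.comp_hasDerivAt (0 : ℝ) hz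
  have he : HasDerivAt (fun t => (Real.exp (γ t 6) : ℂ)) (u 6) 0 := by
    simpa [h06] using h6.exp.ofReal_comp
  have he' : HasDerivAt (fun t => (Real.exp (-γ t 6) : ℂ)) (-u 6 : ℝ) 0 := by
    simpa [h06] using h6.neg.exp.ofReal_comp
  have h : ∀ x, (coords.symm x).herm = _ := ofCoords_herm
  simp only [h, Complex.normSq_eq_conj_mul_self]
  fin_cases i <;> fin_cases j
  · refine ((he.pow 2).add ((hs.mul hz).mul (he'.pow 2))).congr_deriv ?_
    simp [hermDeriv, h06, hz0]
  · refine (hz.mul (he'.pow 2)).congr_deriv ?_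
    simp [hermDeriv, h06, hz0]
  · refine (hs.mul (he'.pow 2)).congr_deriv ?_
    simp [hermDeriv, h06, hz0]
  · refine (he'.pow 2).congr_deriv ?_
    simp [hermDeriv, h06]

/-- An element of `SU(2)`. -/
structure IsSU2 (g : SL2Aff) (p q r s : ℝ) : Prop where
  mat_eq : g.mat = !![⟨p, q⟩, ⟨r, s⟩; ⟨-r, s⟩, ⟨p, -q⟩]
  vec_eq : g.vec = 0
  norm_eq : p ^ 2 + q ^ 2 + r ^ 2 + s ^ 2 = 1

/-- For a unitary matrix of determinant one the conjugate transpose is the adjugate. Comparing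
entries gives the shape [a, b; -b̄, ā], and the determinant gives the norm condition. -/
theorem exists_isSU2 {g : SL2Aff} (hg : g • base = base) : ∃ p q r s, IsSU2 g p q r s := by
  obtain ⟨h1, h2⟩ := (smul_base_eq_iff g).1 hg
  have hd : g.mat.det = 1 := (g.lin : Matrix.SpecialLinearGroup (Fin 2) ℂ).2
  have h3 : g.matᴴ = g.mat.adjugate := by
    have h4 : g.mat.adjugate * (g.mat * g.matᴴ) = g.mat.adjugate := by
      rw [show g.mat * g.matᴴ = 1 from Matrix.mem_unitaryGroup_iff.1 h1, mul_one]
    rwa [← mul_assoc, Matrix.adjugate_mul, hd, one_smul, one_mul] at h4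
  rw [Matrix.adjugate_fin_two] at h3
  have h00 := congrFun (congrFun h3 0) 0
  have h10 := congrFun (congrFun h3 0) 1
  simp [Matrix.conjTranspose_apply, Complex.ext_iff] at h00 h10
  rw [Matrix.det_fin_two] at hd
  refine ⟨(g.mat 0 0).re, (g.mat 0 0).im, (g.mat 0 1).re, (g.mat 0 1).im, ?_, h2, ?_⟩
  · ext i j
    fin_cases i <;> fin_cases j <;> simp [Complex.ext_iff] <;> constructor <;> linarith
  · have := congrArg Complex.re hd
    simp at this
    rw [← h00.1, ← h00.2, h10.1, show (g.mat 1 0).im = (g.mat 0 1).im by linarith] at this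
    linarith

/-- The intertwining identity for g along the line t ↦ t u is differentiated at t = 0. The Hermitian
part transforms by X ↦ g X g*, of which the entries (0, 1) and (1, 1) determine the coordinates; the
vector part is exactly linear in t. -/
theorem IsSU2.fderiv_eq {g : SL2Aff} {p q r s : ℝ} (hg : IsSU2 g p q r s) (u : E7) :
    fderiv ℝ (fun x => coords (g • coords.symm x)) 0 u = su2Action p q r s u := by
  set F := fun x => coords (g • coords.symm x) with hF
  set w := fderiv ℝ F 0 u
  have hl : HasDerivAt (fun t : ℝ => t • u) u 0 := by
    simpa using (hasDerivAt_id (0 : ℝ)).smul_const u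
  have hd : HasFDerivAt F (fderiv ℝ F 0) ((0 : ℝ) • u) := by
    rw [zero_smul]
    exact ((contDiff_smul g).differentiable (by simp) 0).hasFDerivAt
  have hγ : HasDerivAt (fun t : ℝ => F (t • u)) w 0 :=
    hd.comp_hasDerivAt (f := fun t : ℝ => t • u) (0 : ℝ) hl
  have hb : g • base = base := by
    rw [smul_base_eq_iff, Matrix.mem_unitaryGroup_iff, hg.vec_eq, hg.mat_eq]
    refine ⟨?_, rfl⟩
    have := hg.norm_eq
    ext i j
    fin_cases i <;> fin_cases j <;> simp [Matrix.mul_apply, Fin.sum_univ_two, Complex.ext_iff] <;>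
      constructor <;> linarith
  have hγ0 : F ((0 : ℝ) • u) = 0 := by
    rw [zero_smul, hF]
    simp only
    rw [coords_symm_zero, hb, ← coords_symm_zero, Homeomorph.apply_symm_apply]
  have key : ∀ t : ℝ, coords.symm (F (t • u)) = g • coords.symm (t • u) := fun t => by
    rw [hF]; simp
  have hh : ∀ i j, hermDeriv w i j = ∑ b, (∑ a, g.mat i a * hermDeriv u a b) * g.matᴴ b j := by
    intro i j
    refine (hasDerivAt_herm hγ hγ0 i j).unique ?_
    simp only [key, herm_smul, Matrix.mul_apply]
    exact HasDerivAt.fun_sum fun b _ => (HasDerivAt.fun_sum fun a _ =>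
      (hasDerivAt_herm hl (zero_smul ℝ u) a b).const_mul _).mul_const _
  have h01 := hh 0 1
  have h11 := hh 1 1
  simp [hermDeriv, Fin.sum_univ_two, hg.mat_eq, zeta, Complex.ext_iff] at h01 h11
  have hp : ∀ j : Fin 7, HasDerivAt (fun t : ℝ => F (t • u) j) (w j) 0 := fun j =>
    (EuclideanSpace.proj (𝕜 := ℝ) j).hasFDerivAt.comp_hasDerivAt (0 : ℝ) hγ
  have hq : ∀ c : ℝ, HasDerivAt (fun t : ℝ => t * c) c 0 := fun c => by
    simpa using (hasDerivAt_id (0 : ℝ)).mul_const c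
  have hvec : ∀ t : ℝ, (g • coords.symm (t • u)).vec =
      g.mat *ᵥ ![⟨t * u 2, t * u 3⟩, ⟨t * u 4, -(t * u 5)⟩] := by
    intro t
    rw [vec_smul, hg.vec_eq, add_zero]
    exact congrArg _ (ofCoords_vec _)
  have hF2 : ∀ t : ℝ, F (t • u) 2 = t * su2Action p q r s u 2 := fun t => by
    change ((g • coords.symm (t • u)).vec 0).re = _
    rw [hvec, hg.mat_eq]
    simp [su2Action]
    ring
  have hF3 : ∀ t : ℝ, F (t • u) 3 = t * su2Action p q r s u 3 := fun t => by
    change ((g • coords.symm (t • u)).vec 0).im = _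
    rw [hvec, hg.mat_eq]
    simp [su2Action]
    ring
  have hF4 : ∀ t : ℝ, F (t • u) 4 = t * su2Action p q r s u 4 := fun t => by
    change ((g • coords.symm (t • u)).vec 1).re = _
    rw [hvec, hg.mat_eq]
    simp [su2Action]
    ring
  have hF5 : ∀ t : ℝ, F (t • u) 5 = t * su2Action p q r s u 5 := fun t => by
    change -((g • coords.symm (t • u)).vec 1).im = _
    rw [hvec, hg.mat_eq]
    simp [su2Action]
    ring
  ext i
  fin_cases i
  · simp [su2Action]; linarith [h01.2]
  · simp [su2Action]; linarith [h01.1]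
  · exact (hp 2).unique (by simp only [hF2]; exact hq _)
  · exact (hp 3).unique (by simp only [hF3]; exact hq _)
  · exact (hp 4).unique (by simp only [hF4]; exact hq _)
  · exact (hp 5).unique (by simp only [hF5]; exact hq _)
  · simp [su2Action]; linarith [h11.1]

theorem phi0_comp_fderiv {g : SL2Aff} (hg : g • base = base) :
    phi0.compContinuousLinearMap (fderiv ℝ (fun x => coords (g • coords.symm x)) 0) = phi0 := by
  obtain ⟨p, q, r, s, h⟩ := exists_isSU2 hg
  refine alternating_ext fun i hi => ?_
  refine forall_strictMono_three (P := fun i => phi0.compContinuousLinearMap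
    (fderiv ℝ (fun x => coords (g • coords.symm x)) 0) (fun a => stdVec (i a)) =
      phi0 (fun a => stdVec (i a))) ?_ i hi
  intro a b hab c hbc
  have h1 := phi0_su2Action_stdVec h.norm_eq a b hab c hbc
  have h2 : (fun x => stdVec (![a, b, c] x)) = ![stdVec a, stdVec b, stdVec c] := by
    funext x; fin_cases x <;> rfl
  rw [ContinuousAlternatingMap.compContinuousLinearMap_apply, h2, ← h1]
  congr 1
  funext x
  fin_cases x <;> exact h.fderiv_eq _

/-- The form at a point is defined by moving it to the base point with the section. Two ways of
moving differ by an element `k` of the stabilizer, so invariance under the whole group follows from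
invariance of φ₀ under SU(2). -/
theorem pullback_smul (g : SL2Aff) :
    DiffForm.pullback (fun p : BryantSpace => g • p) phi = phi := by
  refine DiffForm.ext_val fun p => ?_
  have hsm : ∀ (k : SL2Aff) (p : BryantSpace),
      MDifferentiableAt I7 I7 (fun q : BryantSpace => k • q) p := fun k p =>
    (contMDiff_smul k).mdifferentiableAt (by simp)
  have hcs : ∀ (k : SL2Aff) (p : BryantSpace),
      MDifferentiableAt I7 I7 (fun q : BryantSpace => coords (k • q)) p := fun k p =>
    (isGlobalCoords.contMDiff.comp (contMDiff_smul k)).mdifferentiableAt (by simp)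
  let k := (sect (coords (g • p)))⁻¹ * g * sect (coords p)
  have hk : k • base = base := by
    simp only [k, mul_smul, sect_coords_smul_base]
    rw [inv_smul_eq_iff, sect_coords_smul_base]
  have h0 : coords ((sect (coords p))⁻¹ • p) = 0 := by
    nth_rw 2 [← sect_coords_smul_base p]
    rw [inv_smul_smul, ← coords_symm_zero, Homeomorph.apply_symm_apply]
  have h1 : (fun q => coords ((sect (coords (g • p)))⁻¹ • (g • q))) =
      fun q => (fun x => coords (k • coords.symm x)) (coords ((sect (coords p))⁻¹ • q)) := by
    funext q
    simp only [Homeomorph.symm_apply_apply, k, ← mul_smul]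
    congr 2
    group
  have h2 : MDifferentiableAt I7 I7 (fun x => coords (k • coords.symm x))
      (coords ((sect (coords p))⁻¹ • p)) :=
    (contDiff_smul k).contMDiff.mdifferentiableAt (by simp)
  have h3 := DiffForm.tangentDeriv_comp (g := fun q => coords ((sect (coords (g • p)))⁻¹ • q))
    (hcs _ _) (hsm g p)
  have h4 := DiffForm.tangentDeriv_comp (g := fun x => coords (k • coords.symm x))
    (f := fun q => coords ((sect (coords p))⁻¹ • q)) h2 (hcs (sect (coords p))⁻¹ p)
  rw [h1, h4, DiffForm.tangentDeriv_eq_fderiv, h0] at h3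
  have hcomp : ∀ A B : E7 →L[ℝ] E7, (phi0.compContinuousLinearMap A).compContinuousLinearMap B =
      phi0.compContinuousLinearMap (A.comp B) := fun _ _ => rfl
  rw [DiffForm.pullback_val, val_phi, val_phi, hcomp, ← h3, ← hcomp, phi0_comp_fderiv hk]

end BryantSpace

end

noncomputable section

/-! ## Elements of `G₂` that preserve `e^{3456}` up to scale -/

/-- The indices of `e_1, e_2, e_7`. -/
def baseIndex : Fin 3 → Fin 7 := ![0, 1, 6]

theorem baseIndex_injective : Function.Injective baseIndex := by decide

theorem coordForm_base_apply (x y z : E7) : coordForm ![0, 1, 6] ![x, y, z] =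
    x 0 * (y 1 * z 6 - y 6 * z 1) - x 1 * (y 0 * z 6 - y 6 * z 0)
      + x 6 * (y 0 * z 1 - y 1 * z 0) := by
  simp only [coordForm_apply, Matrix.det_fin_three, Matrix.of_apply, Matrix.cons_val]
  ring

/-- The Hodge star commutes with `A` and exchanges e³⁴⁵⁶ with e¹²⁷, so `A` also preserves e¹²⁷ up to
`μ` and therefore its kernel, the span of e₃, …, e₆. Rows 1, 2, 7 of the orthogonal matrix `A` then
vanish on that span, and the remaining 3 × 3 block is orthogonal. -/
theorem sum_sq_base_of_map_phi0 {A : E7 →L[ℝ] E7} (hA : phi0.compContinuousLinearMap A = phi0)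
    {μ : ℝ} (hμ : μ ≠ 0)
    (hq : (coordForm ![2, 3, 4, 5]).compContinuousLinearMap A = μ • coordForm ![2, 3, 4, 5])
    (w : E7) :
    ∑ i, A w (baseIndex i) ^ 2 = ∑ i, w (baseIndex i) ^ 2 := by
  have hb : (coordForm ![0, 1, 6]).compContinuousLinearMap A = μ • coordForm ![0, 1, 6] := by
    rw [← star0_quad, ← star0_comp_of_map_phi0 hA four_add_three_eq, hq, star0_smul]
  have hb' : ∀ x y z, coordForm ![0, 1, 6] ![A x, A y, A z] =
      μ * coordForm ![0, 1, 6] ![x, y, z] := by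
    intro x y z
    have := DFunLike.congr_fun hb ![x, y, z]
    rw [ContinuousAlternatingMap.smul_apply, smul_eq_mul] at this
    rw [← this, ContinuousAlternatingMap.compContinuousLinearMap_apply]
    congr 1
    funext a
    fin_cases a <;> rfl
  have hd := hb' (stdVec 0) (stdVec 1) (stdVec 6)
  have hz : ∀ j : Fin 7, j = 2 ∨ j = 3 ∨ j = 4 ∨ j = 5 →
      A (stdVec j) 0 = 0 ∧ A (stdVec j) 1 = 0 ∧ A (stdVec j) 6 = 0 := by
    intro j hj
    have h1 := hb' (stdVec j) (stdVec 1) (stdVec 6)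
    have h2 := hb' (stdVec j) (stdVec 0) (stdVec 6)
    have h3 := hb' (stdVec j) (stdVec 0) (stdVec 1)
    have e0 : (stdVec j : E7) 0 = 0 := by rcases hj with rfl | rfl | rfl | rfl <;> simp
    have e1 : (stdVec j : E7) 1 = 0 := by rcases hj with rfl | rfl | rfl | rfl <;> simp
    have e6 : (stdVec j : E7) 6 = 0 := by rcases hj with rfl | rfl | rfl | rfl <;> simp
    simp only [coordForm_base_apply, e0, e1, e6] at h1 h2 h3 hd
    simp at h1 h2 h3 hd
    -- Cramer's rule: the images of e₁, e₂, e₇ have base determinant `μ ≠ 0`, while all determinants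
    -- with one column replaced by the image of `e_j` vanish.
    refine ⟨?_, ?_, ?_⟩ <;> apply mul_left_cancel₀ hμ <;> rw [mul_zero, ← hd]
    · linear_combination A (stdVec 0) 0 * h1 - A (stdVec 1) 0 * h2 + A (stdVec 6) 0 * h3
    · linear_combination A (stdVec 0) 1 * h1 - A (stdVec 1) 1 * h2 + A (stdVec 6) 1 * h3
    · linear_combination A (stdVec 0) 6 * h1 - A (stdVec 1) 6 * h2 + A (stdVec 6) 6 * h3
  have hz' : ∀ j : Fin 7, j = 2 ∨ j = 3 ∨ j = 4 ∨ j = 5 → ∀ i, A (stdVec j) (baseIndex i) = 0 := by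
    intro j hj i
    obtain ⟨h0, h1, h6⟩ := hz j hj
    fin_cases i
    exacts [h0, h1, h6]
  let B : Matrix (Fin 3) (Fin 3) ℝ := Matrix.of fun i k => A (stdVec (baseIndex k)) (baseIndex i)
  have hBB : B * Bᵀ = 1 := by
    ext i i'
    have h := row_orthonormal_of_map_phi0 hA (baseIndex i) (baseIndex i')
    rw [Fin.sum_univ_seven, hz' 2 (by simp), hz' 3 (by simp), hz' 4 (by simp), hz' 5 (by simp)] at h
    simp only [baseIndex_injective.eq_iff] at h
    rw [Matrix.mul_apply, Matrix.one_apply, ← h, Fin.sum_univ_three]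
    simp [B, baseIndex]
  have hBB' := mul_eq_one_comm.1 hBB
  have hw : ∀ i, A w (baseIndex i) = (B *ᵥ fun k => w (baseIndex k)) i := by
    intro i
    conv_lhs => rw [eq_sum_stdVec w]
    rw [map_sum, WithLp.ofLp_sum, Finset.sum_apply, Fin.sum_univ_seven]
    simp only [map_smul, PiLp.smul_apply, smul_eq_mul]
    rw [hz' 2 (by simp), hz' 3 (by simp), hz' 4 (by simp), hz' 5 (by simp)]
    simp [B, baseIndex, Matrix.mulVec, dotProduct, Fin.sum_univ_three]
    ring
  have h1 : ∀ v : Fin 3 → ℝ, ∑ i, v i ^ 2 = v ⬝ᵥ v := fun v => by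
    simp [dotProduct, sq]
  simp only [hw]
  rw [h1, h1 fun i => w (baseIndex i), Matrix.dotProduct_mulVec, ← Matrix.mulVec_transpose,
    Matrix.mulVec_mulVec, hBB', Matrix.one_mulVec]

/-! ## Flatness -/

/-- The partial derivative in the direction `e_a`. -/
def partialDeriv (a : Fin 7) (f : E7 → ℝ) (y : E7) : ℝ := fderiv ℝ f y (stdVec a)

section PartialDeriv

variable {V : Set E7}

theorem partialDeriv_contDiffOn (hV : IsOpen V) {f : E7 → ℝ} (hf : ContDiffOn ℝ ∞ f V) (a : Fin 7) :
    ContDiffOn ℝ ∞ (partialDeriv a f) V :=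
  (hf.fderiv_of_isOpen hV (m := ∞) (by simp)).clm_apply contDiffOn_const

theorem partialDeriv_congr (hV : IsOpen V) {f g : E7 → ℝ} (h : ∀ y ∈ V, f y = g y) (a : Fin 7) :
    ∀ y ∈ V, partialDeriv a f y = partialDeriv a g y := by
  intro y hy
  have : f =ᶠ[nhds y] g := by
    filter_upwards [hV.mem_nhds hy] with z hz using h z hz
  rw [partialDeriv, partialDeriv, this.fderiv_eq]

theorem differentiableAt_of_contDiffOn (hV : IsOpen V) {f : E7 → ℝ} (hf : ContDiffOn ℝ ∞ f V) {y : E7}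
    (hy : y ∈ V) : DifferentiableAt ℝ f y :=
  (hf.contDiffAt (hV.mem_nhds hy)).differentiableAt (by simp)

/-- Besides symmetry of the second derivatives of the three functions, this is applied to their
first derivatives, where it is the integrability condition that detects curvature. -/
theorem partialDeriv_comm (hV : IsOpen V) {f : E7 → ℝ} (hf : ContDiffOn ℝ ∞ f V) (a b : Fin 7) :
    ∀ y ∈ V, partialDeriv a (partialDeriv b f) y = partialDeriv b (partialDeriv a f) y := by
  intro y hy
  have h1 : ContDiffAt ℝ ∞ f y := hf.contDiffAt (hV.mem_nhds hy)
  have h2 : DifferentiableAt ℝ (fderiv ℝ f) y :=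
    ((hf.fderiv_of_isOpen hV (m := ∞) (by simp)).contDiffAt (hV.mem_nhds hy)).differentiableAt
      (by simp)
  have h3 : ∀ a b, partialDeriv a (partialDeriv b f) y =
      fderiv ℝ (fderiv ℝ f) y (stdVec a) (stdVec b) := by
    intro a b
    change fderiv ℝ (fun z => fderiv ℝ f z (stdVec b)) y (stdVec a) = _
    rw [fderiv_clm_apply h2 (differentiableAt_const _)]
    simp
  rw [h3, h3]
  exact h1.isSymmSndFDerivAt (by rw [minSmoothness_of_isRCLikeNormedField]; exact ENat.LEInfty.out)
    _ _

theorem partialDeriv_sum_mul (hV : IsOpen V) {f g : Fin 3 → E7 → ℝ} (hf : ∀ i, ContDiffOn ℝ ∞ (f i) V)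
    (hg : ∀ i, ContDiffOn ℝ ∞ (g i) V) (a : Fin 7) {y : E7} (hy : y ∈ V) :
    partialDeriv a (fun z => ∑ i, f i z * g i z) y =
      ∑ i, (partialDeriv a (f i) y * g i y + f i y * partialDeriv a (g i) y) := by
  have h : HasFDerivAt (fun z => ∑ i, f i z * g i z) _ y := HasFDerivAt.fun_sum (u := Finset.univ) fun i _ =>
    ((differentiableAt_of_contDiffOn hV (hf i) hy).hasFDerivAt.mul
      (differentiableAt_of_contDiffOn hV (hg i) hy).hasFDerivAt)
  rw [partialDeriv, h.fderiv, _root_.sum_apply]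
  refine Finset.sum_congr rfl fun i _ => ?_
  simp [partialDeriv]
  ring

theorem partialDeriv_const_mul (hV : IsOpen V) {f : E7 → ℝ} (hf : ContDiffOn ℝ ∞ f V) (c : ℝ) (a : Fin 7)
    {y : E7} (hy : y ∈ V) : partialDeriv a (fun z => c * f z) y = c * partialDeriv a f y := by
  rw [partialDeriv, ((differentiableAt_of_contDiffOn hV hf hy).hasFDerivAt.const_mul c).fderiv]
  rfl

end PartialDeriv

theorem partialDeriv_const (a : Fin 7) (c : ℝ) (y : E7) : partialDeriv a (fun _ => c) y = 0 := by
  simp [partialDeriv]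

theorem partialDeriv_exp (a : Fin 7) (c : ℝ) (y : E7) :
    partialDeriv a (fun z => c * Real.exp (-4 * z 6)) y =
      if a = 6 then -4 * (c * Real.exp (-4 * y 6)) else 0 := by
  have h : HasFDerivAt (fun z : E7 => c * Real.exp (-4 * z 6)) _ y :=
    ((((EuclideanSpace.proj (𝕜 := ℝ) (6 : Fin 7)).hasFDerivAt (x := y)).const_mul
      (-4)).exp).const_mul c
  rw [partialDeriv, h.fderiv]
  by_cases ha : a = 6
  · subst ha; simp; ring
  · have : (6 : Fin 7) ≠ a := fun h => ha h.symm
    simp [ha, this]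

theorem eq_zero_of_orthogonal {X : Fin 3 → Fin 3 → ℝ} {d : Fin 3 → ℝ} (hd : ∀ a, d a ≠ 0)
    (hX : ∀ a b, ∑ i, X a i * X b i = if a = b then d a else 0) {z : Fin 3 → ℝ}
    (hz : ∀ a, ∑ i, z i * X a i = 0) : z = 0 := by
  have h1 : Matrix.of X * (Matrix.of X)ᵀ = Matrix.diagonal d := by
    ext a b
    rw [Matrix.mul_apply, Matrix.diagonal_apply, ← hX]
    rfl
  have h2 : (Matrix.of X).det ≠ 0 := by
    intro h0
    have := congrArg Matrix.det h1
    rw [Matrix.det_mul, h0, zero_mul, Matrix.det_diagonal] at this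
    exact Finset.prod_ne_zero_iff.2 (fun a _ => hd a) this.symm
  refine Matrix.eq_zero_of_mulVec_eq_zero h2 ?_
  funext a
  rw [Matrix.mulVec, dotProduct, Pi.zero_apply, ← hz a]
  exact Finset.sum_congr rfl fun i _ => mul_comm _ _

/-- No three functions have the hyperbolic metric `λ² (e^{-4t} (dx² + dy²) + dt²)` as the sum of
the squares of their differentials. -/
theorem not_isometric_hyperbolic {V : Set E7} (hV : IsOpen V) (hne : V.Nonempty) {m : ℝ}
    (hm : m ≠ 0) {h : Fin 3 → E7 → ℝ} (hh : ∀ i, ContDiffOn ℝ ∞ (h i) V)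
    (hg : ∀ y ∈ V, ∀ u : E7, ∑ i, fderiv ℝ (h i) y u ^ 2 =
      m * (Real.exp (-4 * y 6) * (u 0 ^ 2 + u 1 ^ 2) + u 6 ^ 2)) : False := by
  let X : Fin 7 → Fin 3 → E7 → ℝ := fun a i => partialDeriv a (h i)
  have hX : ∀ a i, ContDiffOn ℝ ∞ (X a i) V := fun a i => partialDeriv_contDiffOn hV (hh i) a
  have hsym : ∀ a b i, ∀ y ∈ V, partialDeriv a (X b i) y = partialDeriv b (X a i) y :=
    fun a b i => partialDeriv_comm hV (hh i) a b
  -- Polarization of the identity of quadratic forms, applied to e_a + e_b and e_a - e_b.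
  have hpol : ∀ y ∈ V, ∀ a b : Fin 7, ∑ i, X a i y * X b i y =
      m * (Real.exp (-4 * y 6) * ((stdVec a : E7) 0 * (stdVec b : E7) 0 +
        (stdVec a : E7) 1 * (stdVec b : E7) 1) + (stdVec a : E7) 6 * (stdVec b : E7) 6) := by
    intro y hy a b
    have h1 := hg y hy (stdVec a + stdVec b)
    have h2 := hg y hy (stdVec a - stdVec b)
    simp only [map_add, map_sub, PiLp.add_apply, PiLp.sub_apply, Fin.sum_univ_three] at h1 h2
    simp only [X, partialDeriv, Fin.sum_univ_three]
    linear_combination (1 / 4 : ℝ) * h1 - (1 / 4 : ℝ) * h2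
  have g00 : ∀ y ∈ V, ∑ i, X 0 i y * X 0 i y = m * Real.exp (-4 * y 6) := fun y hy => by
    rw [hpol y hy]; simp
  have g11 : ∀ y ∈ V, ∑ i, X 1 i y * X 1 i y = m * Real.exp (-4 * y 6) := fun y hy => by
    rw [hpol y hy]; simp
  have g66 : ∀ y ∈ V, ∑ i, X 6 i y * X 6 i y = m := fun y hy => by
    rw [hpol y hy]; simp
  have g01 : ∀ y ∈ V, ∑ i, X 0 i y * X 1 i y = 0 := fun y hy => by
    rw [hpol y hy]; simp
  have g06 : ∀ y ∈ V, ∑ i, X 0 i y * X 6 i y = 0 := fun y hy => by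
    rw [hpol y hy]; simp
  have g16 : ∀ y ∈ V, ∑ i, X 1 i y * X 6 i y = 0 := fun y hy => by
    rw [hpol y hy]; simp
  have hD : ∀ a b c, ∀ y ∈ V, partialDeriv c (fun z => ∑ i, X a i z * X b i z) y =
      ∑ i, (partialDeriv c (X a i) y * X b i y + X a i y * partialDeriv c (X b i) y) :=
    fun a b c y hy => partialDeriv_sum_mul hV (hX a) (hX b) c hy
  have horth : ∀ y ∈ V, ∀ a b : Fin 3, ∑ i, X (baseIndex a) i y * X (baseIndex b) i y =
      if a = b then (![m * Real.exp (-4 * y 6), m * Real.exp (-4 * y 6), m] : Fin 3 → ℝ) a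
        else 0 := by
    intro y hy a b
    have h10 : ∑ i, X 1 i y * X 0 i y = 0 := by
      rw [← g01 y hy]; exact Finset.sum_congr rfl fun i _ => mul_comm _ _
    have h60 : ∑ i, X 6 i y * X 0 i y = 0 := by
      rw [← g06 y hy]; exact Finset.sum_congr rfl fun i _ => mul_comm _ _
    have h61 : ∑ i, X 6 i y * X 1 i y = 0 := by
      rw [← g16 y hy]; exact Finset.sum_congr rfl fun i _ => mul_comm _ _
    fin_cases a <;> fin_cases b
    exacts [g00 y hy, g01 y hy, g06 y hy, h10, g11 y hy, g16 y hy, h60, h61, g66 y hy]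
  have hne' : ∀ y : E7, ∀ a,
      (![m * Real.exp (-4 * y 6), m * Real.exp (-4 * y 6), m] : Fin 3 → ℝ) a ≠ 0 := by
    intro y a
    have := mul_ne_zero hm (Real.exp_pos (-4 * y 6)).ne'
    fin_cases a
    exacts [this, this, hm]
  have D66 := fun c y hy => (hD 6 6 c y hy).symm.trans
    ((partialDeriv_congr hV g66 c y hy).trans (partialDeriv_const c m y))
  have D00 := fun c y hy => (hD 0 0 c y hy).symm.trans
    ((partialDeriv_congr hV g00 c y hy).trans (partialDeriv_exp c m y))
  have D06 := fun c y hy => (hD 0 6 c y hy).symm.trans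
    ((partialDeriv_congr hV g06 c y hy).trans (partialDeriv_const c 0 y))
  have D16 := fun c y hy => (hD 1 6 c y hy).symm.trans
    ((partialDeriv_congr hV g16 c y hy).trans (partialDeriv_const c 0 y))
  have D01 := fun c y hy => (hD 0 1 c y hy).symm.trans
    ((partialDeriv_congr hV g01 c y hy).trans (partialDeriv_const c 0 y))
  -- The first derivatives in the directions 0, 1, 6 form an orthogonal basis of ℝ³, and the second
  -- derivatives are expressed in it by the Christoffel symbols of the metric. Here ∇_t ∂_t = 0.
  have hX66 : ∀ i, ∀ y ∈ V, partialDeriv 6 (X 6 i) y = 0 := by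
    intro i y hy
    refine congrFun (eq_zero_of_orthogonal (X := fun a i => X (baseIndex a) i y) (hne' y)
      (horth y hy) (z := fun i => partialDeriv 6 (X 6 i) y) ?_) i
    have e6 := D66 6 y hy
    have e0 := D06 6 y hy
    have e0' := D66 0 y hy
    have e1 := D16 6 y hy
    have e1' := D66 1 y hy
    simp only [Fin.sum_univ_three, hsym 6 0 _ y hy, hsym 6 1 _ y hy] at e6 e0 e0' e1 e1'
    intro a
    rw [Fin.sum_univ_three]
    fin_cases a
    · change partialDeriv 6 (X 6 0) y * X 0 0 y + partialDeriv 6 (X 6 1) y * X 0 1 y +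
        partialDeriv 6 (X 6 2) y * X 0 2 y = 0
      linear_combination e0 - (1 / 2 : ℝ) * e0'
    · change partialDeriv 6 (X 6 0) y * X 1 0 y + partialDeriv 6 (X 6 1) y * X 1 1 y +
        partialDeriv 6 (X 6 2) y * X 1 2 y = 0
      linear_combination e1 - (1 / 2 : ℝ) * e1'
    · change partialDeriv 6 (X 6 0) y * X 6 0 y + partialDeriv 6 (X 6 1) y * X 6 1 y +
        partialDeriv 6 (X 6 2) y * X 6 2 y = 0
      linear_combination (1 / 2 : ℝ) * e6
  -- Likewise ∇_t ∂_x = -2 ∂_x, from the factor e^{-4t}.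
  have hX60 : ∀ i, ∀ y ∈ V, partialDeriv 6 (X 0 i) y = -2 * X 0 i y := by
    intro i y hy
    rw [← sub_eq_zero]
    refine congrFun (eq_zero_of_orthogonal (X := fun a i => X (baseIndex a) i y) (hne' y)
      (horth y hy) (z := fun i => partialDeriv 6 (X 0 i) y - -2 * X 0 i y) ?_) i
    have e0 := D00 6 y hy
    have e6 := D66 0 y hy
    have f1 := D06 1 y hy
    have f2 := D16 0 y hy
    have f3 := D01 6 y hy
    have n00 := g00 y hy
    have n01 := g01 y hy
    have n06 := g06 y hy
    simp only [Fin.sum_univ_three, hsym 0 6 _ y hy, hsym 1 6 _ y hy, hsym 1 0 _ y hy, if_true]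
      at e0 e6 f1 f2 f3 n00 n01 n06
    intro a
    rw [Fin.sum_univ_three]
    fin_cases a
    · change (partialDeriv 6 (X 0 0) y - -2 * X 0 0 y) * X 0 0 y +
        (partialDeriv 6 (X 0 1) y - -2 * X 0 1 y) * X 0 1 y +
        (partialDeriv 6 (X 0 2) y - -2 * X 0 2 y) * X 0 2 y = 0
      linear_combination (1 / 2 : ℝ) * e0 + 2 * n00
    · change (partialDeriv 6 (X 0 0) y - -2 * X 0 0 y) * X 1 0 y +
        (partialDeriv 6 (X 0 1) y - -2 * X 0 1 y) * X 1 1 y +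
        (partialDeriv 6 (X 0 2) y - -2 * X 0 2 y) * X 1 2 y = 0
      -- The Koszul formula for the component along the direction 1.
      linear_combination (1 / 2 : ℝ) * (f3 + f2 - f1) + 2 * n01
    · change (partialDeriv 6 (X 0 0) y - -2 * X 0 0 y) * X 6 0 y +
        (partialDeriv 6 (X 0 1) y - -2 * X 0 1 y) * X 6 1 y +
        (partialDeriv 6 (X 0 2) y - -2 * X 0 2 y) * X 6 2 y = 0
      linear_combination (1 / 2 : ℝ) * e6 + 2 * n06
  obtain ⟨y, hy⟩ := hne
  -- The third derivatives must commute, but ∂_x(∂_t ∂_t h) = 0, while ∂_t(∂_x ∂_t h) = -2 ∂_t ∂_x h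
  -- = 4 ∂_x h. So ∂_x h vanishes, against `g00`; this is the nonzero curvature of the hyperbolic
  -- metric.
  have hzero : ∀ i, X 0 i y = 0 := by
    intro i
    have h1 : partialDeriv 0 (partialDeriv 6 (X 6 i)) y = 0 := by
      rw [partialDeriv_congr hV (hX66 i) 0 y hy, partialDeriv_const]
    have h2 := partialDeriv_comm hV (hX 6 i) 0 6 y hy
    have h3 : ∀ z ∈ V, partialDeriv 0 (X 6 i) z = -2 * X 0 i z := fun z hz =>
      (hsym 0 6 i z hz).trans (hX60 i z hz)
    rw [h1, partialDeriv_congr hV h3 6 y hy, partialDeriv_const_mul hV (hX 0 i) _ _ hy,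
      hX60 i y hy] at h2
    linarith
  have := g00 y hy
  simp only [hzero, mul_zero, Finset.sum_const_zero] at this
  exact mul_ne_zero hm (Real.exp_pos _).ne' this.symm

end

noncomputable section

/-! ## Local inequivalence -/

open DiffForm Topology

theorem DiffForm.exists_equiv_of_inverse {M N : Type*} [TopologicalSpace M] [ChartedSpace E7 M]
    [TopologicalSpace N] [ChartedSpace E7 N] {f : M → N} {g : N → M} {x : M}
    (hf : MDifferentiableAt I7 I7 f x) (hg : MDifferentiableAt I7 I7 g (f x))
    (h1 : (fun y => g (f y)) =ᶠ[𝓝 x] fun y => y) (h2 : (fun y => f (g y)) =ᶠ[𝓝 (f x)] fun y => y) :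
    ∃ e : E7 ≃L[ℝ] E7, (e : E7 →L[ℝ] E7) = tangentDeriv f x := by
  have hx : g (f x) = x := h1.eq_of_nhds
  have e1 := tangentDeriv_comp hg hf
  have e2 := tangentDeriv_comp (g := f) (f := g) (x := f x) (by rwa [hx]) hg
  rw [hx, tangentDeriv_congr h2] at e2
  rw [tangentDeriv_congr h1] at e1
  have i1 : tangentDeriv (fun y : M => y) x = .id ℝ E7 := mfderiv_id
  have i2 : tangentDeriv (fun y : N => y) (f x) = .id ℝ E7 := mfderiv_id
  rw [i1] at e1
  rw [i2] at e2
  exact ⟨.equivOfInverse (tangentDeriv f x) (tangentDeriv g (f x))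
    (fun v => (DFunLike.congr_fun e1 v).symm) (fun v => (DFunLike.congr_fun e2 v).symm), rfl⟩

/-- A multiple of a linear equivalence. -/
def scaledEquiv (r : ℝ) (hr : r ≠ 0) (e : E7 ≃L[ℝ] E7) : E7 ≃L[ℝ] E7 :=
  .equivOfInverse (r • (e : E7 →L[ℝ] E7)) (r⁻¹ • (e.symm : E7 →L[ℝ] E7))
    (fun v => by simp [smul_smul, hr]) (fun v => by simp [smul_smul, hr])

theorem scaledEquiv_coe {r : ℝ} (hr : r ≠ 0) (e : E7 ≃L[ℝ] E7) :
    (scaledEquiv r hr e : E7 →L[ℝ] E7) = r • (e : E7 →L[ℝ] E7) := rfl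

/-- d(rK) = r C(K, K) = r⁻¹ C(rK, rK). -/
theorem IsCoframeOn.scaled {V : Set E7} {C : E7 →L[ℝ] E7 →L[ℝ] E7} {K : E7 → E7 ≃L[ℝ] E7}
    (h : IsCoframeOn Set.univ C K) (hV : IsOpen V) {r : ℝ} (hr : r ≠ 0) :
    IsCoframeOn V (r⁻¹ • C) fun y => scaledEquiv r hr (K y) where
  isOpen := hV
  hasFDerivAt := by
    intro y _
    simp only [scaledEquiv_coe]
    refine ((h.hasFDerivAt y trivial).const_smul r).congr_fderiv ?_
    ext u v i
    simp [hr]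

theorem form_comp_smul {k : ℕ} (α : E7 [⋀^Fin k]→L[ℝ] ℝ) (r : ℝ) (A : E7 →L[ℝ] E7) :
    α.compContinuousLinearMap (r • A) = r ^ k • α.compContinuousLinearMap A := by
  ext v
  have := α.toContinuousMultilinearMap.map_smul_univ (fun _ => r) fun a => A (v a)
  simpa [Function.comp_def] using this

theorem altWedge_smul_self {k : ℕ} (r : ℝ) (α : E7 [⋀^Fin k]→L[ℝ] ℝ) :
    altWedge (r • α) (r • α) = r ^ 2 • altWedge α α := by
  have h : altProd (r • α) (r • α) = r ^ 2 • altProd α α := by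
    ext v
    exact mul_mul_mul_comm r _ r _ |>.trans (congrArg (· * _) (sq r).symm)
  rw [altWedge, h, altWedge, smul_comm]
  congr 1
  ext v
  simp only [ContinuousMultilinearMap.alternatization_apply_apply,
    ContinuousAlternatingMap.smul_apply, smul_apply, Finset.smul_sum,
    smul_comm (r ^ 2)]

/-- No change of coordinates matches the 3-form and the torsion form of `G_J` with multiples of those
of Bryant's space. -/
theorem false_of_common_coordinates {V : Set E7} (hV : IsOpen V) (hne : V.Nonempty)
    {G : E7 → E7} (hG : ContDiffOn ℝ ∞ G V) {r : ℝ} (hr : r ≠ 0)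
    (hφ : ∀ y ∈ V, (phi0.compContinuousLinearMap (GJ.coframe (G y) : E7 →L[ℝ] E7)).compContinuousLinearMap
      (fderiv ℝ G y) = phi0.compContinuousLinearMap
        (scaledEquiv r hr (BryantSpace.coframe y) : E7 →L[ℝ] E7))
    (hτ : ∀ y ∈ V, ((formOfList tauListGJ).compContinuousLinearMap
      (GJ.coframe (G y) : E7 →L[ℝ] E7)).compContinuousLinearMap (fderiv ℝ G y) =
        (r⁻¹ • formOfList tauListBryant).compContinuousLinearMap
          (scaledEquiv r hr (BryantSpace.coframe y) : E7 →L[ℝ] E7)) : False := by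
  -- The three functions are the components of `G` along e₁, e₂, e₇; the factor r² comes from the
  -- coframe r K of Bryant's space.
  refine not_isometric_hyperbolic hV hne (m := r ^ 2) (pow_ne_zero 2 hr)
    (h := fun i y => G y (baseIndex i))
    (fun i => (EuclideanSpace.proj (𝕜 := ℝ) (baseIndex i)).contDiff.comp_contDiffOn hG) ?_
  intro y hy u
  set K := scaledEquiv r hr (BryantSpace.coframe y) with hK
  set D := (GJ.coframe (G y) : E7 →L[ℝ] E7).comp (fderiv ℝ G y) with hD
  set A := D.comp (K.symm : E7 →L[ℝ] E7) with hA
  have hcomp : ∀ {k : ℕ} {α β : E7 [⋀^Fin k]→L[ℝ] ℝ},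
      α.compContinuousLinearMap D = β.compContinuousLinearMap (K : E7 →L[ℝ] E7) →
      α.compContinuousLinearMap A = β := by
    intro k α β h
    have h1 : α.compContinuousLinearMap A =
      (α.compContinuousLinearMap D).compContinuousLinearMap (K.symm : E7 →L[ℝ] E7) := rfl
    rw [h1, h]
    ext v
    simp [Function.comp_def]
  have hA1 : phi0.compContinuousLinearMap A = phi0 := hcomp (hφ y hy)
  have hA2 : (formOfList tauListGJ).compContinuousLinearMap A = r⁻¹ • formOfList tauListBryant :=
    hcomp (hτ y hy)
  -- The squares of the torsion forms are -24 e³⁴⁵⁶ for `GJ` and -72 e³⁴⁵⁶ for Bryant's space. Their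
  -- ratio is 3, and r⁻² comes from the factor r⁻¹ of the rescaled torsion.
  have hA3 : (coordForm ![2, 3, 4, 5]).compContinuousLinearMap A =
      (3 * (r⁻¹) ^ 2) • coordForm ![2, 3, 4, 5] := by
    have h1 := altWedge_comp A (formOfList tauListGJ) (formOfList tauListGJ)
    rw [hA2] at h1
    have h2 : altWedge (r⁻¹ • formOfList tauListBryant) (r⁻¹ • formOfList tauListBryant) =
        (r⁻¹) ^ 2 • altWedge (formOfList tauListBryant) (formOfList tauListBryant) :=
          altWedge_smul_self _ _
    have h5 : altWedge (formOfList tauListGJ) (formOfList tauListGJ) = _ :=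
      isERPStructure_GJ.altWedge_tau
    have h6 : altWedge (formOfList tauListBryant) (formOfList tauListBryant) = _ :=
      isERPStructure_bryant.altWedge_tau
    rw [h2, h5, h6] at h1
    ext v
    have h7 := DFunLike.congr_fun h1 v
    simp only [ContinuousAlternatingMap.smul_apply, smul_eq_mul,
      ContinuousAlternatingMap.compContinuousLinearMap_apply] at h7 ⊢
    push_cast at h7
    linarith
  have h1 := sum_sq_base_of_map_phi0 hA1
    (mul_ne_zero three_ne_zero (pow_ne_zero 2 (inv_ne_zero hr))) hA3 (K u)
  have h2 : A (K u) = D u := by simp [hA]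
  -- The coframe of `GJ` is the identity in the directions e₁, e₂, e₇: these coframe elements are
  -- coordinate differentials, which is the flatness of the base.
  have h3 : ∀ i, D u (baseIndex i) = fderiv ℝ G y u (baseIndex i) := by
    intro i
    rw [hD]
    fin_cases i <;> rfl
  have h4 : ∀ i, fderiv ℝ (fun y => G y (baseIndex i)) y u = fderiv ℝ G y u (baseIndex i) := by
    intro i
    have h5 : DifferentiableAt ℝ G y :=
      (hG.contDiffAt (hV.mem_nhds hy)).differentiableAt (by simp)
    have h6 := (EuclideanSpace.proj (𝕜 := ℝ) (baseIndex i)).hasFDerivAt.comp y h5.hasFDerivAt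
    have h7 : fderiv ℝ (fun y => G y (baseIndex i)) y = _ := h6.fderiv
    rw [h7]
    rfl
  simp only [h4, ← h3, ← h2, h1]
  have h8 : ∀ i, K u i = r * BryantSpace.coframe y u i := fun i => by
    change (r • BryantSpace.coframe y u : E7) i = _
    simp
  have e2 : Real.exp (-(2 * y 6)) ^ 2 = Real.exp (-4 * y 6) := by
    rw [← Real.exp_nat_mul]
    congr 1
    push_cast
    ring
  simp only [Fin.sum_univ_three, h8, BryantSpace.coframe_apply, baseIndex, Matrix.cons_val,
    PiLp.toLp_apply]
  rw [← e2]
  ring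

/-! ### From a local equivalence to common coordinates. -/

section Equivalence

variable {M : Type*} [TopologicalSpace M] [ChartedSpace E7 M] [IsManifold I7 ∞ M]

/-- Composing the inverse of an equivalence with Bryant's coordinates gives a second adapted
parametrization `s₁` of the same form, with coframe r K. Since the torsion depends only on the form,
the components of φ and τ in the two parametrizations are related by the transition map `G`, and the
algebraic comparison applies. -/
theorem not_locallyEquivalentAt_bryant {s : E7 → M} {φM : DiffForm 3 M}
    (h : IsAdaptedOn Set.univ s φM (structOfList structListGJ) GJ.coframe)
    (hs : ∀ p, Set.EqOn (chartAt E7 p).symm s (chartAt E7 p).target) {c : ℝ} (hc : 0 < c)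
    (p : M) (q : BryantSpace) : ¬ LocallyEquivalentAt φM (c • BryantSpace.phi) p q := by
  rintro ⟨f, hp, -, hf⟩
  have hM1 : IsManifold I7 1 M := .of_le (n := ∞) (by simp)
  -- A 3-form scales by the cube of the coframe, so the constant c becomes the factor r = c^{1/3}.
  obtain ⟨r, hr0, hr⟩ : ∃ r : ℝ, 0 < r ∧ r ^ 3 = c :=
    ⟨c ^ (1 / 3 : ℝ), Real.rpow_pos_of_pos hc _, by
      rw [← Real.rpow_natCast, ← Real.rpow_mul hc.le]; norm_num⟩
  let s₁ : E7 → M := fun y => f.toPartialEquiv.symm (BryantSpace.coords.symm y)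
  let V₁ : Set E7 := BryantSpace.coords.symm ⁻¹' f.target
  have hV₁ : IsOpen V₁ := f.open_target.preimage BryantSpace.coords.symm.continuous
  have hmem : ∀ y ∈ V₁, s₁ y ∈ f.source := fun y hy => f.toPartialEquiv.map_target hy
  have hs₁ : ∀ y ∈ V₁, ContMDiffAt I7 I7 ∞ s₁ y := fun y hy =>
    (f.contMDiffOn_invFun.contMDiffAt (f.open_target.mem_nhds hy)).comp y
      (BryantSpace.isGlobalCoords.contMDiff_symm y)
  have hfd : ∀ x ∈ f.source, MDifferentiableAt I7 I7 f x := fun x hx =>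
    (f.contMDiffOn_toFun.contMDiffAt (f.open_source.mem_nhds hx)).mdifferentiableAt (by simp)
  have hfs : ∀ y ∈ V₁, f (s₁ y) = BryantSpace.coords.symm y := fun y hy =>
    f.toPartialEquiv.right_inv hy
  let V : Set E7 := V₁ ∩ s₁ ⁻¹' (chartAt E7 p).source
  have hs₁c : ContinuousOn s₁ V₁ := fun y hy => (hs₁ y hy).continuousAt.continuousWithinAt
  have hV : IsOpen V := hs₁c.isOpen_inter_preimage hV₁ (chartAt E7 p).open_source
  have hne : V.Nonempty := by
    refine ⟨BryantSpace.coords (f p), ?_, ?_⟩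
    · change BryantSpace.coords.symm (BryantSpace.coords (f p)) ∈ f.target
      rw [Homeomorph.symm_apply_apply]
      exact f.toPartialEquiv.map_source hp
    · change f.toPartialEquiv.symm (BryantSpace.coords.symm (BryantSpace.coords (f p))) ∈
        (chartAt E7 p).source
      rw [Homeomorph.symm_apply_apply]
      have : f.toPartialEquiv.symm (f p) = p := f.toPartialEquiv.left_inv hp
      rw [this]
      exact mem_chart_source E7 p
  have hτ4 : IsSmooth (g2Star φM three_add_four_eq φM) :=
    (h.g2Star three_add_four_eq h.pullback_eq).isSmooth GJ.contDiff_coframe hs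
  have hB : IsAdaptedOn V s₁ φM (r⁻¹ • structOfList structListBryant)
      (fun y => scaledEquiv r hr0.ne' (BryantSpace.coframe y)) :=
    { toIsCoframeOn := BryantSpace.isCoframeOn.scaled hV hr0.ne'
      contMDiffAt := fun y hy => hs₁ y hy.1
      exists_equiv := by
        intro y hy
        refine exists_equiv_of_inverse (g := fun x => BryantSpace.coords (f x))
          ((hs₁ y hy.1).mdifferentiableAt (by simp)) ?_ ?_ ?_
        · exact (BryantSpace.isGlobalCoords.contMDiff.mdifferentiableAt (by simp)).comp _
            (hfd _ (hmem y hy.1))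
        · filter_upwards [hV₁.mem_nhds hy.1] with z hz
          rw [hfs z hz, Homeomorph.apply_symm_apply]
        · filter_upwards [f.open_source.mem_nhds (hmem y hy.1)] with x hx
          change f.toPartialEquiv.symm (BryantSpace.coords.symm (BryantSpace.coords (f x))) = x
          rw [Homeomorph.symm_apply_apply]
          exact f.toPartialEquiv.left_inv hx
      pullback_eq := by
        intro y hy
        have h1 : val φM (s₁ y) = val (pullback f (c • BryantSpace.phi)) (s₁ y) :=
          hf _ (hmem y hy.1)
        rw [pullback_val, h1, ← pullback_val, ← pullback_comp (hfd _ (hmem y hy.1))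
          ((hs₁ y hy.1).mdifferentiableAt (by simp))]
        have h2 : (fun z => f (s₁ z)) =ᶠ[𝓝 y] BryantSpace.coords.symm := by
          filter_upwards [hV₁.mem_nhds hy.1] with z hz using hfs z hz
        rw [pullback_congr h2, scaledEquiv_coe, form_comp_smul, hr]
        have h3 : val (pullback BryantSpace.coords.symm (c • BryantSpace.phi)) y =
            c • val (pullback BryantSpace.coords.symm BryantSpace.phi) y := rfl
        rw [h3, BryantSpace.val_pullback_phi] }
  let G : E7 → E7 := fun y => chartAt E7 p (s₁ y)
  have hGm : ∀ y ∈ V, ContMDiffAt I7 I7 ∞ G y := fun y hy =>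
    (contMDiffAt_of_mem_maximalAtlas (IsManifold.chart_mem_maximalAtlas p) hy.2).comp y
      (hs₁ y hy.1)
  have hG : ContDiffOn ℝ ∞ G V := fun y hy =>
    (contMDiffAt_iff_contDiffAt.1 (hGm y hy)).contDiffWithinAt
  have hsG : ∀ y ∈ V, s (G y) = s₁ y := fun y hy => by
    rw [← hs p ((chartAt E7 p).map_source hy.2)]
    exact (chartAt E7 p).left_inv hy.2
  have key : ∀ {k : ℕ} {η : DiffForm k M} {α β : E7 [⋀^Fin k]→L[ℝ] ℝ},
      HasComponentsOn Set.univ s GJ.coframe η α →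
      HasComponentsOn V s₁ (fun y => scaledEquiv r hr0.ne' (BryantSpace.coframe y)) η β →
      ∀ y ∈ V, (α.compContinuousLinearMap (GJ.coframe (G y) : E7 →L[ℝ] E7)).compContinuousLinearMap
        (fderiv ℝ G y) = β.compContinuousLinearMap
          (scaledEquiv r hr0.ne' (BryantSpace.coframe y) : E7 →L[ℝ] E7) := by
    intro k η α β hα hβ y hy
    have h2 : (fun z => s (G z)) =ᶠ[𝓝 y] s₁ := by
      filter_upwards [hV.mem_nhds hy] with z hz using hsG z hz
    rw [← hβ y hy, ← pullback_congr h2, pullback_comp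
      ((h.contMDiffAt (G y) trivial).mdifferentiableAt (by simp))
      ((hGm y hy).mdifferentiableAt (by simp)), ← hα (G y) trivial, pullback_eq_fderiv]
  exact false_of_common_coordinates hV hne hG hr0.ne' (key h.pullback_eq hB.pullback_eq)
    (key (isERPStructure_GJ.torsion_eq h GJ.contDiff_coframe hs)
      (isERPStructure_bryant.torsion_smul hB hτ4))

end Equivalence

end

noncomputable section

/-! ## Arithmetic of the lattice -/

theorem latU_zero : latU 0 = 2 * Real.cos (2 * Real.pi / 15) := by
  rw [latU]; congr 2; simp; ring

/-- The double-angle formula. The numerators 1, 2, 4, 7 are doubled modulo 15 and up to sign: 8 ≡ -7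
and 14 ≡ -1. So the map x ↦ x² - 2 permutes the four numbers cyclically. -/
theorem latU_add_one (i : Fin 4) : latU (i + 1) = latU i ^ 2 - 2 := by
  have h : ∀ x y : ℝ, Real.cos x = Real.cos (2 * y) →
      2 * Real.cos x = (2 * Real.cos y) ^ 2 - 2 := by
    intro x y hxy
    rw [hxy, Real.cos_two_mul]
    ring
  fin_cases i
  · refine h _ _ (congrArg _ ?_)
    simp; ring
  · refine h _ _ (congrArg _ ?_)
    simp; ring
  · refine h _ _ ?_
    rw [← Real.cos_two_pi_sub]
    refine congrArg _ ?_
    simp; ring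
  · refine h _ _ ?_
    rw [← Real.cos_two_pi_sub]
    refine congrArg _ ?_
    simp; ring

theorem latU_injective : Function.Injective latU := by
  have h : ∀ i : Fin 4, 2 * Real.pi * ((![1, 2, 4, 7] i : ℝ) / 15) ∈ Set.Icc 0 Real.pi := by
    intro i
    have := Real.pi_pos
    fin_cases i <;> constructor <;> simp <;> linarith
  intro i j hij
  have h1 := Real.injOn_cos (h i) (h j) (mul_left_cancel₀ two_ne_zero hij)
  have h2 : (![1, 2, 4, 7] i : ℝ) = ![1, 2, 4, 7] j := by
    have := Real.pi_ne_zero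
    field_simp at h1
    exact h1
  fin_cases i <;> fin_cases j <;> first | rfl | norm_num at h2

theorem latU_sq_injective : Function.Injective fun i => latU i ^ 2 := by
  intro i j hij
  have h : latU (i + 1) = latU (j + 1) := by
    rw [latU_add_one, latU_add_one, show latU i ^ 2 = latU j ^ 2 from hij]
  exact add_right_cancel (latU_injective h)

/-- Since cos(5 · 2π/15) = -1/2, the first number is a root of x⁵ - 5x³ + 5x + 1 = (x + 1)q(x) with
q the quartic. It is not -1, which is fixed by x ↦ x² - 2. The other roots follow from q(x² - 2) =
q(x) q(-x). -/
theorem latU_quartic (i : Fin 4) :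
    latU i ^ 4 - latU i ^ 3 - 4 * latU i ^ 2 + 4 * latU i + 1 = 0 := by
  have h0 : latU 0 ^ 5 - 5 * latU 0 ^ 3 + 5 * latU 0 + 1 = 0 := by
    set c := Real.cos (2 * Real.pi / 15) with hc
    have h2 : Real.cos (5 * (2 * Real.pi / 15)) = -1 / 2 := by
      rw [show 5 * (2 * Real.pi / 15) = Real.pi - Real.pi / 3 by ring, Real.cos_pi_sub,
        Real.cos_pi_div_three]
      norm_num
    have h3 : Real.cos (5 * (2 * Real.pi / 15)) = 16 * c ^ 5 - 20 * c ^ 3 + 5 * c := by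
      rw [show 5 * (2 * Real.pi / 15) = 2 * (2 * Real.pi / 15) + 3 * (2 * Real.pi / 15) by ring,
        Real.cos_add, Real.cos_two_mul, Real.cos_three_mul, Real.sin_two_mul, Real.sin_three_mul,
        ← hc]
      have h4 := Real.sin_sq (2 * Real.pi / 15)
      rw [← hc] at h4
      linear_combination (-(6 * c) + 8 * c * (Real.sin (2 * Real.pi / 15) ^ 2 + (1 - c ^ 2))) * h4
    rw [latU_zero, ← hc]
    linear_combination 2 * (h2 - h3)
  have hne : latU 0 + 1 ≠ 0 := by
    intro h
    have h1 : latU (0 + 1) = latU 0 := by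
      rw [latU_add_one, eq_neg_of_add_eq_zero_left h]
      norm_num
    exact absurd (latU_injective h1) (by decide)
  have q0 : latU 0 ^ 4 - latU 0 ^ 3 - 4 * latU 0 ^ 2 + 4 * latU 0 + 1 = 0 :=
    mul_left_cancel₀ hne (by linear_combination h0)
  have step : ∀ j, latU j ^ 4 - latU j ^ 3 - 4 * latU j ^ 2 + 4 * latU j + 1 = 0 →
      latU (j + 1) ^ 4 - latU (j + 1) ^ 3 - 4 * latU (j + 1) ^ 2 + 4 * latU (j + 1) + 1 = 0 := by
    intro j hj
    rw [latU_add_one]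
    linear_combination (latU j ^ 4 + latU j ^ 3 - 4 * latU j ^ 2 - 4 * latU j + 1) * hj
  have q1 := step 0 q0
  have q2 := step (0 + 1) q1
  have q3 := step (0 + 1 + 1) q2
  fin_cases i
  exacts [q0, q1, q2, q3]

theorem latU_ne_zero (i : Fin 4) : latU i ≠ 0 := by
  intro h
  have := latU_quartic i
  rw [h] at this
  norm_num at this

theorem latU_sq_pos (i : Fin 4) : 0 < latU i ^ 2 := by
  have := latU_ne_zero i
  positivity

theorem latPhi_det_isUnit : IsUnit latPhi.det :=
  (Matrix.det_vandermonde_ne_zero_iff.2 latU_injective).isUnit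

theorem latA_mul_comm (i j : Fin 3) : latA i * latA j = latA j * latA i := by
  refine Subtype.ext ?_
  fin_cases i <;> fin_cases j <;> decide

/-- Column k of A_j holds the coordinates of u^k times the square of the j-th iterate of u under x ↦
x² - 2, in the basis 1, u, u², u³. Row i of ϕ evaluates this basis at u_i, so the identity is a
reduction modulo the quartic. -/
theorem latPhi_mul (j : Fin 3) : latPhi * latAReal j =
    Matrix.diagonal (fun i : Fin 4 => latU (i + j.castSucc) ^ 2) * latPhi := by
  ext i k
  rw [Matrix.diagonal_mul, Matrix.mul_apply, Fin.sum_univ_four]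
  simp only [latPhi, Matrix.vandermonde_apply]
  have h := latU_quartic i
  have h1 := latU_add_one i
  have h2 := latU_add_one (i + 1)
  rw [h1] at h2
  set x := latU i
  fin_cases j
  · have h3 : latU (i + (0 : Fin 3).castSucc) = x := by simp [x]
    change _ = latU (i + (0 : Fin 3).castSucc) ^ 2 * _
    rw [h3]
    fin_cases k <;> simp [latAReal, latA] <;> grind
  · change _ = latU (i + 1) ^ 2 * _
    rw [h1]
    fin_cases k <;> simp [latAReal, latA] <;> grind
  · change _ = latU (i + 2) ^ 2 * _
    rw [show i + 2 = i + 1 + 1 by rw [add_assoc]; rfl, h2]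
    fin_cases k <;> simp [latAReal, latA] <;> grind

theorem latPhi_conj (j : Fin 3) : latPhi * latAReal j * latPhi⁻¹ =
    Matrix.diagonal (fun i : Fin 4 => latU (i + j.castSucc) ^ 2) := by
  rw [latPhi_mul, Matrix.mul_assoc, Matrix.mul_nonsing_inv _ latPhi_det_isUnit, Matrix.mul_one]

theorem spectrum_latAReal (j : Fin 3) :
    spectrum ℝ (latAReal j) = Set.range fun i => latU i ^ 2 := by
  have h := spectrum.units_conjugate (R := ℝ) (a := latAReal j)
    (u := Matrix.nonsingInvUnit latPhi latPhi_det_isUnit)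
  have h2 : ((Matrix.nonsingInvUnit latPhi latPhi_det_isUnit)⁻¹ : (Matrix (Fin 4) (Fin 4) ℝ)ˣ) =
    (latPhi⁻¹ : Matrix (Fin 4) (Fin 4) ℝ) := rfl
  have h3 : ((Matrix.nonsingInvUnit latPhi latPhi_det_isUnit : (Matrix (Fin 4) (Fin 4) ℝ)ˣ) :
    Matrix (Fin 4) (Fin 4) ℝ) = latPhi := rfl
  rw [← h, h2, h3, latPhi_conj, spectrum_diagonal]
  ext y
  constructor
  · rintro ⟨i, rfl⟩
    exact ⟨_, rfl⟩
  · rintro ⟨i, rfl⟩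
    exact ⟨i - j.castSucc, by simp⟩


/-! ## The lattice `Λ` -/

/-- The product of the conjugates is the constant term of the quartic; this puts the logarithms of
the squares in the hyperplane of trace zero. -/
theorem latU_prod : latU 0 * latU 1 * latU 2 * latU 3 = 1 := by
  have h := latU_quartic 0
  have h1 : latU 1 = _ := latU_add_one 0
  have h2 : latU 2 = _ := latU_add_one 1
  have h3 : latU 3 = _ := latU_add_one 2
  rw [h3, h2, h1]
  grind

/-- The coordinates of `ϕ A_j ϕ⁻¹`. -/
def latLog (j : Fin 3) : E7 :=
  let L : Fin 4 → ℝ := fun i => Real.log (latU (i + j.castSucc) ^ 2)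
  !₂[(L 0 + L 2) / 2, (L 0 + L 3) / 2, 0, 0, 0, 0, (L 0 + L 1) / 2]

theorem sum_log_latU : Real.log (latU 0 ^ 2) + Real.log (latU 1 ^ 2) + Real.log (latU 2 ^ 2) +
    Real.log (latU 3 ^ 2) = 0 := by
  have h := fun i => (latU_sq_pos i).ne'
  rw [← Real.log_mul (h 0) (h 1), ← Real.log_mul (mul_ne_zero (h 0) (h 1)) (h 2),
    ← Real.log_mul (mul_ne_zero (mul_ne_zero (h 0) (h 1)) (h 2)) (h 3), ← mul_pow, ← mul_pow,
    ← mul_pow, latU_prod, one_pow, Real.log_one]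

theorem expElem_coe (x : E7) : ((expElem x : expA) : Matrix.SpecialLinearGroup (Fin 4) ℝ).1 =
    Matrix.diagonal ![Real.exp (x 6 + x 0 + x 1), Real.exp (x 6 - x 0 - x 1),
      Real.exp (-x 6 + x 0 - x 1), Real.exp (-x 6 - x 0 + x 1)] := exp_aElem x

theorem expElem_latLog (j : Fin 3) :
    ((expElem (latLog j) : expA) : Matrix.SpecialLinearGroup (Fin 4) ℝ).1 =
      latPhi * latAReal j * latPhi⁻¹ := by
  rw [expElem_coe, latPhi_conj]
  congr 1
  have hs : ∑ i : Fin 4, Real.log (latU (i + j.castSucc) ^ 2) = 0 := by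
    rw [← sum_log_latU, ← Fin.sum_univ_four fun i => Real.log (latU i ^ 2)]
    exact Fintype.sum_equiv (Equiv.addRight j.castSucc) _ _ fun _ => rfl
  rw [Fin.sum_univ_four] at hs
  ext i
  rw [← Real.exp_log (latU_sq_pos (i + j.castSucc))]
  fin_cases i
  all_goals
    refine congrArg Real.exp ?_
    simp only [latLog, PiLp.toLp_apply, Matrix.cons_val]
    simp only [Fin.mk_zero, Fin.mk_one, Fin.reduceFinMk]
    linarith

theorem expElem_latLog_mem (j : Fin 3) :
    ((expElem (latLog j) : expA) : Matrix.SpecialLinearGroup (Fin 4) ℝ) ∈ latLambda :=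
  Subgroup.subset_closure ⟨j, expElem_latLog j⟩

theorem latLambda_le_expA : latLambda ≤ expA := by
  refine (Subgroup.closure_le _).2 ?_
  rintro S ⟨j, hS⟩
  have h : S = (expElem (latLog j) : expA) := Subtype.ext (hS.trans (expElem_latLog j).symm)
  rw [h]
  exact (expElem (latLog j)).2

/-- Conjugation by ϕ carries the generators to the integral matrices A_j, and integrality with
determinant one is stable under products and inverses. This yields both discreteness and the
invariance of ϕ(ℤ⁴). -/
theorem exists_int_of_mem_latLambda {S : Matrix.SpecialLinearGroup (Fin 4) ℝ}
    (hS : S ∈ latLambda) : ∃ B : Matrix.SpecialLinearGroup (Fin 4) ℤ,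
      latPhi * B.1.map (Int.cast : ℤ → ℝ) = S.1 * latPhi := by
  have hu := latPhi_det_isUnit
  induction hS using Subgroup.closure_induction with
  | mem S h =>
    obtain ⟨j, hj⟩ := h
    refine ⟨latA j, ?_⟩
    rw [hj, Matrix.mul_assoc _ latPhi⁻¹, Matrix.nonsing_inv_mul _ hu, Matrix.mul_one]
    rfl
  | one => exact ⟨1, by simp⟩
  | mul S T _ _ hS hT =>
    obtain ⟨B, hB⟩ := hS
    obtain ⟨C, hC⟩ := hT
    refine ⟨B * C, ?_⟩
    have h : (B * C).1.map (Int.cast : ℤ → ℝ) =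
        B.1.map (Int.cast : ℤ → ℝ) * C.1.map (Int.cast : ℤ → ℝ) :=
      Matrix.map_mul (f := Int.castRingHom ℝ)
    rw [h, ← Matrix.mul_assoc, hB, Matrix.mul_assoc, hC, ← Matrix.mul_assoc]
    rfl
  | inv S _ hS =>
    obtain ⟨B, hB⟩ := hS
    refine ⟨B⁻¹, ?_⟩
    have h : B.1.map (Int.cast : ℤ → ℝ) * (B⁻¹).1.map (Int.cast : ℤ → ℝ) = 1 := by
      have h1 : (B * B⁻¹).1.map (Int.cast : ℤ → ℝ) = _ :=
        Matrix.map_mul (f := Int.castRingHom ℝ)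
      refine h1.symm.trans ?_
      simp
    have h2 : (S⁻¹).1 * S.1 = 1 := congrArg Subtype.val (inv_mul_cancel S)
    calc latPhi * (B⁻¹).1.map (Int.cast : ℤ → ℝ)
        = (S⁻¹).1 * (S.1 * latPhi) * (B⁻¹).1.map (Int.cast : ℤ → ℝ) := by
          rw [← Matrix.mul_assoc _ S.1, h2, Matrix.one_mul]
      _ = (S⁻¹).1 * latPhi := by
          rw [← hB, Matrix.mul_assoc, Matrix.mul_assoc, h, Matrix.mul_one]

theorem continuous_int_of_cast {X : Type*} [TopologicalSpace X] {f : X → ℤ}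
    (h : Continuous fun x => (f x : ℝ)) : Continuous f :=
  Int.isClosedEmbedding_coe_real.isInducing.continuous_iff.2 h

/-- The integer matrix conjugate to an element of `Λ`. -/
def latInt (S : latLambda) : Matrix.SpecialLinearGroup (Fin 4) ℤ :=
  (exists_int_of_mem_latLambda S.2).choose

theorem latPhi_mul_latInt (S : latLambda) :
    latPhi * (latInt S).1.map (Int.cast : ℤ → ℝ) = S.1.1 * latPhi :=
  (exists_int_of_mem_latLambda S.2).choose_spec

theorem latInt_map (S : latLambda) :
    (latInt S).1.map (Int.cast : ℤ → ℝ) = latPhi⁻¹ * S.1.1 * latPhi := by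
  rw [Matrix.mul_assoc, ← latPhi_mul_latInt, ← Matrix.mul_assoc,
    Matrix.nonsing_inv_mul _ latPhi_det_isUnit, Matrix.one_mul]

theorem latInt_injective : Function.Injective fun S => (latInt S).1 := by
  intro S T h
  have h1 : S.1.1 * latPhi = T.1.1 * latPhi := by
    rw [← latPhi_mul_latInt, ← latPhi_mul_latInt, show (latInt S).1 = (latInt T).1 from h]
  refine Subtype.ext (Subtype.ext ?_)
  have h2 := congrArg (· * latPhi⁻¹) h1
  simpa only [Matrix.mul_assoc, Matrix.mul_nonsing_inv _ latPhi_det_isUnit, Matrix.mul_one] using h2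

/-- The integer matrices form a discrete space, so a continuous injective map into them forces
discreteness of the source; this is the form in which both lattices are shown to be discrete. -/
theorem continuous_latInt {X : Type*} [TopologicalSpace X] {f : X → latLambda}
    (hf : Continuous fun x => (f x).1.1) : Continuous fun x => (latInt (f x)).1 := by
  refine continuous_matrix fun i j => continuous_int_of_cast ?_
  have h : ∀ x, (((latInt (f x)).1 i j : ℤ) : ℝ) = (latPhi⁻¹ * (f x).1.1 * latPhi) i j := fun x =>
    congrFun (congrFun (latInt_map (f x)) i) j
  simp only [h]
  exact ((continuous_const.matrix_mul hf).matrix_mul continuous_const).matrix_elem i j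

/-- The logarithms of the generators span 𝔞. By the cyclic symmetry their coordinates (x₁, x₂, x₇)
are (Q, R, P), (-Q, P, -R), (Q, -R, -P), with determinant -2Q(P² + R²), so only Q ≠ 0 and (P, R) ≠ 0
are needed. -/
theorem exists_expElem_eq_sum (x : E7) :
    ∃ t : Fin 3 → ℝ, expElem x = expElem (∑ j, t j • latLog j) := by
  obtain ⟨L, hL⟩ : ∃ L : Fin 4 → ℝ, L = fun i => Real.log (latU i ^ 2) := ⟨_, rfl⟩
  have hs : L 0 + L 1 + L 2 + L 3 = 0 := by rw [hL]; exact sum_log_latU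
  have hinj : Function.Injective L := by
    intro i j h
    rw [hL] at h
    exact latU_sq_injective (Real.log_injOn_pos (latU_sq_pos i) (latU_sq_pos j) h)
  -- If Q = 0 then u₁u₃ has square 1; but it satisfies x² + 3x + 1 = 0, which would force x = -2/3.
  have hQ : L 0 + L 2 ≠ 0 := by
    intro h
    have h1 : latU 0 ^ 2 * latU 2 ^ 2 = 1 := by
      have h0 := mul_pos (latU_sq_pos 0) (latU_sq_pos 2)
      refine Real.eq_one_of_pos_of_log_eq_zero h0 ?_
      rw [Real.log_mul (latU_sq_pos 0).ne' (latU_sq_pos 2).ne', ← h, hL]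
    have q := latU_quartic 0
    have q1 : latU 1 = _ := latU_add_one 0
    have q2 : latU 2 = _ := latU_add_one 1
    rw [q1] at q2
    have q3 : (latU 0 * latU 2) ^ 2 + 3 * (latU 0 * latU 2) + 1 = 0 := by
      rw [q2]
      grind
    have q4 : latU 0 * latU 2 = -2 / 3 := by linear_combination (q3 - h1) / 3
    rw [← mul_pow, q4] at h1
    norm_num at h1
  -- If P = R = 0 then `L 1 = L 3`, against the distinctness of the squares.
  have hPR : (L 0 + L 1) ^ 2 + (L 0 + L 3) ^ 2 ≠ 0 := by
    intro h
    have h1 : L 0 + L 1 = 0 := by nlinarith [sq_nonneg (L 0 + L 1), sq_nonneg (L 0 + L 3)]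
    have h3 : L 0 + L 3 = 0 := by nlinarith [sq_nonneg (L 0 + L 1), sq_nonneg (L 0 + L 3)]
    exact absurd (hinj (show L 1 = L 3 by linarith)) (by decide)
  have e0 : latLog 0 = !₂[(L 0 + L 2) / 2, (L 0 + L 3) / 2, 0, 0, 0, 0, (L 0 + L 1) / 2] := by
    rw [hL]; rfl
  have e1 : latLog 1 = !₂[(L 1 + L 3) / 2, (L 1 + L 0) / 2, 0, 0, 0, 0, (L 1 + L 2) / 2] := by
    rw [hL]; rfl
  have e2 : latLog 2 = !₂[(L 2 + L 0) / 2, (L 2 + L 1) / 2, 0, 0, 0, 0, (L 2 + L 3) / 2] := by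
    rw [hL]; rfl
  obtain ⟨Q, hQd⟩ : ∃ Q, Q = (L 0 + L 2) / 2 := ⟨_, rfl⟩
  obtain ⟨R, hRd⟩ : ∃ R, R = (L 0 + L 3) / 2 := ⟨_, rfl⟩
  obtain ⟨P, hPd⟩ : ∃ P, P = (L 0 + L 1) / 2 := ⟨_, rfl⟩
  have hQ' : Q ≠ 0 := by rw [hQd]; exact div_ne_zero hQ two_ne_zero
  have hPR' : P ^ 2 + R ^ 2 ≠ 0 := by
    rw [hPd, hRd]
    intro h
    exact hPR (by linear_combination 4 * h)
  have e0' : latLog 0 = !₂[Q, R, 0, 0, 0, 0, P] := by rw [e0, hQd, hRd, hPd]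
  have e1' : latLog 1 = !₂[-Q, P, 0, 0, 0, 0, -R] := by
    rw [e1, show (L 1 + L 3) / 2 = -Q by linarith, show (L 1 + L 0) / 2 = P by linarith,
      show (L 1 + L 2) / 2 = -R by linarith]
  have e2' : latLog 2 = !₂[Q, -R, 0, 0, 0, 0, -P] := by
    rw [e2, show (L 2 + L 0) / 2 = Q by linarith, show (L 2 + L 1) / 2 = -R by linarith,
      show (L 2 + L 3) / 2 = -P by linarith]
  -- Here `s` is the difference of the first and third coefficients and `t` the second one; the pair
  -- solves a 2 × 2 system that is a rotation up to scale, with determinant -(P² + R²).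
  let s : ℝ := (R * x 1 + P * x 6) / (P ^ 2 + R ^ 2)
  let t : ℝ := (P * x 1 - R * x 6) / (P ^ 2 + R ^ 2)
  have c1 : R * s + P * t = x 1 := by simp only [s, t]; field_simp; ring
  have c6 : P * s - R * t = x 6 := by simp only [s, t]; field_simp; ring
  refine ⟨![(x 0 / Q + t + s) / 2, t, (x 0 / Q + t - s) / 2], expElem_congr ?_ ?_ ?_⟩
  all_goals
    simp only [Fin.sum_univ_three, e0', e1', e2', PiLp.add_apply, PiLp.smul_apply, smul_eq_mul,
      Matrix.cons_val]
  · field_simp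
    ring
  · linear_combination -c1
  · linear_combination -c6

theorem expElem_sum_int_mem (n : Fin 3 → ℤ) :
    ((expElem (∑ j, (n j : ℝ) • latLog j) : expA) : Matrix.SpecialLinearGroup (Fin 4) ℝ) ∈
      latLambda := by
  let A : AddSubgroup E7 :=
    { carrier := {x | ((expElem x : expA) : Matrix.SpecialLinearGroup (Fin 4) ℝ) ∈ latLambda}
      add_mem' := by
        intro x y hx hy
        have h := latLambda.mul_mem hx hy
        rwa [← Subgroup.coe_mul, expElem_mul] at h
      zero_mem' := by
        have h : expElem 0 = 1 := by
          have h1 := expElem_mul 0 0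
          rw [add_zero] at h1
          exact mul_eq_left.1 h1
        change ((expElem 0 : expA) : Matrix.SpecialLinearGroup (Fin 4) ℝ) ∈ latLambda
        rw [h]
        exact latLambda.one_mem
      neg_mem' := by
        intro x hx
        have h : expElem (-x) = (expElem x)⁻¹ := by
          refine eq_inv_of_mul_eq_one_left ?_
          have h1 := expElem_mul 0 0
          rw [add_zero] at h1
          rw [expElem_mul, neg_add_cancel]
          exact mul_eq_left.1 h1
        change ((expElem (-x) : expA) : Matrix.SpecialLinearGroup (Fin 4) ℝ) ∈ latLambda
        rw [h]
        exact latLambda.inv_mem hx }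
  change _ ∈ A
  refine A.sum_mem fun j _ => ?_
  rw [Int.cast_smul_eq_zsmul]
  exact A.zsmul_mem (expElem_latLog_mem j) _

/-- A compact fundamental region for the action of `Λ` on `exp(𝔞)`. -/
theorem exists_mul_mem_latLambda (a : expA) : ∃ t : Fin 3 → ℝ, (∀ j, t j ∈ Set.Icc (0 : ℝ) 1) ∧
    ∃ l : expA, (l : Matrix.SpecialLinearGroup (Fin 4) ℝ) ∈ latLambda ∧
      a = expElem (∑ j, t j • latLog j) * l := by
  obtain ⟨x, hx⟩ := GJ.mat_eq ⟨a, 0⟩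
  obtain ⟨t, ht⟩ := exists_expElem_eq_sum x
  refine ⟨fun j => Int.fract (t j), fun j => ⟨Int.fract_nonneg _, (Int.fract_lt_one _).le⟩, _,
    expElem_sum_int_mem fun j => ⌊t j⌋, ?_⟩
  rw [show a = expElem x from hx, ht, expElem_mul, ← Finset.sum_add_distrib]
  simp only [← add_smul, Int.fract_add_floor]

theorem compactSpace_quotient {G : Type*} [Group G] [TopologicalSpace G] {H : Subgroup G} {K : Set G}
    (hK : IsCompact K) (h : ∀ g, ∃ k ∈ K, ∃ γ ∈ H, g = k * γ) : CompactSpace (G ⧸ H) := by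
  refine ⟨?_⟩
  have h1 := hK.image (QuotientGroup.continuous_mk (N := H))
  convert h1
  refine (Set.eq_univ_of_forall fun q => ?_).symm
  induction q using QuotientGroup.induction_on with
  | H g =>
    obtain ⟨k, hk, γ, hγ, rfl⟩ := h g
    exact ⟨k, hk, QuotientGroup.eq.2 (by simpa using hγ)⟩

theorem continuous_expElem : Continuous expElem := by
  have h : Continuous fun x => (GJ.coords.symm x).lin :=
    (continuous_fst.comp (continuous_induced_dom (f := fun g : GJ => (g.lin, g.vec)))).comp
      GJ.coords.symm.continuous
  exact h

theorem isLattice_latLambda : IsLattice (latLambda.subgroupOf expA) where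
  discrete := by
    refine DiscreteTopology.of_continuous_injective
      (f := fun S : latLambda.subgroupOf expA => (latInt ⟨S.1.1, S.2⟩).1) ?_ ?_
    · have h1 : Continuous fun S : latLambda.subgroupOf expA => S.1.1 :=
        Continuous.subtype_val continuous_subtype_val
      exact continuous_latInt (f := fun S : latLambda.subgroupOf expA => ⟨S.1.1, S.2⟩)
        (Continuous.subtype_val h1)
    · intro S T h
      have h1 := latInt_injective h
      exact Subtype.ext (Subtype.ext (congrArg (fun S : latLambda => S.1) h1))
  cocompact := by
    have hK : IsCompact ((fun t : Fin 3 → ℝ => expElem (∑ j, t j • latLog j)) ''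
        Set.pi Set.univ fun _ => Set.Icc (0 : ℝ) 1) := by
      refine (isCompact_univ_pi fun _ => isCompact_Icc).image (continuous_expElem.comp ?_)
      fun_prop
    refine compactSpace_quotient hK fun a => ?_
    obtain ⟨t, ht, l, hl, h⟩ := exists_mul_mem_latLambda a
    exact ⟨_, ⟨t, fun j _ => ht j, rfl⟩, l, hl, h⟩

end

noncomputable section

/-! ## Quotients of `G_J` by discrete subgroups -/

namespace GJ

open DiffForm Topology

variable (Γ : Subgroup GJ)

/-- The space of orbits of the left action of `Γ`. -/
abbrev LeftQuotient : Type := Quotient (QuotientGroup.rightRel Γ)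

/-- The projection `G_J → Γ \ G_J`. -/
abbrev proj : GJ → LeftQuotient Γ := Quotient.mk (QuotientGroup.rightRel Γ)

variable {Γ}

theorem proj_eq_iff {x y : GJ} : proj Γ x = proj Γ y ↔ y * x⁻¹ ∈ Γ :=
  Quotient.eq.trans QuotientGroup.rightRel_apply

theorem proj_mul {γ : GJ} (hγ : γ ∈ Γ) (x : GJ) : proj Γ (γ * x) = proj Γ x :=
  proj_eq_iff.2 (by simpa using Γ.inv_mem hγ)

theorem continuous_proj : Continuous (proj Γ) := continuous_quot_mk

theorem proj_surjective : Function.Surjective (proj Γ) := Quot.mk_surjective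

instance connectedSpace_leftQuotient : ConnectedSpace (LeftQuotient Γ) := by
  have : ConnectedSpace GJ := GJ.coords.symm.surjective.connectedSpace GJ.coords.symm.continuous
  exact (proj_surjective (Γ := Γ)).connectedSpace continuous_proj

/-- Inversion exchanges left and right cosets continuously. -/
theorem compactSpace_leftQuotient (h : CompactSpace (GJ ⧸ Γ)) : CompactSpace (LeftQuotient Γ) := by
  let f : GJ ⧸ Γ → LeftQuotient Γ := (QuotientGroup.quotientRightRelEquivQuotientLeftRel Γ).symm
  have hf : Continuous f := by
    refine continuous_quot_lift _ ?_
    exact continuous_proj.comp continuous_inv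
  exact (QuotientGroup.quotientRightRelEquivQuotientLeftRel Γ).symm.surjective.compactSpace hf

/-- A local inverse of the projection differs from the identity by an element of Γ, which is
constant near a point. So transition maps are left translations, and left-invariant forms do not see
which local inverse is used. -/
theorem exists_lift_eventuallyEq {e : OpenPartialHomeomorph GJ (LeftQuotient Γ)}
    (he : ⇑e = proj Γ) {x : GJ} (hx : proj Γ x ∈ e.target) :
    ∃ γ ∈ Γ, (fun z => e.symm (proj Γ z)) =ᶠ[𝓝 x] fun z => γ * z := by
  have h1 : proj Γ (e.symm (proj Γ x)) = proj Γ x := by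
    rw [← he]
    exact e.right_inv (by rwa [he])
  refine ⟨e.symm (proj Γ x) * x⁻¹, proj_eq_iff.1 h1.symm, ?_⟩
  have h2 : Filter.Tendsto (fun z => e.symm (proj Γ x) * x⁻¹ * z) (𝓝 x)
      (𝓝 (e.symm (proj Γ x))) := by
    have := (continuous_const_mul (e.symm (proj Γ x) * x⁻¹)).tendsto x
    rwa [inv_mul_cancel_right] at this
  filter_upwards [h2 (e.open_source.mem_nhds (e.map_target hx))] with z hz
  have h3 := e.left_inv hz
  rw [he] at h3
  rw [← proj_mul (proj_eq_iff.1 h1.symm) z]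
  exact h3

variable [DiscreteTopology Γ]

theorem t2Space_leftQuotient : T2Space (LeftQuotient Γ) := by
  have : ProperlyDiscontinuousSMul Γ GJ := Γ.properlyDiscontinuousSMul_of_tendsto_cofinite
    (Γ.tendsto_coe_cofinite_of_discrete (isDiscrete_iff_discreteTopology.2 inferInstance))
  exact t2Space_of_properlyDiscontinuousSMul_of_t2Space (Γ := Γ) (T := GJ)

theorem isLocalHomeomorph_proj : IsLocalHomeomorph (proj Γ) := by
  have h : IsQuotientCoveringMap (proj Γ) Γ :=
    IsQuotientMap.isQuotientCoveringMap_of_subgroup isQuotientMap_quot_mk Γ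
      (isDiscrete_iff_discreteTopology.2 inferInstance) proj_eq_iff
  exact h.isCoveringMap.isLocalHomeomorph

/-- The chart of `Γ \ G_J` given by a local inverse of the projection. -/
def quotientChart (e : OpenPartialHomeomorph GJ (LeftQuotient Γ)) :
    OpenPartialHomeomorph (LeftQuotient Γ) E7 :=
  e.symm.trans GJ.coords.toOpenPartialHomeomorph

variable (Γ) in
/-- A local inverse of the projection near a given point. -/
def localLift (p : LeftQuotient Γ) : OpenPartialHomeomorph GJ (LeftQuotient Γ) :=
  (isLocalHomeomorph_proj (Γ := Γ) p.out).choose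

theorem localLift_coe (p : LeftQuotient Γ) : ⇑(localLift Γ p) = proj Γ :=
  (isLocalHomeomorph_proj (Γ := Γ) p.out).choose_spec.2.symm

theorem mem_localLift_target (p : LeftQuotient Γ) : p ∈ (localLift Γ p).target := by
  have h := (localLift Γ p).map_source (isLocalHomeomorph_proj (Γ := Γ) p.out).choose_spec.1
  rwa [localLift_coe, show proj Γ p.out = p from Quotient.out_eq p] at h

instance : ChartedSpace E7 (LeftQuotient Γ) where
  atlas := {c | ∃ e : OpenPartialHomeomorph GJ (LeftQuotient Γ), ⇑e = proj Γ ∧ c = quotientChart e}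
  chartAt p := quotientChart (localLift Γ p)
  mem_chart_source p := by
    simpa [quotientChart] using mem_localLift_target p
  chart_mem_atlas p := ⟨_, localLift_coe p, rfl⟩

theorem quotientChart_mem_atlas {e : OpenPartialHomeomorph GJ (LeftQuotient Γ)}
    (he : ⇑e = proj Γ) : quotientChart e ∈ atlas E7 (LeftQuotient Γ) := ⟨e, he, rfl⟩

instance : IsManifold I7 ∞ (LeftQuotient Γ) := by
  refine isManifold_of_contDiffOn I7 ∞ _ ?_
  rintro _ _ ⟨e, he, rfl⟩ ⟨e', he', rfl⟩ y hy
  have hy' : proj Γ (GJ.coords.symm y) ∈ e'.target := by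
    have h : GJ.coords.symm y ∈ e.source ∧ proj Γ (GJ.coords.symm y) ∈ e'.target := by
      simpa [quotientChart, he] using hy.1
    exact h.2
  obtain ⟨γ, -, hγ⟩ := exists_lift_eventuallyEq he' hy'
  refine ContDiffAt.contDiffWithinAt ?_
  have h1 : ContMDiff I7 I7 ∞ fun y => GJ.coords (γ * GJ.coords.symm y) :=
    GJ.isGlobalCoords.contMDiff.comp
      ((contMDiff_mul_left (I := I7) (n := ∞) (a := γ)).comp GJ.isGlobalCoords.contMDiff_symm)
  refine (contMDiff_iff_contDiff.1 h1).contDiffAt.congr_of_eventuallyEq ?_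
  filter_upwards [GJ.coords.symm.continuous.continuousAt.eventually hγ] with z hz
  change GJ.coords (e'.symm (e (GJ.coords.symm z))) = _
  rw [he, hz]

theorem contMDiffOn_lift {e : OpenPartialHomeomorph GJ (LeftQuotient Γ)} (he : ⇑e = proj Γ) :
    ContMDiffOn I7 I7 ∞ e.symm e.target := by
  have h := contMDiffOn_of_mem_maximalAtlas (I := I7) (n := ∞)
    (IsManifold.subset_maximalAtlas (quotientChart_mem_atlas he))
  have h1 := GJ.isGlobalCoords.contMDiff_symm.comp_contMDiffOn h
  refine (h1.mono ?_).congr ?_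
  · intro p hp
    simpa [quotientChart] using hp
  · intro p _
    simp [quotientChart]

theorem contMDiff_proj : ContMDiff I7 I7 ∞ (proj Γ) := by
  intro g
  obtain ⟨e, hg, he⟩ := isLocalHomeomorph_proj (Γ := Γ) g
  have h := contMDiffAt_symm_of_mem_maximalAtlas (I := I7) (n := ∞) (x := GJ.coords g)
    (IsManifold.subset_maximalAtlas (quotientChart_mem_atlas he.symm))
    (by simpa [quotientChart] using hg)
  have h1 := h.comp g (GJ.isGlobalCoords.contMDiff g)
  refine h1.congr_of_eventuallyEq (.of_forall fun x => ?_)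
  simp [quotientChart, ← he]

theorem isLocalDiffeomorph_proj : IsLocalDiffeomorph I7 I7 ∞ (proj Γ) := by
  intro g
  obtain ⟨e, hg, he⟩ := isLocalHomeomorph_proj (Γ := Γ) g
  exact ⟨{ toPartialEquiv := e.toPartialEquiv
           open_source := e.open_source
           open_target := e.open_target
           contMDiffOn_toFun := by
             have h := (contMDiff_proj (Γ := Γ)).contMDiffOn (s := e.source)
             rwa [he] at h
           contMDiffOn_invFun := contMDiffOn_lift he.symm }, hg, fun x _ => congrFun he x⟩

theorem chart_symm_eqOn (p : LeftQuotient Γ) : Set.EqOn (chartAt E7 p).symm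
    (fun y => proj Γ (GJ.coords.symm y)) (chartAt E7 p).target := by
  intro y _
  change localLift Γ p (GJ.coords.symm y) = _
  rw [localLift_coe]

/-- The form on `Γ \ G_J` induced by a left-invariant form. -/
def descend {k : ℕ} (η : DiffForm k GJ) : DiffForm k (LeftQuotient Γ) :=
  fun p => pullback (localLift Γ p).symm η p

theorem val_descend {k : ℕ} (η : DiffForm k GJ) (p : LeftQuotient Γ) :
    val (descend η) p = val (pullback (localLift Γ p).symm η) p := by
  delta val descend
  rfl

/-- The chosen local inverse after the projection is a left translation near each point, under which
the form is invariant. -/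
theorem pullback_proj_descend {k : ℕ} {η : DiffForm k GJ}
    (hη : ∀ γ : GJ, pullback (fun h : GJ => γ * h) η = η) : pullback (proj Γ) (descend η) = η := by
  refine ext_val fun g => ?_
  have hp := mem_localLift_target (proj Γ g)
  obtain ⟨γ, -, hγ⟩ := exists_lift_eventuallyEq (localLift_coe (proj Γ g)) hp
  rw [pullback_val, val_descend, ← pullback_val, ← pullback_comp
    (((contMDiffOn_lift (localLift_coe (proj Γ g))).contMDiffAt
      ((localLift Γ (proj Γ g)).open_target.mem_nhds hp)).mdifferentiableAt (by simp))
    (contMDiff_proj.mdifferentiableAt (by simp)), pullback_congr hγ, hη]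

theorem isAdaptedOn_leftQuotient {φM : DiffForm 3 (LeftQuotient Γ)}
    (h : pullback (proj Γ) φM = GJ.phi) :
    IsAdaptedOn Set.univ (fun y => proj Γ (GJ.coords.symm y)) φM (structOfList structListGJ)
      GJ.coframe where
  toIsCoframeOn := GJ.isCoframeOn
  contMDiffAt y _ := (contMDiff_proj.comp GJ.isGlobalCoords.contMDiff_symm) y
  exists_equiv y _ := by
    set g := GJ.coords.symm y with hg
    obtain ⟨e, hge, he⟩ := isLocalHomeomorph_proj (Γ := Γ) g
    have hp : proj Γ g ∈ e.target := by
      rw [he]; exact e.map_source hge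
    refine exists_equiv_of_inverse (g := fun p => GJ.coords (e.symm p)) ?_ ?_ ?_ ?_
    · exact ((contMDiff_proj.comp GJ.isGlobalCoords.contMDiff_symm) y).mdifferentiableAt (by simp)
    · exact (GJ.isGlobalCoords.contMDiff.mdifferentiableAt (by simp)).comp _
        (((contMDiffOn_lift he.symm).contMDiffAt
          (e.open_target.mem_nhds hp)).mdifferentiableAt (by simp))
    · filter_upwards [GJ.coords.symm.continuous.continuousAt.preimage_mem_nhds
        (e.open_source.mem_nhds hge)] with z hz
      rw [he, e.left_inv hz, Homeomorph.apply_symm_apply]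
    · filter_upwards [e.open_target.mem_nhds hp] with q hq
      rw [Homeomorph.symm_apply_apply, he, e.right_inv hq]
  pullback_eq y _ := by
    rw [pullback_comp (contMDiff_proj.mdifferentiableAt (by simp))
      (GJ.isGlobalCoords.contMDiff_symm.mdifferentiableAt (by simp)), h]
    exact GJ.val_pullback_phi y

end GJ

end

noncomputable section

/-! ## The lattice `Γ = Λ ⋉ ϕ(ℤ⁴)` -/

theorem mulVec_latPhi_int {S : Matrix.SpecialLinearGroup (Fin 4) ℝ} (hS : S ∈ latLambda)
    (m : Fin 4 → ℤ) : ∃ m' : Fin 4 → ℤ,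
      S.1 *ᵥ (latPhi *ᵥ fun i => (m i : ℝ)) = latPhi *ᵥ fun i => (m' i : ℝ) := by
  obtain ⟨B, hB⟩ := exists_int_of_mem_latLambda hS
  refine ⟨B.1 *ᵥ m, ?_⟩
  rw [Matrix.mulVec_mulVec, ← hB, ← Matrix.mulVec_mulVec]
  congr 1
  ext i
  simp [Matrix.mulVec, dotProduct]

/-- The lattice `Λ ⋉ ϕ(ℤ⁴)` of `G_J`. -/
def latGamma : Subgroup GJ where
  carrier := latGammaSet
  mul_mem' := by
    rintro g h ⟨hg, m, hm⟩ ⟨hh, n, hn⟩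
    obtain ⟨n', hn'⟩ := mulVec_latPhi_int hg n
    refine ⟨latLambda.mul_mem hg hh, m + n', ?_⟩
    change g.vec + g.mat *ᵥ h.vec = _
    rw [hn]
    refine (congrArg (g.vec + ·) hn').trans ?_
    rw [hm, ← Matrix.mulVec_add]
    congr 1
    ext i
    simp
  one_mem' := ⟨latLambda.one_mem, 0, by
    change (0 : Fin 4 → ℝ) = _
    ext i
    simp [Matrix.mulVec, dotProduct]⟩
  inv_mem' := by
    rintro g ⟨hg, m, hm⟩
    obtain ⟨m', hm'⟩ := mulVec_latPhi_int (latLambda.inv_mem hg) m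
    refine ⟨latLambda.inv_mem hg, -m', ?_⟩
    change -((g.lin⁻¹ : expA) : Matrix.SpecialLinearGroup (Fin 4) ℝ).1 *ᵥ g.vec = _
    rw [Matrix.neg_mulVec, hm]
    refine (congrArg Neg.neg hm').trans ?_
    rw [← Matrix.mulVec_neg]
    congr 1
    ext i
    simp

theorem exists_int_vec (g : latGamma) : ∃ m : Fin 4 → ℤ,
    latPhi⁻¹ *ᵥ g.1.vec = fun i => (m i : ℝ) := by
  obtain ⟨m, hm⟩ := g.2.2
  refine ⟨m, ?_⟩
  rw [hm, Matrix.mulVec_mulVec, Matrix.nonsing_inv_mul _ latPhi_det_isUnit, Matrix.one_mulVec]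

/-- The integral matrix of the linear part together with the integral coordinates of the translation
part is a continuous injective invariant with discrete values. A compact fundamental region combines
the one for Λ in exp(𝔞) with the unit cube of the lattice ϕ(ℤ⁴). -/
theorem isLattice_latGamma : IsLattice latGamma where
  discrete := by
    choose v hv using exists_int_vec
    refine DiscreteTopology.of_continuous_injective
      (f := fun g : latGamma => ((latInt ⟨g.1.lin.1, g.2.1⟩).1, v g)) ?_ ?_
    · refine Continuous.prodMk ?_ ?_
      · exact continuous_latInt (f := fun g : latGamma => ⟨g.1.lin.1, g.2.1⟩)
          (GJ.continuous_mat.comp continuous_subtype_val)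
      · refine continuous_pi fun i => continuous_int_of_cast ?_
        have h1 : ∀ g, (v g i : ℝ) = (latPhi⁻¹ *ᵥ g.1.vec) i := fun g => (congrFun (hv g) i).symm
        simp only [h1]
        exact (continuous_apply i).comp (continuous_const.matrix_mulVec
          (GJ.continuous_vec.comp continuous_subtype_val))
    · intro g h hgh
      have h1 := latInt_injective (congrArg Prod.fst hgh)
      have h2 : latPhi⁻¹ *ᵥ g.1.vec = latPhi⁻¹ *ᵥ h.1.vec := by
        rw [hv, hv, show v g = v h from congrArg Prod.snd hgh]
      have h3 := congrArg (latPhi *ᵥ ·) h2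
      simp only [Matrix.mulVec_mulVec, Matrix.mul_nonsing_inv _ latPhi_det_isUnit,
        Matrix.one_mulVec] at h3
      exact Subtype.ext (LinSemidirect.ext
        (Subtype.ext (congrArg (fun S : latLambda => S.1) h1)) h3)
  cocompact := by
    let F : (Fin 3 → ℝ) × (Fin 4 → ℝ) → GJ := fun p =>
      ⟨expElem (∑ j, p.1 j • latLog j),
        (expElem (∑ j, p.1 j • latLog j)).1.1 *ᵥ (latPhi *ᵥ p.2)⟩
    have hc : Continuous fun p : (Fin 3 → ℝ) × (Fin 4 → ℝ) =>
        expElem (∑ j, p.1 j • latLog j) := continuous_expElem.comp (by fun_prop)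
    have hF : Continuous F := by
      refine continuous_induced_rng.2 (hc.prodMk ?_)
      exact (Continuous.subtype_val (Continuous.subtype_val hc)).matrix_mulVec
        (continuous_const.matrix_mulVec continuous_snd)
    have hK : IsCompact (F '' ((Set.pi Set.univ fun _ => Set.Icc (0 : ℝ) 1) ×ˢ
        (Set.pi Set.univ fun _ => Set.Icc (0 : ℝ) 1))) :=
      ((isCompact_univ_pi fun _ => isCompact_Icc).prod
        (isCompact_univ_pi fun _ => isCompact_Icc)).image hF
    refine compactSpace_quotient hK fun g => ?_
    obtain ⟨t, ht, l, hl, h⟩ := exists_mul_mem_latLambda g.lin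
    set k := expElem (∑ j, t j • latLog j) with hk
    -- The translation part is pulled back by `k` before it is split into integral and fractional
    -- parts, because in the product (k, b)(l, b') = (k l, b + k b') the linear part `k` acts on
    -- `b'`.
    let s : Fin 4 → ℝ := latPhi⁻¹ *ᵥ ((k⁻¹).1.1 *ᵥ g.vec)
    have hs : k.1.1 *ᵥ (latPhi *ᵥ s) = g.vec := by
      have h1 : k.1.1 * (k⁻¹).1.1 = 1 := congrArg (fun a : expA => a.1.1) (mul_inv_cancel k)
      simp only [s]
      rw [Matrix.mulVec_mulVec, Matrix.mulVec_mulVec, Matrix.mulVec_mulVec,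
        Matrix.mul_assoc, Matrix.mul_assoc, ← Matrix.mul_assoc latPhi,
        Matrix.mul_nonsing_inv _ latPhi_det_isUnit, Matrix.one_mul, h1, Matrix.one_mulVec]
    refine ⟨F (t, fun i => Int.fract (s i)), ⟨_, ⟨fun j _ => ht j, fun i _ =>
      ⟨Int.fract_nonneg _, (Int.fract_lt_one _).le⟩⟩, rfl⟩,
      ⟨l, latPhi *ᵥ fun i => (⌊s i⌋ : ℝ)⟩, ⟨hl, fun i => ⌊s i⌋, rfl⟩, LinSemidirect.ext h ?_⟩
    change g.vec = k.1.1 *ᵥ (latPhi *ᵥ fun i => Int.fract (s i)) +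
      k.1.1 *ᵥ (latPhi *ᵥ fun i => (⌊s i⌋ : ℝ))
    rw [← Matrix.mulVec_add, ← Matrix.mulVec_add, ← hs]
    congr 2
    ext i
    exact (Int.fract_add_floor (s i)).symm

instance : DiscreteTopology latGamma := isLattice_latGamma.discrete

/-! ## The ERP structure on the quotient -/

/-- The 3-form induced by `φ` on `Γ \ G_J`. -/
def latPhiForm : DiffForm 3 (GJ.LeftQuotient latGamma) := GJ.descend GJ.phi

theorem pullback_proj_latPhiForm : DiffForm.pullback (GJ.proj latGamma) latPhiForm = GJ.phi :=
  GJ.pullback_proj_descend GJ.pullback_mul_left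

theorem isAdaptedOn_latPhiForm : IsAdaptedOn Set.univ
    (fun y => GJ.proj latGamma (GJ.coords.symm y)) latPhiForm (structOfList structListGJ)
      GJ.coframe :=
  GJ.isAdaptedOn_leftQuotient pullback_proj_latPhiForm

theorem isERP_latPhiForm : IsERP latPhiForm :=
  isERPStructure_GJ.isERP isAdaptedOn_latPhiForm GJ.contDiff_coframe GJ.chart_symm_eqOn
    (GJ.proj_surjective.comp GJ.coords.symm.surjective)

theorem formOfList_tauListGJ_ne_zero : formOfList tauListGJ ≠ 0 := by
  intro h
  have h1 := DFunLike.congr_fun h fun a => stdVec (![2, 3] a)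
  rw [formOfList_stdVec] at h1
  have h2 : listCoeff tauListGJ ![2, 3] = -2 := by decide
  rw [h2] at h1
  norm_num at h1

theorem g2Torsion_latPhiForm_ne_zero (p : GJ.LeftQuotient latGamma) :
    g2Torsion latPhiForm p ≠ 0 := by
  intro h
  obtain ⟨g, rfl⟩ := GJ.proj_surjective p
  have h1 := isERPStructure_GJ.torsion_eq isAdaptedOn_latPhiForm GJ.contDiff_coframe
    GJ.chart_symm_eqOn (GJ.coords g) trivial
  have h2 : DiffForm.val (g2Torsion latPhiForm) (GJ.proj latGamma (GJ.coords.symm (GJ.coords g))) =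
      0 := by
    rw [Homeomorph.symm_apply_apply]
    exact h
  rw [DiffForm.pullback_val, h2] at h1
  refine formOfList_tauListGJ_ne_zero ?_
  ext v
  have h3 := DFunLike.congr_fun h1 fun i => (GJ.coframe (GJ.coords g)).symm (v i)
  simpa [Function.comp_def] using h3.symm

theorem hodgeStar_zero {V : Type*} [AddCommGroup V] [Module ℝ V] [TopologicalSpace V]
    (α : V [⋀^Fin 3]→L[ℝ] ℝ) {k l : ℕ} (hkl : k + l = 7) :
    hodgeStar α hkl (0 : V [⋀^Fin k]→L[ℝ] ℝ) = 0 := by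
  rw [hodgeStar]
  split_ifs with h
  · have h1 : (0 : V [⋀^Fin k]→L[ℝ] ℝ).compContinuousLinearMap
      ((adaptedCoords α h).symm : E7 →L[ℝ] V) = 0 := rfl
    rw [h1, star0_zero]
    rfl
  · rfl

theorem not_cleytonIvanovConjecture : ¬ CleytonIvanovConjecture := by
  intro h
  have := GJ.t2Space_leftQuotient (Γ := latGamma)
  have := GJ.compactSpace_leftQuotient isLattice_latGamma.cocompact
  -- A torsion-free form has d*φ = 0 and hence τ = 0, whereas the torsion of the quotient vanishes
  -- nowhere.
  have h2 : ¬ IsTorsionFree latPhiForm := by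
    rintro ⟨-, h2⟩
    refine g2Torsion_latPhiForm_ne_zero (GJ.proj latGamma 1) ?_
    rw [g2Torsion, h2]
    exact neg_eq_zero.2 (hodgeStar_zero _ _)
  obtain ⟨c, hc, h1⟩ := h (GJ.LeftQuotient latGamma) latPhiForm isERP_latPhiForm h2
  obtain ⟨q, hq⟩ := h1 (GJ.proj latGamma 1)
  exact not_locallyEquivalentAt_bryant isAdaptedOn_latPhiForm GJ.chart_symm_eqOn hc _ q hq

theorem mainTheorem1 :
    -- the matrices `A_j` commute, have spectrum `{u_1^2, …, u_4^2}` (four distinct positive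
    -- numbers), and are simultaneously diagonalized by the Vandermonde matrix `ϕ`
    (∀ i j, latA i * latA j = latA j * latA i) ∧
    (∀ i, 0 < latU i ^ 2) ∧ Function.Injective (fun i => latU i ^ 2) ∧
    (∀ j, spectrum ℝ (latAReal j) = Set.range (fun i => latU i ^ 2)) ∧
    IsUnit latPhi.det ∧
    (∀ j : Fin 3, latPhi * latAReal j * latPhi⁻¹ =
      Matrix.diagonal (fun i : Fin 4 => latU (i + j.castSucc) ^ 2)) ∧
    -- the matrices `ϕ A_j ϕ⁻¹` generate a lattice `Λ` of `exp(𝔞)`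
    (∀ j, ∃ S ∈ expA, (S : Matrix (Fin 4) (Fin 4) ℝ) = latPhi * latAReal j * latPhi⁻¹) ∧
    latLambda ≤ expA ∧ IsLattice (latLambda.subgroupOf expA) ∧
    -- `G_J` is a simply connected unimodular solvable Lie group, and the left-invariant form `φ`
    -- on it is an ERP `G₂`-structure
    LieGroup I7 ∞ GJ ∧ SimplyConnectedSpace GJ ∧ Group.IsSolvable GJ ∧ IsUnimodularGroup GJ ∧
    (∀ g : GJ, DiffForm.pullback (fun h : GJ => g * h) GJ.phi = GJ.phi) ∧ IsERP GJ.phi ∧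
    -- Bryant's example is an invariant ERP `G₂`-structure on `(SL₂(ℂ) ⋉ ℂ²) / SU(2)`
    IsManifold I7 ∞ BryantSpace ∧ IsERP BryantSpace.phi ∧
    MulAction.IsPretransitive SL2Aff BryantSpace ∧
    (∀ g : SL2Aff, g • BryantSpace.base = BryantSpace.base ↔
      g.mat ∈ Matrix.unitaryGroup (Fin 2) ℂ ∧ g.vec = 0) ∧
    (∀ g : SL2Aff, DiffForm.pullback (fun p : BryantSpace => g • p) BryantSpace.phi =
      BryantSpace.phi) ∧
    -- `Γ = Λ ⋉ ϕ(ℤ⁴)` is a lattice of `G_J`; the quotient by the left action of `Γ` is a compact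
    -- manifold, and `φ` descends to an ERP `G₂`-structure on it
    (∃ Γ : Subgroup GJ, (Γ : Set GJ) = latGammaSet ∧ IsLattice Γ ∧
      CompactSpace (Quotient (QuotientGroup.rightRel Γ)) ∧
      T2Space (Quotient (QuotientGroup.rightRel Γ)) ∧
      ConnectedSpace (Quotient (QuotientGroup.rightRel Γ)) ∧
      ∃ _ : ChartedSpace E7 (Quotient (QuotientGroup.rightRel Γ)),
        IsManifold I7 ∞ (Quotient (QuotientGroup.rightRel Γ)) ∧
        IsLocalDiffeomorph I7 I7 ∞ (Quotient.mk (QuotientGroup.rightRel Γ)) ∧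
        ∃ φM : DiffForm 3 (Quotient (QuotientGroup.rightRel Γ)),
          DiffForm.pullback (Quotient.mk (QuotientGroup.rightRel Γ)) φM = GJ.phi ∧
          IsERP φM ∧ (∀ p, g2Torsion φM p ≠ 0) ∧
          -- it is nowhere locally equivalent to Bryant's example, even up to scaling
          ∀ c : ℝ, 0 < c → ∀ p q, ¬ LocallyEquivalentAt φM (c • BryantSpace.phi) p q) ∧
    ¬ CleytonIvanovConjecture := by
  refine ⟨latA_mul_comm, latU_sq_pos, latU_sq_injective, spectrum_latAReal, latPhi_det_isUnit,
    latPhi_conj, fun j => ⟨_, (expElem (latLog j)).2, expElem_latLog j⟩, latLambda_le_expA,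
    isLattice_latLambda, GJ.lieGroup, GJ.simplyConnectedSpace, GJ.isSolvable, GJ.isUnimodularGroup,
    GJ.pullback_mul_left, GJ.isERP, inferInstance, BryantSpace.isERP, BryantSpace.isPretransitive,
    BryantSpace.smul_base_eq_iff, BryantSpace.pullback_smul, ⟨latGamma, rfl, isLattice_latGamma,
      GJ.compactSpace_leftQuotient isLattice_latGamma.cocompact, GJ.t2Space_leftQuotient,
      GJ.connectedSpace_leftQuotient, inferInstance, inferInstance, GJ.isLocalDiffeomorph_proj,
      latPhiForm, pullback_proj_latPhiForm, isERP_latPhiForm, g2Torsion_latPhiForm_ne_zero, ?_⟩,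
    not_cleytonIvanovConjecture⟩
  exact fun c hc p q =>
    not_locallyEquivalentAt_bryant isAdaptedOn_latPhiForm GJ.chart_symm_eqOn hc p q

end
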